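/- Let $\Bbbk$ be an algebraically closed field of characteristic $0$ and let $m,d\ge 1$ be integers. **Fractions.** Let $m_1,\dots,m_\theta$ be positive integers and let $e_i$ be the smallest positive integer with $m\mid e_im_i$. The family $\underline m=\{m_1,\dots,m_\theta\}$ is a *fraction of* $m$ if (1) $\gcd(e_i,m_i)=1$ for all $i$; (2) $m\mid m_im_j$ for all $i\ne j$; (3) $m=e_1e_2\cdots e_\theta$; (4) distinct tuples $(a_i),(b_i)$ with $0\le a_i,b_i<e_i$ satisfy $\sum_i a_im_i\not\equiv\sum_i b_im_i \pmod m$. Then every $j\in\mathbb Z$ has unique coordinates $(j_1,\dots,j_\theta)$ with $0\le j_i<e_i$ and $j\equiv\sum_i j_im_i\pmod m$. **Data.** Let $\underline m$ be a fraction of $m$ satisfying the parity conditions $$2\;\Big|\;\sum_{i=1}^\theta (m_i-1)(e_i-1),\qquad 2\;\Big|\;\sum_{i=1}^\theta (e_i-1)m_id, \tag{4.7}$$ let $\gamma\in\Bbbk$ be a primitive $m$-th root of unity, and let $\xi_{m_i}\in\Bbbk$ be square roots of $\gamma^{m_i}$ with $\xi_{m_i}^{e_i}=-1$ ($1\le i\le\theta$).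 For $j\in\mathbb Z$ put $$\phi_{m_i,j}=1-\gamma^{-m_i(m_i+j)}x^{m_id}.$$ For $s,t\in\mathbb Z$ with remainders $\bar s,\bar t\in\{0,\dots,e_i-1\}$ modulo $e_i$, put $$[s,t]_{m_i}=\begin{cases}1,& s\equiv t+1 \pmod{e_i},\\ \phi_{m_i,\bar sm_i}\phi_{m_i,(\bar s+1)m_i}\cdots\phi_{m_i,\bar tm_i},& \bar s\le\bar t \text{ and } s\not\equiv t+1\pmod{e_i},\\ \phi_{m_i,\bar sm_i}\cdots\phi_{m_i,(e_i-1)m_i}\,\phi_{m_i,0}\cdots\phi_{m_i,\bar tm_i},&\bar s\ge\bar t+2.\end{cases}$$ **The algebra.** Let $D=D(\underline m,d,\gamma)$ be the $\Bbbk$-algebra generated by $x^{\pm1},g^{\pm1},y_{m_1},\dots,y_{m_\theta},u_0,\dots,u_{m-1}$ (with $u_s:=u_j$ for $j$ the remainder of $s$ modulo $m$, and $y_s:=\prod_i y_{m_i}^{s_i}$ for $s\in\mathbb Z$ with coordinates $(s_i)$) subject to the relations $$xx^{-1}=x^{-1}x=1,\quad gg^{-1}=g^{-1}g=1,\quad xg=gx,\quad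 xy_{m_i}=y_{m_i}x,$$ $$y_{m_i}y_{m_k}=y_{m_k}y_{m_i},\quad y_{m_i}g=\gamma^{m_i}gy_{m_i},\quad y_{m_i}^{e_i}=1-x^{e_im_id},\quad g^m=x^{md},$$ $$xu_j=u_jx^{-1},\quad y_{m_i}u_j=\phi_{m_i,j}u_{j+m_i}=\xi_{m_i}x^{m_id}u_jy_{m_i},\quad u_jg=\gamma^jx^{-2d}gu_j,$$ $$u_ju_l=(-1)^{\sum_il_i}\,\gamma^{\sum_i m_i^2\frac{l_i(l_i+1)}2}\,\frac1m\,x^{-\frac{2+\sum_i(e_i-1)m_i}{2}d}\Big(\prod_{i=1}^\theta\xi_{m_i}^{-l_i}[j_i,e_i-2-l_i]_{m_i}\Big)y_{j+l}\,g$$ for $1\le i,k\le\theta$ and $0\le j,l\le m-1$. **Proposition.** The algebra $D$ is a Hopf algebra (with bijective antipode), with coproduct, counit and antipode given on the generators by $$\Delta(x)=x\otimes x,\quad \Delta(g)=g\otimes g,\quad \Delta(y_{m_i})=y_{m_i}\otimes g^{m_i}+1\otimes y_{m_i},\quad \Delta(u_j)=\sum_{k=0}^{m-1}\gamma^{k(j-k)}u_k\otimes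 x^{-kd}g^ku_{j-k},$$ $$\epsilon(x)=\epsilon(g)=\epsilon(u_0)=1,\qquad \epsilon(y_{m_i})=0,\qquad \epsilon(u_s)=0\ \ (1\le s\le m-1),$$ $$S(x)=x^{-1},\quad S(g)=g^{-1},\quad S(y_{m_i})=-y_{m_i}g^{-m_i},$$ $$S(u_j)=(-1)^{\sum_ij_i}\,\gamma^{-\sum_i m_i^2\frac{j_i(j_i+1)}2}\,x^{\,b+\sum_ij_im_id}\,g^{\,m-1-\sum_ij_im_i}\Big(\prod_{i=1}^\theta\xi_{m_i}^{-j_i}\Big)u_j,$$ where $b=(1-m)d-\frac{\sum_i(e_i-1)m_i}{2}d$, for $1\le i\le\theta$ and $0\le j\le m-1$. -/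

import Mathlib

open scoped TensorProduct

namespace FracHopf

/-- The exponent of `a` with respect to `m`: the smallest positive integer `e` with `m ∣ e * a`. -/
noncomputable def exponent (m a : ℕ) : ℕ := sInf {e : ℕ | 0 < e ∧ m ∣ e * a}

/-- The (positive) natural numbers `M 0, …, M (θ - 1)` form a fraction of `m` of length `θ`. -/
structure IsFraction (m : ℕ) {θ : ℕ} (M : Fin θ → ℕ) : Prop where
  pos : 0 < m
  pos_apply : ∀ i, 0 < M i
  coprime : ∀ i, Nat.Coprime (exponent m (M i)) (M i)
  dvd_mul : ∀ i j, i ≠ j → m ∣ M i * M j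
  prod_exponent : m = ∏ i, exponent m (M i)
  injective : ∀ a b : Fin θ → ℕ, (∀ i, a i < exponent m (M i)) →
    (∀ i, b i < exponent m (M i)) → a ≠ b → ¬ (∑ i, a i * M i ≡ ∑ i, b i * M i [MOD m])

/-- For a fraction of `m`, every residue `j` modulo `m` has exactly one coordinate vector
`(j_1, …, j_θ)` with `0 ≤ j_i < e_i` and `j ≡ ∑ j_i m_i` modulo `m`. -/
theorem IsFraction.existsUnique_coord {m θ : ℕ} {M : Fin θ → ℕ} (h : IsFraction m M)
    (j : ZMod m) : ∃! a : Fin θ → ℕ, (∀ i, a i < exponent m (M i)) ∧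
      ((∑ i, a i * M i : ℕ) : ZMod m) = j := by
  have : NeZero m := ⟨h.pos.ne'⟩
  let f : (∀ i : Fin θ, Fin (exponent m (M i))) → ZMod m :=
    fun a => ((∑ i, (a i : ℕ) * M i : ℕ) : ZMod m)
  have hinj : Function.Injective f := by
    intro a b hab
    by_contra hne
    refine h.injective (fun i => (a i : ℕ)) (fun i => (b i : ℕ)) (fun i => (a i).2)
      (fun i => (b i).2) (fun he => hne ?_) ((ZMod.natCast_eq_natCast_iff _ _ _).1 hab)
    funext i
    exact Fin.ext (congrFun he i)
  have hcard : Fintype.card (∀ i : Fin θ, Fin (exponent m (M i))) = Fintype.card (ZMod m) := by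
    rw [ZMod.card, Fintype.card_pi]
    simpa using h.prod_exponent.symm
  have hbij := (Fintype.bijective_iff_injective_and_card f).2 ⟨hinj, hcard⟩
  obtain ⟨a, ha⟩ := hbij.2 j
  refine ⟨fun i => (a i : ℕ), ⟨fun i => (a i).2, ha⟩, ?_⟩
  rintro b ⟨hb, hbj⟩
  have : (fun i => (⟨b i, hb i⟩ : Fin (exponent m (M i)))) = a := hinj (hbj.trans ha.symm)
  subst this
  rfl

open Classical in
/-- The coordinate vector `(j_1, …, j_θ)` of a residue `j` modulo `m` (the dummy value `0` is
never used for a fraction of `m`, see `coord_spec`). -/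
noncomputable def coord (m : ℕ) {θ : ℕ} (M : Fin θ → ℕ) (j : ZMod m) : Fin θ → ℕ :=
  if h : ∃ a : Fin θ → ℕ, (∀ i, a i < exponent m (M i)) ∧
      ((∑ i, a i * M i : ℕ) : ZMod m) = j
  then h.choose else 0

theorem coord_spec {m θ : ℕ} {M : Fin θ → ℕ} (h : IsFraction m M) (j : ZMod m) :
    (∀ i, coord m M j i < exponent m (M i)) ∧
      ((∑ i, coord m M j i * M i : ℕ) : ZMod m) = j := by
  have hex := (h.existsUnique_coord j).exists
  unfold coord
  rw [dif_pos hex]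
  exact hex.choose_spec

/-- The generators `x, x⁻¹, g, g⁻¹, y_{m_i}, u_j`. The index `j` of `u_j` is a residue modulo `m`,
that is, `u_s` means `u_j` for the remainder `j` of `s` modulo `m`. -/
inductive Gen (m θ : ℕ) : Type
  | x | xinv | g | ginv
  | y (i : Fin θ)
  | u (j : ZMod m)

/-- `a ^ n` for an integer `n`, where `b` plays the role of the inverse of `a`. -/
def intPow {A : Type*} [Monoid A] (a b : A) (n : ℤ) : A := a ^ n.toNat * b ^ (-n).toNat

section

variable {k : Type*} [Field k] (m d : ℕ) {θ : ℕ} (M : Fin θ → ℕ) (γ : k) (ξ : Fin θ → k)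

/-- The polynomial `φ_{m_i, j} = 1 - γ ^ (-m_i (m_i + j)) x ^ (m_i d)`. -/
noncomputable def phi (i : Fin θ) (j : ℤ) : Polynomial k :=
  1 - Polynomial.C (γ ^ (-((M i : ℤ) * (M i + j)))) * Polynomial.X ^ (M i * d)

/-- The polynomial `[s, t]_{m_i}`: the product of the factors from `φ_{m_i, s m_i}` to
`φ_{m_i, t m_i}` in the cyclic list `φ_{m_i, 0}, φ_{m_i, m_i}, …, φ_{m_i, (e_i - 1) m_i}`, where
the empty product is meant if `s ≡ t + 1` modulo `e_i`. -/
noncomputable def bracket (i : Fin θ) (s t : ℤ) : Polynomial k :=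
  let e : ℤ := exponent m (M i)
  let s' : ℕ := (s % e).toNat
  let t' : ℕ := (t % e).toNat
  if s ≡ t + 1 [ZMOD e] then 1
  else if s' ≤ t' then ∏ r ∈ Finset.Icc s' t', phi d M γ i ((r : ℤ) * M i)
  else (∏ r ∈ Finset.Ico s' (exponent m (M i)), phi d M γ i ((r : ℤ) * M i)) *
    ∏ r ∈ Finset.Icc 0 t', phi d M γ i ((r : ℤ) * M i)

/-- `∑ (e_i - 1) m_i`. -/
noncomputable def sigma : ℤ := ∑ i, ((exponent m (M i) : ℤ) - 1) * M i

/-- The scalar in the formula for `u_j u_l` (it depends on `l` only). -/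
noncomputable def mulCoeff (l : ZMod m) : k :=
  (-1) ^ (∑ i, coord m M l i) *
    γ ^ (∑ i, M i ^ 2 * (coord m M l i * (coord m M l i + 1) / 2)) * (1 / (m : k)) *
    ∏ i, ξ i ^ (-(coord m M l i : ℤ))

/-- The scalar in the formula for `S (u_j)`. -/
noncomputable def antipodeCoeff (j : ZMod m) : k :=
  (-1) ^ (∑ i, coord m M j i) *
    γ ^ (-((∑ i, M i ^ 2 * (coord m M j i * (coord m M j i + 1) / 2) : ℕ) : ℤ)) *
    ∏ i, ξ i ^ (-(coord m M j i : ℤ))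

variable (k θ) in
/-- A generator as an element of the free algebra. -/
def gen (a : Gen m θ) : FreeAlgebra k (Gen m θ) := FreeAlgebra.ι k a

/-- The monomial `y_j = ∏ y_{m_i} ^ {j_i}` in the free algebra. -/
noncomputable def yMon (j : ZMod m) : FreeAlgebra k (Gen m θ) :=
  (List.ofFn fun i => gen k m θ (.y i) ^ coord m M j i).prod

/-- The defining relations of the algebra. -/
inductive Rel : FreeAlgebra k (Gen m θ) → FreeAlgebra k (Gen m θ) → Prop
  | x_mul_xinv : Rel (gen k m θ .x * gen k m θ .xinv) 1
  | xinv_mul_x : Rel (gen k m θ .xinv * gen k m θ .x) 1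
  | g_mul_ginv : Rel (gen k m θ .g * gen k m θ .ginv) 1
  | ginv_mul_g : Rel (gen k m θ .ginv * gen k m θ .g) 1
  | x_g : Rel (gen k m θ .x * gen k m θ .g) (gen k m θ .g * gen k m θ .x)
  | x_y (i : Fin θ) :
      Rel (gen k m θ .x * gen k m θ (.y i)) (gen k m θ (.y i) * gen k m θ .x)
  | y_y (i j : Fin θ) :
      Rel (gen k m θ (.y i) * gen k m θ (.y j)) (gen k m θ (.y j) * gen k m θ (.y i))
  | y_g (i : Fin θ) :
      Rel (gen k m θ (.y i) * gen k m θ .g) (γ ^ M i • (gen k m θ .g * gen k m θ (.y i)))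
  | y_pow (i : Fin θ) :
      Rel (gen k m θ (.y i) ^ exponent m (M i))
        (1 - gen k m θ .x ^ (exponent m (M i) * M i * d))
  | g_pow : Rel (gen k m θ .g ^ m) (gen k m θ .x ^ (m * d))
  | x_u (j : ZMod m) :
      Rel (gen k m θ .x * gen k m θ (.u j)) (gen k m θ (.u j) * gen k m θ .xinv)
  | y_u (i : Fin θ) (j : ZMod m) :
      Rel (gen k m θ (.y i) * gen k m θ (.u j))
        (Polynomial.aeval (gen k m θ .x) (phi d M γ i j.val) * gen k m θ (.u (j + (M i : ZMod m))))
  | y_u' (i : Fin θ) (j : ZMod m) :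
      Rel (gen k m θ (.y i) * gen k m θ (.u j))
        (ξ i • (gen k m θ .x ^ (M i * d) * gen k m θ (.u j) * gen k m θ (.y i)))
  | u_g (j : ZMod m) :
      Rel (gen k m θ (.u j) * gen k m θ .g)
        (γ ^ j.val • (gen k m θ .xinv ^ (2 * d) * gen k m θ .g * gen k m θ (.u j)))
  | u_u (j l : ZMod m) :
      Rel (gen k m θ (.u j) * gen k m θ (.u l))
        (mulCoeff m M γ ξ l •
          (intPow (gen k m θ .x) (gen k m θ .xinv) (-((2 + sigma m M) * d / 2)) *
            Polynomial.aeval (gen k m θ .x)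
              (∏ i, bracket m d M γ i (coord m M j i)
                ((exponent m (M i) : ℤ) - 2 - coord m M l i)) *
            yMon m M (j + l) * gen k m θ .g))

/-- The algebra `D(m̲, d, γ)` (for the chosen square roots `ξ_i` of `γ ^ m_i`): the quotient of the
free algebra on the generators by the two-sided ideal generated by the relations. -/
abbrev D : Type _ := RingQuot (Rel m d M γ ξ)

/-- The image of a generator in `D(m̲, d, γ)`. -/
noncomputable def D.of (a : Gen m θ) : D m d M γ ξ :=
  RingQuot.mkAlgHom k (Rel m d M γ ξ) (gen k m θ a)

/-- The coproduct, counit and antipode of a Hopf algebra `A` are given by the prescribed formulas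
on the elements `x, x⁻¹, g, g⁻¹, y_{m_i}, u_j` of `A`, and the antipode is bijective. -/
structure HasStructureMaps {A : Type*} [Ring A] [HopfAlgebra k A]
    (x xinv g ginv : A) (y : Fin θ → A) (u : ZMod m → A) : Prop where
  comul_x : Coalgebra.comul (R := k) x = x ⊗ₜ[k] x
  comul_g : Coalgebra.comul (R := k) g = g ⊗ₜ[k] g
  comul_y : ∀ i, Coalgebra.comul (R := k) (y i) = y i ⊗ₜ[k] (g ^ M i) + 1 ⊗ₜ[k] y i
  comul_u : ∀ j : ZMod m, Coalgebra.comul (R := k) (u j) =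
    ∑ s ∈ Finset.range m, γ ^ ((s : ℤ) * ((j.val : ℤ) - s)) •
      (u (s : ZMod m) ⊗ₜ[k] (xinv ^ (s * d) * g ^ s * u (j - (s : ZMod m))))
  counit_x : Coalgebra.counit (R := k) x = 1
  counit_g : Coalgebra.counit (R := k) g = 1
  counit_y : ∀ i, Coalgebra.counit (R := k) (y i) = 0
  counit_u_zero : Coalgebra.counit (R := k) (u 0) = 1
  counit_u : ∀ j : ZMod m, j ≠ 0 → Coalgebra.counit (R := k) (u j) = 0
  antipode_x : HopfAlgebra.antipode k x = xinv
  antipode_g : HopfAlgebra.antipode k g = ginv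
  antipode_y : ∀ i, HopfAlgebra.antipode k (y i) = -(y i * ginv ^ M i)
  antipode_u : ∀ j : ZMod m, HopfAlgebra.antipode k (u j) =
    antipodeCoeff m M γ ξ j •
      (intPow x xinv ((1 - (m : ℤ)) * d - sigma m M * d / 2
          + ∑ i, (coord m M j i : ℤ) * M i * d) *
        intPow g ginv ((m : ℤ) - 1 - ∑ i, (coord m M j i : ℤ) * M i) * u j)
  antipode_bijective : Function.Bijective (HopfAlgebra.antipode k : A → A)

end

end FracHopf

/-!
The algebra `D(m̲, d, γ)` is given by generators and relations, so the coproduct, the counit and the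
antipode are obtained by checking that their prescribed values satisfy the defining relations in
`D ⊗ D`, in `k` and in the opposite algebra of `D`; the Hopf algebra axioms then only have to be
checked on generators. The relations are brought to a form in which all three checks are finite
manipulations of characters of `ZMod m` and of Gaussian binomial coefficients.

* The element `h = x⁻ᵈ g` commutes with `x` and satisfies `h ^ m = 1`, and all commutation rules of
  `h` are given by the character `χ a = γ ^ a` of `ZMod m`. As `m ∣ m_i m_j` for `i ≠ j`, one has
  `χ (a b) = ∏ q_i ^ (a_i b_i)` with `q_i = γ ^ (m_i ^ 2)`, a primitive `e_i`-th root of unity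
  (`Datum.χ_mul`, `Datum.q_prim`). The scalar in the formula for `u_j u_l` is `C l / m`, where
  `C (a + b) = C a * C b * χ (a b)` (`Datum.C_add`), and the scalar in the formula for `S (u_j)` is
  `A j = χ (-j) / C j`.
* A truncated `q`-binomial series (`prod_one_sub_eq_sum_gauss`) expands the product of brackets in
  the formula for `u_j u_l` as `∑ s, G (j + l) s * χ (-j s) * x ^ (|s| d)`, where
  `|s| = ∑ s_i m_i` and `G n s` is the product of the Gaussian binomials `(n_i + s_i choose s_i)` at
  `q_i` (`Datum.prod_bracket_eq_sum`). These vanish as soon as `n_i + s_i ≥ e_i` for some `i`, so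
  that `|n + s| = |n| + |s|` whenever `G n s ≠ 0`.
* A family satisfying the rewritten relations is a `Model`; models in `A` define algebra
  homomorphisms `D → A` (`Model.lift`), and `D` is itself a model (`Datum.self`). A model in `A`
  yields one in `A ⊗ A` (`Model.tensor`) and one in the opposite algebra (`Model.antipode`).
* The difficult relation is the one for `u_j u_l`. For the coproduct, orthogonality of characters
  removes one summation and the trinomial identity `G n s * G (N - n) (n + s) = G N s * B N n`
  (`Datum.G_mul_G`) matches the result with the `q`-binomial expansion of the coproduct of a
  monomial in the `y_i` (`Model.comulU_mul_comulU`). For the antipode, the substitution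
  `s ↦ -∑ m_i - (j + l) - s` and the reflection formula `Datum.G_complement` do the same
  (`Model.antipodeU_mul_antipodeU`).
* On `u_j`, the antipode axioms follow again from orthogonality of characters: it selects a single
  summand, whose coefficient `G j t` vanishes for `j ≠ 0` because a coordinate carries.
* The square of the antipode is an inner automorphism (`Model.antipodeMap_antipodeMap`), hence the
  antipode is bijective.
-/

namespace FracHopf

/-! ### Gaussian binomial coefficients -/

section Gauss

variable {R : Type*} [CommRing R]

/-- The `q`-integer `1 + q + ⋯ + q ^ (n - 1)`. -/
def qInt (q : R) (n : ℕ) : R := ∑ r ∈ Finset.range n, q ^ r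

/-- The `q`-factorial. -/
def qFact (q : R) (n : ℕ) : R := ∏ r ∈ Finset.range n, qInt q (r + 1)

/-- The Gaussian binomial coefficient, defined by Pascal's recursion. -/
def gauss (q : R) : ℕ → ℕ → R
  | _, 0 => 1
  | 0, _ + 1 => 0
  | n + 1, r + 1 => gauss q n r + q ^ (r + 1) * gauss q n (r + 1)

@[simp] theorem gauss_zero_right (q : R) (n : ℕ) : gauss q n 0 = 1 := by
  cases n <;> rfl

theorem gauss_succ_succ (q : R) (n r : ℕ) :
    gauss q (n + 1) (r + 1) = gauss q n r + q ^ (r + 1) * gauss q n (r + 1) := rfl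

theorem gauss_of_lt (q : R) {n r : ℕ} (h : n < r) : gauss q n r = 0 := by
  induction n generalizing r with
  | zero => cases r with
    | zero => omega
    | succ r => rfl
  | succ n ih => cases r with
    | zero => omega
    | succ r => rw [gauss_succ_succ, ih (by omega), ih (by omega)]; simp

@[simp] theorem gauss_self (q : R) (n : ℕ) : gauss q n n = 1 := by
  induction n with
  | zero => rfl
  | succ n ih => rw [gauss_succ_succ, ih, gauss_of_lt q (Nat.lt_succ_self n)]; simp

theorem qInt_add (q : R) (a b : ℕ) : qInt q (a + b) = qInt q a + q ^ a * qInt q b := by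
  simp only [qInt, Finset.sum_range_add, Finset.mul_sum, pow_add]

@[simp] theorem qInt_zero (q : R) : qInt q 0 = 0 := by simp [qInt]

@[simp] theorem qFact_zero (q : R) : qFact q 0 = 1 := by simp [qFact]

theorem qFact_succ (q : R) (n : ℕ) : qFact q (n + 1) = qFact q n * qInt q (n + 1) := by
  simp [qFact, Finset.prod_range_succ]

/-- The factorial formula for the Gaussian binomials, valid without any division. -/
theorem gauss_mul_qFact (q : R) (a b : ℕ) :
    gauss q (a + b) a * (qFact q a * qFact q b) = qFact q (a + b) := by
  obtain ⟨n, hn⟩ : ∃ n, a + b = n := ⟨_, rfl⟩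
  induction n generalizing a b with
  | zero =>
    obtain ⟨rfl, rfl⟩ : a = 0 ∧ b = 0 := by omega
    simp
  | succ n ih =>
    rcases a with _ | a
    · simp
    rcases b with _ | b
    · simp
    have h1 := ih a (b + 1) (by omega)
    have h2 := ih (a + 1) b (by omega)
    have h3 : qInt q (a + (b + 1) + 1) = qInt q (a + 1) + q ^ (a + 1) * qInt q (b + 1) := by
      rw [← qInt_add]; congr 1; ring
    rw [show a + 1 + b = a + (b + 1) by ring, qFact_succ q a] at h2
    rw [show a + 1 + (b + 1) = (a + (b + 1)) + 1 by ring, gauss_succ_succ, qFact_succ q (_ + _),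
      h3, qFact_succ q a]
    rw [qFact_succ q b] at h1 ⊢
    linear_combination qInt q (a + 1) * h1 + q ^ (a + 1) * qInt q (b + 1) * h2

/-- The second form of Pascal's recursion. -/
theorem gauss_succ_succ' (q : R) (b c : ℕ) :
    gauss q (b + c + 1) (b + 1) = q ^ c * gauss q (b + c) b + gauss q (b + c) (b + 1) := by
  obtain ⟨n, hn⟩ : ∃ n, b + c = n := ⟨_, rfl⟩
  rw [hn]
  induction n generalizing b c with
  | zero =>
    obtain ⟨rfl, rfl⟩ : b = 0 ∧ c = 0 := by omega
    simp [gauss_of_lt q Nat.zero_lt_one]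
  | succ n ih =>
    rcases c with _ | c
    · obtain rfl : b = n + 1 := by omega
      simp [gauss_of_lt q (Nat.lt_succ_self (n + 1))]
    rcases b with _ | b
    · have h := ih 0 c (by omega)
      have h' := gauss_succ_succ q n 0
      rw [gauss_succ_succ q (n + 1)]
      simp only [gauss_zero_right, zero_add, pow_one, mul_one] at h h' ⊢
      linear_combination q * h - h'
    · have h1 := ih b (c + 1) (by omega)
      have h2 := ih (b + 1) c (by omega)
      have h3 := gauss_succ_succ q n b
      have h4 := gauss_succ_succ q n (b + 1)
      rw [gauss_succ_succ q (n + 1)]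
      linear_combination h1 + q ^ (b + 1 + 1) * h2 - q ^ (c + 1) * h3 - h4

/-- Row recursion in the lower index. -/
theorem gauss_succ_mul_qInt (q : R) (n r : ℕ) (h : r ≤ n) :
    gauss q n (r + 1) * qInt q (r + 1) = gauss q n r * qInt q (n - r) := by
  induction n generalizing r with
  | zero =>
    obtain rfl : r = 0 := by omega
    simp [gauss_of_lt q Nat.zero_lt_one]
  | succ n ih =>
    rcases r with _ | r
    · have h0 := ih 0 (Nat.zero_le _)
      have h1 : qInt q (n + 1) = qInt q 1 + q * qInt q n := by
        rw [add_comm, qInt_add]; simp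
      have h2 : qInt q 1 = 1 := by simp [qInt]
      rw [gauss_succ_succ]
      simp only [gauss_zero_right, zero_add, Nat.sub_zero, pow_one, h1, h2] at h0 ⊢
      linear_combination q * h0
    · have ha := ih r (by omega)
      rcases Nat.lt_or_ge n (r + 1) with hn | hn
      · obtain rfl : n = r := by omega
        simp [gauss_of_lt q (Nat.lt_succ_self (n + 1))]
      · have hb := ih (r + 1) hn
        obtain ⟨c, rfl⟩ : ∃ c, n = r + 1 + c := ⟨n - (r + 1), by omega⟩
        rw [gauss_succ_succ, gauss_succ_succ]
        rw [show r + 1 + c - r = c + 1 by omega] at ha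
        rw [show r + 1 + c - (r + 1) = c by omega] at hb
        rw [show r + 1 + c + 1 - (r + 1) = c + 1 by omega]
        have h1 : qInt q (r + 1 + 1) = qInt q (r + 1) + q ^ (r + 1) * 1 := by
          rw [qInt_add]; simp [qInt]
        have h3 : qInt q (c + 1) = 1 + q * qInt q c := by
          rw [add_comm, qInt_add]; simp [qInt]
        generalize gauss q (r + 1 + c) (r + 1 + 1) = g2 at *
        generalize gauss q (r + 1 + c) (r + 1) = g1 at *
        generalize gauss q (r + 1 + c) r = g0 at *
        generalize qInt q (r + 1 + 1) = i2 at *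
        generalize qInt q (r + 1) = i1 at *
        generalize qInt q (c + 1) = c1 at *
        generalize qInt q c = c0 at *
        rw [pow_succ q (r + 1)]
        generalize q ^ (r + 1) = z at *
        subst h3
        subst h1
        linear_combination z * q * hb + ha

/-- The trinomial revision identity, for non-vanishing `q`-factorials. -/
theorem gauss_mul_gauss_of_qFact [IsDomain R] (q : R) {N n s : ℕ} (hn : n ≤ N)
    (h : qFact q (N + s) ≠ 0) :
    gauss q (n + s) s * gauss q (N + s) (n + s) = gauss q (N + s) s * gauss q N n := by
  obtain ⟨c, rfl⟩ := Nat.exists_eq_add_of_le hn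
  have h1 := gauss_mul_qFact q s n
  have h2 := gauss_mul_qFact q (n + s) c
  have h3 := gauss_mul_qFact q s (n + c)
  have h4 := gauss_mul_qFact q n c
  rw [add_comm s n] at h1
  rw [show n + s + c = n + c + s by ring] at h2
  rw [add_comm s (n + c)] at h3
  have hne : qFact q s * qFact q n * qFact q c ≠ 0 := by
    intro h0
    apply h
    rw [← h2, ← h1]
    linear_combination gauss q (n + c + s) (n + s) * gauss q (n + s) s * h0
  apply mul_right_cancel₀ hne
  rw [← h4] at h3
  rw [← h1] at h2
  linear_combination h2 - h3

end Gauss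

section Root

variable {k : Type*} [Field k] {q : k} {e : ℕ}

theorem qInt_ne_zero (hq : IsPrimitiveRoot q e) {n : ℕ} (h0 : 0 < n) (h : n < e) :
    qInt q n ≠ 0 := by
  intro hz
  have h1 : qInt q n * (q - 1) = q ^ n - 1 := geom_sum_mul q n
  rw [hz, zero_mul] at h1
  exact hq.pow_ne_one_of_pos_of_lt h0.ne' h (sub_eq_zero.1 h1.symm)

theorem qInt_order (hq : IsPrimitiveRoot q e) (h : 1 < e) : qInt q e = 0 :=
  hq.geom_sum_eq_zero h

theorem qFact_ne_zero (hq : IsPrimitiveRoot q e) {n : ℕ} (h : n < e) : qFact q n ≠ 0 :=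
  Finset.prod_ne_zero_iff.2 fun r hr => qInt_ne_zero hq (Nat.succ_pos r) (by
    have := Finset.mem_range.1 hr; omega)

theorem qFact_eq_zero (hq : IsPrimitiveRoot q e) (h1 : 1 < e) {n : ℕ} (h : e ≤ n) :
    qFact q n = 0 :=
  Finset.prod_eq_zero (Finset.mem_range.2 (by omega : e - 1 < n)) (by
    rw [Nat.sub_add_cancel h1.le]; exact qInt_order hq h1)

/-- At a primitive `e`-th root of unity, a Gaussian binomial coefficient vanishes as soon as the
addition `a + b` of the two lower indices carries past `e`. -/
theorem gauss_eq_zero_of_carry (hq : IsPrimitiveRoot q e) {a b : ℕ} (ha : a < e) (hb : b < e)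
    (h : e ≤ a + b) : gauss q (a + b) a = 0 := by
  have h1 := gauss_mul_qFact q a b
  rw [qFact_eq_zero hq (by omega) h] at h1
  exact (mul_eq_zero.1 h1).resolve_right
    (mul_ne_zero (qFact_ne_zero hq ha) (qFact_ne_zero hq hb))

theorem gauss_mul_gauss (hq : IsPrimitiveRoot q e) {N n s : ℕ} (hn : n ≤ N)
    (h : N + s < e) :
    gauss q (n + s) s * gauss q (N + s) (n + s) = gauss q (N + s) s * gauss q N n :=
  gauss_mul_gauss_of_qFact q hn (qFact_ne_zero hq h)

theorem pow_mul_qInt_sub (hq : IsPrimitiveRoot q e) {r : ℕ} (h1 : 1 < e) (h : r ≤ e) :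
    q ^ r * qInt q (e - r) = -qInt q r := by
  have := qInt_add q r (e - r)
  rw [Nat.add_sub_cancel' h, qInt_order hq h1] at this
  linear_combination -this

/-- Reflection of the upper index of a Gaussian binomial coefficient at a root of unity. -/
theorem gauss_reflect (hq : IsPrimitiveRoot q e) {N s : ℕ} (h : N + s < e) :
    q ^ (N * s + N * (N + 1) / 2) * gauss q (e - 1 - s) N = (-1) ^ N * gauss q (N + s) s := by
  have hsymm : gauss q (N + s) s = gauss q (N + s) N := by
    have h1 := gauss_mul_qFact q s N
    have h2 := gauss_mul_qFact q N s
    rw [add_comm s N] at h1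
    apply mul_right_cancel₀
      (mul_ne_zero (qFact_ne_zero hq (by omega : s < e)) (qFact_ne_zero hq (by omega : N < e)))
    linear_combination h1 - h2
  rw [hsymm]
  clear hsymm
  induction N with
  | zero => simp
  | succ N ih =>
    have ih := ih (by omega)
    have hI := qInt_ne_zero hq (Nat.succ_pos N) (by omega)
    apply mul_right_cancel₀ hI
    have h1 := gauss_succ_mul_qInt q (e - 1 - s) N (by omega)
    -- raising both indices, by the factorial formula
    have h2 : gauss q (N + 1 + s) (N + 1) * qInt q (N + 1) =
        gauss q (N + s) N * qInt q (N + s + 1) := by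
      have h3 := gauss_mul_qFact q N s
      have h4 := gauss_mul_qFact q (N + 1) s
      rw [show N + 1 + s = N + s + 1 by ring, qFact_succ q (N + s), qFact_succ q N] at h4
      rw [show N + 1 + s = N + s + 1 by ring]
      apply mul_right_cancel₀
        (mul_ne_zero (qFact_ne_zero hq (by omega : N < e)) (qFact_ne_zero hq (by omega : s < e)))
      linear_combination h4 - qInt q (N + s + 1) * h3
    have h5 := pow_mul_qInt_sub hq (r := N + s + 1) (by omega) (by omega)
    rw [show e - 1 - s - N = e - (N + s + 1) by omega] at h1
    have h6 : (N + 1) * s + (N + 1) * (N + 1 + 1) / 2 =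
        N * s + N * (N + 1) / 2 + (N + s + 1) := by
      rw [show (N + 1) * (N + 1 + 1) = N * (N + 1) + (N + 1) * 2 by ring,
        Nat.add_mul_div_right _ _ (by norm_num)]
      ring
    rw [h6, pow_add, pow_succ (-1 : k) N]
    linear_combination q ^ (N * s + N * (N + 1) / 2) * q ^ (N + s + 1) * h1 + (-1) ^ N * h2
      + q ^ (N * s + N * (N + 1) / 2) * gauss q (e - 1 - s) N * h5 - qInt q (N + s + 1) * ih

/-- The product `∏_{1 ≤ r < e - n} (1 - q⁻ʳ z)` expanded in powers of `z`; equivalently, the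
truncation below `z ^ e` of the power series of `1 / ∏_{0 ≤ r ≤ n} (1 - qʳ z)`. -/
theorem prod_one_sub_eq_sum_gauss (hq : IsPrimitiveRoot q e) {A : Type*} [CommRing A]
    [Algebra k A] (z : A) {n : ℕ} (h : n < e) :
    ∏ r ∈ Finset.range (e - 1 - n), (1 - (q⁻¹ ^ (r + 1)) • z) =
      ∑ s ∈ Finset.range e, gauss q (n + s) s • z ^ s := by
  obtain ⟨c, hc⟩ : ∃ c, e = n + 1 + c := ⟨e - (n + 1), by omega⟩
  induction c generalizing n with
  | zero =>
    obtain rfl : n = e - 1 := by omega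
    rw [Nat.sub_self, Finset.range_zero, Finset.prod_empty, Finset.sum_eq_single 0]
    · simp
    · intro s hs hs0
      have hs := Finset.mem_range.1 hs
      rw [add_comm, gauss_eq_zero_of_carry hq hs (by omega) (by omega), zero_smul]
    · intro h0; exact absurd (Finset.mem_range.2 (by omega)) h0
  | succ c ih =>
    have hlt : n + 1 < e := by omega
    have hq0 : q ≠ 0 := hq.ne_zero (by omega)
    have hinv : q⁻¹ ^ (c + 1) = q ^ (n + 1) := by
      rw [inv_pow, inv_eq_iff_eq_inv, eq_comm]
      apply inv_eq_of_mul_eq_one_right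
      rw [← pow_add, show n + 1 + (c + 1) = e by omega, hq.pow_eq_one]
    rw [show e - 1 - n = c + 1 by omega, Finset.prod_range_succ, hinv]
    have ih := ih hlt (by omega)
    rw [show e - 1 - (n + 1) = c by omega] at ih
    rw [ih, mul_sub, mul_one]
    -- the top term of the shifted sum carries past `e`, hence vanishes
    have hshift : (∑ s ∈ Finset.range e, gauss q (n + 1 + s) s • z ^ s) * q ^ (n + 1) • z =
        ∑ s ∈ Finset.range e, (if s = 0 then 0 else
          q ^ (n + 1) * gauss q (n + s) (s - 1)) • z ^ s := by
      obtain ⟨f, rfl⟩ : ∃ f, e = f + 1 := ⟨e - 1, by omega⟩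
      rw [Finset.sum_range_succ, Finset.sum_range_succ']
      have htop : gauss q (n + 1 + f) f = 0 := by
        rw [add_comm]
        exact gauss_eq_zero_of_carry hq (by omega) (by omega) (by omega)
      rw [htop, zero_smul, add_zero, if_pos rfl, zero_smul, add_zero, Finset.sum_mul]
      refine Finset.sum_congr rfl fun s _ => ?_
      rw [if_neg (Nat.succ_ne_zero s), smul_mul_smul_comm, pow_succ z,
        show n + (s + 1) = n + 1 + s by ring, Nat.add_sub_cancel, mul_comm (q ^ (n + 1))]
    rw [hshift, ← Finset.sum_sub_distrib]
    refine Finset.sum_congr rfl fun s hs => ?_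
    rw [← sub_smul]
    congr 1
    rcases s with _ | s
    · simp
    · have hs := Finset.mem_range.1 hs
      rw [if_neg (Nat.succ_ne_zero s), Nat.add_sub_cancel]
      rw [show n + 1 + (s + 1) = s + (n + 1) + 1 by ring, gauss_succ_succ',
        show n + (s + 1) = s + (n + 1) by ring]
      ring

end Root

/-! ### Coordinates of residues -/

theorem exponent_spec {m : ℕ} (hm : 0 < m) (a : ℕ) :
    0 < exponent m a ∧ m ∣ exponent m a * a :=
  Nat.sInf_mem (s := {e : ℕ | 0 < e ∧ m ∣ e * a}) ⟨m, hm, dvd_mul_right m a⟩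

theorem exponent_dvd_iff {m : ℕ} (hm : 0 < m) (a t : ℕ) : exponent m a ∣ t ↔ m ∣ t * a := by
  obtain ⟨he, hd⟩ := exponent_spec hm a
  constructor
  · rintro ⟨c, rfl⟩
    rw [mul_right_comm]
    exact hd.mul_right c
  · intro h
    rw [← Nat.div_add_mod t (exponent m a), add_mul, mul_right_comm] at h
    have h2 : m ∣ t % exponent m a * a := (Nat.dvd_add_right (hd.mul_right _)).1 h
    by_contra hc
    have hpos : 0 < t % exponent m a := Nat.pos_of_ne_zero fun h0 => hc (Nat.dvd_of_mod_eq_zero h0)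
    have hle : exponent m a ≤ t % exponent m a := Nat.sInf_le ⟨hpos, h2⟩
    exact absurd (Nat.mod_lt t he) (not_lt.2 hle)

/-- The parameters of the algebra `D(m̲, d, γ)`: a fraction `M` of `m`, the exponent `d`, a primitive
`m`-th root of unity `γ`, square roots `ξ i` of `γ ^ M i`, and the second parity condition, which
makes the exponent `σ d / 2` an integer. -/
structure Datum (k : Type*) [Field k] (m θ : ℕ) where
  d : ℕ
  M : Fin θ → ℕ
  γ : k
  ξ : Fin θ → k
  isFraction : IsFraction m M
  even : (2 : ℤ) ∣ ∑ i, ((exponent m (M i) : ℤ) - 1) * M i * d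
  prim : IsPrimitiveRoot γ m
  ξ_sq : ∀ i, ξ i ^ 2 = γ ^ M i
  ξ_pow : ∀ i, ξ i ^ exponent m (M i) = -1

namespace Datum

variable {k : Type*} [Field k] {m θ : ℕ} (P : Datum k m θ)

/-- The exponent `e_i`. -/
noncomputable def e (i : Fin θ) : ℕ := exponent m (P.M i)

/-- The root of unity `q_i = γ ^ (m_i ^ 2)`. -/
def q (i : Fin θ) : k := P.γ ^ (P.M i ^ 2)

/-- The coordinate `j_i` of a residue `j`. -/
noncomputable def co (j : ZMod m) (i : Fin θ) : ℕ := coord m P.M j i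

/-- The weight `|j| = ∑ j_i m_i`, a natural number representing the residue `j`. -/
noncomputable def deg (j : ZMod m) : ℕ := ∑ i, P.co j i * P.M i

theorem e_pos (i : Fin θ) : 0 < P.e i := (exponent_spec P.isFraction.pos _).1

theorem co_lt (j : ZMod m) (i : Fin θ) : P.co j i < P.e i := (coord_spec P.isFraction j).1 i

theorem deg_cast (j : ZMod m) : (P.deg j : ZMod m) = j := (coord_spec P.isFraction j).2

theorem sum_co (j : ZMod m) : ∑ i, (P.co j i : ZMod m) * P.M i = j := by
  simpa [deg] using P.deg_cast j

theorem e_mul_M (i : Fin θ) : (P.e i : ZMod m) * P.M i = 0 := by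
  rw [← Nat.cast_mul, ZMod.natCast_eq_zero_iff]
  exact (exponent_spec P.isFraction.pos _).2

theorem M_mul_M {i j : Fin θ} (h : i ≠ j) : (P.M i : ZMod m) * P.M j = 0 := by
  rw [← Nat.cast_mul, ZMod.natCast_eq_zero_iff]
  exact P.isFraction.dvd_mul i j h

theorem co_sum (a : Fin θ → ℕ) (i : Fin θ) :
    P.co (∑ i, (a i : ZMod m) * P.M i) i = a i % P.e i := by
  obtain ⟨b, -, hb⟩ := P.isFraction.existsUnique_coord (∑ i, (a i : ZMod m) * P.M i)
  have h1 := hb (fun i => P.co (∑ i, (a i : ZMod m) * P.M i) i)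
    ⟨fun i => P.co_lt _ i, P.deg_cast _⟩
  have h2 := hb (fun i => a i % P.e i) ⟨fun i => Nat.mod_lt _ (P.e_pos i), by
    rw [Nat.cast_sum]
    refine Finset.sum_congr rfl fun i _ => ?_
    conv_rhs => rw [← Nat.div_add_mod (a i) (P.e i)]
    push_cast
    linear_combination -(a i / P.e i : ℕ) * P.e_mul_M i⟩
  exact congrFun (h1.trans h2.symm) i

theorem co_add (a b : ZMod m) (i : Fin θ) : P.co (a + b) i = (P.co a i + P.co b i) % P.e i := by
  rw [← P.co_sum (fun i => P.co a i + P.co b i)]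
  congr 1
  conv_lhs => rw [← P.sum_co a, ← P.sum_co b]
  rw [← Finset.sum_add_distrib]
  refine Finset.sum_congr rfl fun i _ => ?_
  push_cast
  ring

@[simp] theorem co_zero (i : Fin θ) : P.co 0 i = 0 := by
  have := P.co_sum (fun _ => 0) i
  simpa using this

theorem co_M (i j : Fin θ) : P.co (P.M i) j = (if j = i then 1 else 0) % P.e j := by
  rw [← P.co_sum (fun j => if j = i then 1 else 0)]
  simp

theorem co_ext {a b : ZMod m} (h : ∀ i, P.co a i = P.co b i) : a = b := by
  rw [← P.sum_co a, ← P.sum_co b]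
  simp only [h]

theorem co_add_of_lt {a b : ZMod m} {i : Fin θ} (h : P.co a i + P.co b i < P.e i) :
    P.co (a + b) i = P.co a i + P.co b i := by
  rw [co_add, Nat.mod_eq_of_lt h]

theorem co_sub_add (a b : ZMod m) (i : Fin θ) :
    P.co a i = P.co (a - b) i + P.co b i ∨ P.co a i + P.e i = P.co (a - b) i + P.co b i := by
  have h := P.co_add (a - b) b i
  rw [sub_add_cancel] at h
  have h1 := P.co_lt (a - b) i
  have h2 := P.co_lt b i
  rcases Nat.lt_or_ge (P.co (a - b) i + P.co b i) (P.e i) with h3 | h3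
  · rw [Nat.mod_eq_of_lt h3] at h; exact Or.inl h
  · rw [Nat.mod_eq_sub_mod h3, Nat.mod_eq_of_lt (by omega)] at h; right; omega

theorem co_sub_of_le {a b : ZMod m} {i : Fin θ} (h : P.co b i ≤ P.co a i) :
    P.co (a - b) i = P.co a i - P.co b i := by
  have h1 := P.co_lt (a - b) i
  have := P.co_sub_add a b i
  omega

theorem co_sub_of_lt {a b : ZMod m} {i : Fin θ} (h : P.co a i < P.co b i) :
    P.co (a - b) i = P.co a i + P.e i - P.co b i := by
  have := P.co_sub_add a b i
  omega

theorem co_add_M_self {n : ZMod m} {i : Fin θ} (h : P.co n i + 1 < P.e i) :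
    P.co (n + P.M i) i = P.co n i + 1 := by
  have h1 : P.co (P.M i) i = 1 := by rw [co_M, if_pos rfl, Nat.mod_eq_of_lt (by omega)]
  rw [co_add_of_lt _ (by omega), h1]

theorem co_M_of_ne {i j : Fin θ} (h : j ≠ i) : P.co (P.M i) j = 0 := by
  rw [co_M, if_neg h, Nat.zero_mod]

theorem co_add_M_of_ne (n : ZMod m) {i j : Fin θ} (h : j ≠ i) :
    P.co (n + P.M i) j = P.co n j := by
  rw [co_add, P.co_M_of_ne h, add_zero, Nat.mod_eq_of_lt (P.co_lt n j)]

theorem co_sub_M_of_ne (n : ZMod m) {i j : Fin θ} (h : j ≠ i) :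
    P.co (n - P.M i) j = P.co n j := by
  rw [co_sub_of_le _ (by rw [P.co_M_of_ne h]; exact Nat.zero_le _), P.co_M_of_ne h, Nat.sub_zero]

/-- Induction over residues: every residue is reached from `0` by adding residues `m_i` without
carrying in the coordinates. -/
theorem co_induction {motive : ZMod m → Prop} (zero : motive 0)
    (add : ∀ n i, P.co n i + 1 < P.e i → motive n → motive (n + P.M i)) (n : ZMod m) :
    motive n := by
  obtain ⟨t, ht⟩ : ∃ t, ∑ i, P.co n i = t := ⟨_, rfl⟩
  induction t generalizing n with
  | zero =>
    have : n = 0 := P.co_ext fun i => by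
      rw [co_zero]; exact (Finset.sum_eq_zero_iff.1 ht) i (Finset.mem_univ i)
    rwa [this]
  | succ t ih =>
    obtain ⟨i, -, hi⟩ : ∃ i ∈ Finset.univ, P.co n i ≠ 0 :=
      Finset.exists_ne_zero_of_sum_ne_zero (by omega)
    have hlt := P.co_lt n i
    have hM : P.co (P.M i) i = 1 := by rw [co_M, if_pos rfl, Nat.mod_eq_of_lt (by omega)]
    have hi' : P.co (n - P.M i) i = P.co n i - 1 := by
      rw [co_sub_of_le _ (by omega), hM]
    rw [← sub_add_cancel n (P.M i : ZMod m)]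
    refine add _ i (by omega) (ih _ ?_)
    rw [← Finset.add_sum_erase _ _ (Finset.mem_univ i)] at ht ⊢
    rw [hi', Finset.sum_congr rfl fun j hj => P.co_sub_M_of_ne n (Finset.ne_of_mem_erase hj)]
    omega

@[simp] theorem deg_zero : P.deg 0 = 0 := by simp [deg]

theorem deg_add {a b : ZMod m} (h : ∀ i, P.co a i + P.co b i < P.e i) :
    P.deg (a + b) = P.deg a + P.deg b := by
  simp only [deg, ← Finset.sum_add_distrib]
  exact Finset.sum_congr rfl fun i _ => by rw [P.co_add_of_lt (h i), add_mul]

theorem deg_add_M {n : ZMod m} {i : Fin θ} (h : P.co n i + 1 < P.e i) :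
    P.deg (n + P.M i) = P.deg n + P.M i := by
  simp only [deg]
  rw [← Finset.add_sum_erase _ _ (Finset.mem_univ i),
    ← Finset.add_sum_erase _ (fun j => P.co n j * P.M j) (Finset.mem_univ i), P.co_add_M_self h,
    Finset.sum_congr rfl fun j hj => by rw [P.co_add_M_of_ne n (Finset.ne_of_mem_erase hj)]]
  ring

/-- The sum of all `m_i`, as a residue. -/
def ones : ZMod m := ∑ i, (P.M i : ZMod m)

theorem co_neg_ones (i : Fin θ) : P.co (-P.ones) i = P.e i - 1 := by
  have h := P.co_sub_add 0 P.ones i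
  have h1 : P.co P.ones i = 1 % P.e i := by
    rw [← P.co_sum (fun _ => 1)]; simp [ones]
  rw [co_zero, zero_sub, h1] at h
  have h2 := P.e_pos i
  rcases Nat.lt_or_ge 1 (P.e i) with h3 | h3
  · rw [Nat.mod_eq_of_lt h3] at h; omega
  · have h4 := P.co_lt (-P.ones) i; omega

/-- The integer `σ d / 2`, where `σ = ∑ (e_i - 1) m_i`. -/
noncomputable def T : ℤ := sigma m P.M * P.d / 2

theorem two_mul_T : 2 * P.T = sigma m P.M * P.d := by
  refine Int.mul_ediv_cancel' ?_
  have := P.even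
  rwa [← Finset.sum_mul] at this

theorem half_exponent : (2 + sigma m P.M) * (P.d : ℤ) / 2 = P.d + P.T := by
  rw [T, add_mul, Int.add_ediv_of_dvd_left (dvd_mul_right _ _),
    Int.mul_ediv_cancel_left _ (by norm_num)]

theorem sigma_eq : sigma m P.M = (P.deg (-P.ones) : ℤ) := by
  simp only [sigma, deg, Nat.cast_sum, Nat.cast_mul]
  refine Finset.sum_congr rfl fun i _ => ?_
  have := P.e_pos i
  rw [co_neg_ones, Nat.cast_sub this, Nat.cast_one]
  rfl

/-! ### The character of `ZMod m` and the structure scalars -/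

theorem γ_ne_zero : P.γ ≠ 0 := P.prim.ne_zero P.isFraction.pos.ne'

theorem ξ_ne_zero (i : Fin θ) : P.ξ i ≠ 0 := fun h => by
  have h1 := P.ξ_sq i
  rw [h, zero_pow two_ne_zero] at h1
  exact pow_ne_zero _ P.γ_ne_zero h1.symm

theorem q_prim (i : Fin θ) : IsPrimitiveRoot (P.q i) (P.e i) where
  pow_eq_one := by
    rw [q, ← pow_mul, P.prim.pow_eq_one_iff_dvd, pow_two, mul_assoc, mul_comm (P.M i) (P.e i)]
    exact (exponent_spec P.isFraction.pos (P.M i)).2.mul_left _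
  dvd_of_pow_eq_one n hn := by
    rw [q, ← pow_mul, P.prim.pow_eq_one_iff_dvd, show P.M i ^ 2 * n = (P.M i * n) * P.M i by ring,
      ← exponent_dvd_iff P.isFraction.pos] at hn
    exact (P.isFraction.coprime i).dvd_of_dvd_mul_left hn

theorem q_ne_zero (i : Fin θ) : P.q i ≠ 0 := pow_ne_zero _ P.γ_ne_zero

/-- The local factor of `C`: the scalar `(-1) ^ n q_i ^ (n (n + 1) / 2) ξ_i ^ (-n)`. -/
noncomputable def w (i : Fin θ) (n : ℕ) : k :=
  (-1) ^ n * P.q i ^ (n * (n + 1) / 2) * (P.ξ i)⁻¹ ^ n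

/-- The scalar `m · c_l`, where `c_l` is the scalar in the formula for `u_j u_l`. -/
noncomputable def C (l : ZMod m) : k := ∏ i, P.w i (P.co l i)

theorem w_add (i : Fin θ) (a b : ℕ) :
    P.w i (a + b) = P.w i a * P.w i b * P.q i ^ (a * b) := by
  have h : (a + b) * (a + b + 1) / 2 = a * (a + 1) / 2 + b * (b + 1) / 2 + a * b := by
    obtain ⟨u, hu⟩ := (Nat.even_mul_succ_self a).two_dvd
    obtain ⟨v, hv⟩ := (Nat.even_mul_succ_self b).two_dvd
    rw [hu, hv, show (a + b) * (a + b + 1) = 2 * (u + v + a * b) by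
      linear_combination hu + hv]
    simp
  simp only [w, h, pow_add]
  ring

/-- Since `ξ_i ^ {e_i} = -1`, the local factor at `e_i` is `1`; this makes the local factors depend
on residues modulo `e_i` only. -/
theorem w_e (i : Fin θ) : P.w i (P.e i) = 1 := by
  have hq := P.q_prim i
  have h : P.q i ^ (P.e i * (P.e i + 1) / 2) = (-1) ^ (P.e i + 1) := by
    rcases Nat.even_or_odd (P.e i) with ⟨f, hf⟩ | ⟨f, hf⟩
    · have hpos := P.e_pos i
      have h1 : P.q i ^ f = -1 := by
        have h2 : (P.q i ^ f - 1) * (P.q i ^ f + 1) = 0 := by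
          have := hq.pow_eq_one
          rw [hf, pow_add] at this
          linear_combination this
        rcases mul_eq_zero.1 h2 with h3 | h3
        · exact absurd (sub_eq_zero.1 h3) (hq.pow_ne_one_of_pos_of_lt (by omega) (by omega))
        · exact eq_neg_of_add_eq_zero_left h3
      rw [show P.e i * (P.e i + 1) / 2 = f * (P.e i + 1) by
        rw [hf, ← two_mul, mul_assoc, Nat.mul_div_cancel_left _ two_pos], pow_mul, h1]
    · rw [show P.e i * (P.e i + 1) / 2 = P.e i * (f + 1) by
        conv_lhs => rw [show P.e i + 1 = 2 * (f + 1) by omega, mul_left_comm]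
        exact Nat.mul_div_cancel_left _ two_pos, pow_mul, hq.pow_eq_one, one_pow,
        Even.neg_one_pow ⟨f + 1, by omega⟩]
  rw [w, h, inv_pow, show P.ξ i ^ P.e i = -1 from P.ξ_pow i, ← pow_add, Odd.neg_one_pow
    ⟨P.e i, by ring⟩]
  norm_num

theorem w_mod (i : Fin θ) (n : ℕ) : P.w i (n % P.e i) = P.w i n := by
  conv_rhs => rw [← Nat.mod_add_div n (P.e i)]
  induction n / P.e i with
  | zero => simp
  | succ c ih =>
    rw [mul_add, mul_one, ← add_assoc, w_add, w_e, ← ih, mul_one, mul_comm _ (P.e i), pow_mul,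
      (P.q_prim i).pow_eq_one, one_pow, mul_one]

@[simp] theorem C_zero : P.C 0 = 1 := by simp [C, w]

theorem C_M (i : Fin θ) : P.C (P.M i) = -(P.q i * (P.ξ i)⁻¹) := by
  rw [C, Finset.prod_eq_single i]
  · rw [co_M, if_pos rfl, w_mod]; simp [w]
  · intro j _ hj
    rw [P.co_M_of_ne hj]; simp [w]
  · simp

theorem mulCoeff_eq (l : ZMod m) : mulCoeff m P.M P.γ P.ξ l = P.C l * (m : k)⁻¹ := by
  have h : P.C l = (-1) ^ (∑ i, coord m P.M l i) *
      P.γ ^ (∑ i, P.M i ^ 2 * (coord m P.M l i * (coord m P.M l i + 1) / 2)) *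
      ∏ i, P.ξ i ^ (-(coord m P.M l i : ℤ)) := by
    rw [← Finset.prod_pow_eq_pow_sum, ← Finset.prod_pow_eq_pow_sum, ← Finset.prod_mul_distrib,
      ← Finset.prod_mul_distrib]
    refine Finset.prod_congr rfl fun i _ => ?_
    rw [w, q, ← pow_mul, zpow_neg, zpow_natCast, inv_pow]
    rfl
  rw [h, mulCoeff]
  ring

variable [NeZero m]

/-- The character `a ↦ γ ^ a` of the residues modulo `m`. -/
noncomputable def χ : AddChar (ZMod m) k := AddChar.zmodChar m P.prim.pow_eq_one

theorem χ_apply (a : ZMod m) : P.χ a = P.γ ^ a.val := rfl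

theorem χ_natCast (n : ℕ) : P.χ n = P.γ ^ n := AddChar.zmodChar_apply' P.prim.pow_eq_one n

theorem χ_intCast (n : ℤ) : P.χ n = P.γ ^ n := by
  obtain ⟨a, rfl | rfl⟩ := n.eq_nat_or_neg
  · rw [Int.cast_natCast, χ_natCast, zpow_natCast]
  · rw [Int.cast_neg, Int.cast_natCast, AddChar.map_neg_eq_inv, χ_natCast, zpow_neg, zpow_natCast]

theorem χ_ne_zero (a : ZMod m) : P.χ a ≠ 0 := (P.χ.val_isUnit a).ne_zero

theorem sum_χ_mul (a : ZMod m) : ∑ b, P.χ (b * a) = if a = 0 then (m : k) else 0 := by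
  have h : P.χ.IsPrimitive := AddChar.zmodChar_primitive_of_primitive_root m P.prim
  rw [AddChar.sum_mulShift a h, ZMod.card]
  split_ifs <;> simp

theorem χ_sum {ι : Type*} (t : Finset ι) (f : ι → ZMod m) :
    P.χ (∑ i ∈ t, f i) = ∏ i ∈ t, P.χ (f i) := by
  classical
  induction t using Finset.induction_on with
  | empty => simp
  | insert a t ha ih => rw [Finset.sum_insert ha, Finset.prod_insert ha, AddChar.map_add_eq_mul, ih]

theorem χ_M_mul (i : Fin θ) (a : ZMod m) : P.χ (P.M i * a) = P.q i ^ P.co a i := by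
  conv_lhs => rw [← P.sum_co a]
  rw [Finset.mul_sum, Finset.sum_eq_single i]
  · rw [q, ← pow_mul, ← χ_natCast]
    congr 1; push_cast; ring
  · intro j _ hj
    linear_combination (P.co a j : ZMod m) * P.M_mul_M hj.symm
  · simp

theorem χ_mul (a b : ZMod m) : P.χ (a * b) = ∏ i, P.q i ^ (P.co a i * P.co b i) := by
  conv_lhs => rw [← P.sum_co a]
  rw [Finset.sum_mul, χ_sum]
  refine Finset.prod_congr rfl fun i _ => ?_
  rw [mul_assoc, ← nsmul_eq_mul, AddChar.map_nsmul_eq_pow, χ_M_mul, ← pow_mul, mul_comm]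

/-- The scalars `C` are quadratic, with the pairing `χ (a b)` as associated bicharacter. -/
theorem C_add (a b : ZMod m) : P.C (a + b) = P.C a * P.C b * P.χ (a * b) := by
  simp only [C, χ_mul, ← Finset.prod_mul_distrib]
  exact Finset.prod_congr rfl fun i _ => by rw [co_add, w_mod, w_add]

theorem C_ne_zero (a : ZMod m) : P.C a ≠ 0 := by
  intro h
  have := P.C_add a (-a)
  rw [add_neg_cancel, C_zero, h] at this
  simp at this

/-- The scalar in the formula for `S (u_j)`. -/
noncomputable def A (j : ZMod m) : k := (P.C j)⁻¹ * P.χ (-j)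

theorem prod_ξ_sq (j : ZMod m) : ∏ i, (P.ξ i ^ 2) ^ P.co j i = P.χ j := by
  conv_rhs => rw [← P.deg_cast j, χ_natCast, deg, ← Finset.prod_pow_eq_pow_sum]
  exact Finset.prod_congr rfl fun i _ => by rw [ξ_sq, ← pow_mul, mul_comm]

theorem antipodeCoeff_eq (j : ZMod m) : antipodeCoeff m P.M P.γ P.ξ j = P.A j := by
  rw [A, AddChar.map_neg_eq_inv, ← prod_ξ_sq, C, ← mul_inv, ← Finset.prod_mul_distrib, antipodeCoeff,
    zpow_neg, zpow_natCast, ← Finset.prod_pow_eq_pow_sum, ← Finset.prod_pow_eq_pow_sum,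
    ← Finset.prod_inv_distrib, ← Finset.prod_inv_distrib, ← Finset.prod_mul_distrib,
    ← Finset.prod_mul_distrib]
  refine Finset.prod_congr rfl fun i _ => ?_
  have hξ := P.ξ_ne_zero i
  change (-1) ^ P.co j i * (P.γ ^ (P.M i ^ 2 * (P.co j i * (P.co j i + 1) / 2)))⁻¹ *
    P.ξ i ^ (-(P.co j i : ℤ)) = _
  generalize P.co j i = n
  have h1 : ((-1 : k) ^ n)⁻¹ = (-1) ^ n := by rw [← inv_pow]; norm_num
  rw [w, q, mul_inv, mul_inv, mul_inv, h1, ← pow_mul, zpow_neg, zpow_natCast, inv_pow, inv_inv, ← pow_mul,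
    two_mul, pow_add]
  field_simp

theorem A_mul_C (j : ZMod m) : P.A j * P.C j = P.χ (-j) := by
  rw [A, mul_right_comm, inv_mul_cancel₀ (P.C_ne_zero j), one_mul]

theorem A_ne_zero (j : ZMod m) : P.A j ≠ 0 :=
  mul_ne_zero (inv_ne_zero (P.C_ne_zero j)) (P.χ_ne_zero _)

theorem A_add (a b : ZMod m) : P.A (a + b) = P.A a * P.A b * P.χ (-(a * b)) := by
  simp only [A, C_add, neg_add, AddChar.map_add_eq_mul, mul_inv, AddChar.map_neg_eq_inv]
  ring

/-- Since `m_i m_j = 0` for `i ≠ j`, squaring the half-integral powers of the `q_i` produces a value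
of `χ` at a quadratic expression. -/
theorem C_sq (j : ZMod m) : P.C j ^ 2 = P.χ (j * j + P.ones * j - j) := by
  have h1 : P.C j ^ 2 * P.χ j = P.χ (j * j + P.ones * j) := by
    rw [AddChar.map_add_eq_mul, χ_mul P j j, ones, Finset.sum_mul, χ_sum,
      ← Finset.prod_mul_distrib, C, ← Finset.prod_pow, ← prod_ξ_sq, ← Finset.prod_mul_distrib]
    refine Finset.prod_congr rfl fun i _ => ?_
    have hξ := P.ξ_ne_zero i
    rw [χ_M_mul, ← pow_add, w, mul_pow, mul_pow, ← pow_mul, ← pow_mul, mul_comm (P.co j i) 2,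
      pow_mul (-1 : k)]
    rw [Nat.div_mul_cancel (Nat.even_mul_succ_self _).two_dvd, ← pow_mul (P.ξ i)⁻¹,
      mul_comm (P.co j i) 2, pow_mul (P.ξ i)⁻¹, mul_assoc, ← mul_pow,
      show ((P.ξ i)⁻¹ ^ 2) * P.ξ i ^ 2 = 1 by field_simp]
    simp [mul_add]
  rw [sub_eq_add_neg, AddChar.map_add_eq_mul, ← h1, AddChar.map_neg_eq_inv]
  field_simp [P.χ_ne_zero j]

end Datum
namespace Datum

variable {k : Type*} [Field k] {m θ : ℕ} (P : Datum k m θ)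

/-! ### Products of Gaussian binomial coefficients over the coordinates -/

/-- The coefficient `∏ (n_i + s_i choose s_i)`, with Gaussian binomials at `q_i`. -/
noncomputable def G (n s : ZMod m) : k := ∏ i, gauss (P.q i) (P.co n i + P.co s i) (P.co s i)

/-- The coefficient `∏ (n_i choose r_i)`, with Gaussian binomials at `q_i`. -/
noncomputable def B (n r : ZMod m) : k := ∏ i, gauss (P.q i) (P.co n i) (P.co r i)

/-- The scalar in the formula for the antipode of a monomial in the `y_i`. -/
noncomputable def κ (n : ZMod m) : k :=
  ∏ i, (-1) ^ P.co n i * (P.q i ^ (P.co n i * (P.co n i + 1) / 2))⁻¹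

@[simp] theorem G_zero_left (s : ZMod m) : P.G 0 s = 1 := by simp [G]

theorem B_zero_left (n : ZMod m) : P.B 0 n = if n = 0 then 1 else 0 := by
  split_ifs with h
  · simp [h, B]
  · obtain ⟨i, hi⟩ : ∃ i, P.co n i ≠ 0 := by
      by_contra hc
      push Not at hc
      exact h (P.co_ext fun i => by rw [hc i, co_zero])
    exact Finset.prod_eq_zero (Finset.mem_univ i)
      (gauss_of_lt _ (by rw [co_zero]; exact Nat.pos_of_ne_zero hi))

theorem lt_of_G_ne_zero {n s : ZMod m} (h : P.G n s ≠ 0) (i : Fin θ) :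
    P.co n i + P.co s i < P.e i := by
  by_contra hc
  refine h (Finset.prod_eq_zero (Finset.mem_univ i) ?_)
  rw [add_comm]
  exact gauss_eq_zero_of_carry (P.q_prim i) (P.co_lt s i) (P.co_lt n i) (by omega)

/-- Coefficientwise form of the compatibility of the coproduct with the product `u_j u_l`: the
trinomial revision identity, where both sides vanish as soon as a coordinate carries. -/
theorem G_mul_G (N n s : ZMod m) : P.G n s * P.G (N - n) (n + s) = P.G N s * P.B N n := by
  simp only [G, B, ← Finset.prod_mul_distrib]
  refine Finset.prod_congr rfl fun i _ => ?_
  have hq := P.q_prim i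
  have ha := P.co_lt n i
  have hb := P.co_lt s i
  have hc := P.co_lt N i
  have carry {a b : ℕ} (ha : a < P.e i) (hb : b < P.e i) (h : P.e i ≤ a + b) :
      gauss (P.q i) (a + b) b = 0 := by
    rw [add_comm]; exact gauss_eq_zero_of_carry hq hb ha (by omega)
  rcases Nat.lt_or_ge (P.co n i + P.co s i) (P.e i) with h1 | h1
  · rw [P.co_add_of_lt h1]
    rcases Nat.lt_or_ge (P.co N i) (P.co n i) with h2 | h2
    · have h3 := P.co_lt (N - n) i
      rw [gauss_of_lt _ h2, carry h3 h1 (by rw [P.co_sub_of_lt h2]; omega), mul_zero, mul_zero]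
    · rw [P.co_sub_of_le h2, show P.co N i - P.co n i + (P.co n i + P.co s i) =
        P.co N i + P.co s i by omega]
      rcases Nat.lt_or_ge (P.co N i + P.co s i) (P.e i) with h3 | h3
      · exact gauss_mul_gauss hq h2 h3
      · rw [carry hc hb h3, zero_mul, show P.co N i + P.co s i =
          (P.co N i - P.co n i) + (P.co n i + P.co s i) by omega,
          carry (by omega) h1 (by omega), mul_zero]
  · rw [carry ha hb h1, zero_mul]
    rcases Nat.lt_or_ge (P.co N i) (P.co n i) with h2 | h2
    · rw [gauss_of_lt _ h2, mul_zero]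
    · rw [carry hc hb (by omega), zero_mul]

theorem deg_add_of_G_ne_zero {n s : ZMod m} (h : P.G n s ≠ 0) :
    P.deg (n + s) = P.deg n + P.deg s :=
  P.deg_add (P.lt_of_G_ne_zero h)

@[simp] theorem κ_zero : P.κ 0 = 1 := by simp [κ]

theorem κ_add_M {n : ZMod m} {i : Fin θ} (h : P.co n i + 1 < P.e i) :
    P.κ (n + P.M i) = -(P.q i ^ (P.co n i + 1))⁻¹ * P.κ n := by
  have h1 : (P.co n i + 1) * (P.co n i + 1 + 1) / 2 =
      P.co n i * (P.co n i + 1) / 2 + (P.co n i + 1) := by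
    rw [show (P.co n i + 1) * (P.co n i + 1 + 1) =
      P.co n i * (P.co n i + 1) + (P.co n i + 1) * 2 by ring,
      Nat.add_mul_div_right _ _ (by norm_num)]
  rw [κ, κ, ← Finset.mul_prod_erase _ _ (Finset.mem_univ i), ← Finset.mul_prod_erase _
    (fun j => (-1) ^ P.co n j * (P.q j ^ (P.co n j * (P.co n j + 1) / 2))⁻¹) (Finset.mem_univ i),
    P.co_add_M_self h, h1, pow_succ (-1 : k), pow_add (P.q i) (_ / 2), mul_inv,
    Finset.prod_congr rfl fun j hj => by rw [P.co_add_M_of_ne n (Finset.ne_of_mem_erase hj)]]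
  ring

/-- The complementary index `-∑ m_i - N - s`, whose coordinates are `e_i - 1 - N_i - s_i` when
`N_i + s_i < e_i` for all `i`. -/
theorem co_complement {N s : ZMod m} (i : Fin θ) (h : P.co N i + P.co s i < P.e i) :
    P.co (-P.ones - N - s) i = P.e i - 1 - P.co N i - P.co s i := by
  have h1 : P.co (-P.ones - N) i = P.e i - 1 - P.co N i := by
    rw [P.co_sub_of_le (by rw [co_neg_ones]; omega), co_neg_ones]
  rw [P.co_sub_of_le (by omega), h1]

theorem deg_complement {N s : ZMod m} (h : P.G N s ≠ 0) :
    (P.deg (-P.ones - N - s) : ℤ) = sigma m P.M - P.deg N - P.deg s := by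
  rw [sigma_eq]
  have : P.deg (-P.ones - N - s) + P.deg N + P.deg s = P.deg (-P.ones) := by
    simp only [deg, ← Finset.sum_add_distrib]
    refine Finset.sum_congr rfl fun i _ => ?_
    have h1 := P.lt_of_G_ne_zero h i
    rw [P.co_complement i h1, P.co_neg_ones, ← add_mul, ← add_mul]
    congr 1; omega
  omega

/-! ### The products of brackets -/

theorem phi_eq (i : Fin θ) (r : ℕ) : phi P.d P.M P.γ i ((r : ℤ) * P.M i) =
    1 - ((P.q i)⁻¹ ^ (r + 1)) • (Polynomial.X ^ (P.M i * P.d) : Polynomial k) := by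
  have : P.γ ^ (-((P.M i : ℤ) * (P.M i + r * P.M i))) = (P.q i)⁻¹ ^ (r + 1) := by
    rw [show (P.M i : ℤ) * (P.M i + r * P.M i) = ((P.M i ^ 2 * (r + 1) : ℕ) : ℤ) by
      push_cast; ring, zpow_neg, zpow_natCast, pow_mul, inv_pow, q]
  rw [phi, this, Polynomial.smul_eq_C_mul]

/-- The bracket for coordinates `a` of `j` and `b` of `l` is, up to the rescaling of `x ^ (m_i d)` by
`q_i⁻ᵃ`, a product depending on the coordinate `c` of `j + l` only. -/
theorem bracket_eq_prod (i : Fin θ) {a b c : ℕ} (ha : a < P.e i) (hb : b < P.e i)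
    (hc : c = (a + b) % P.e i) :
    bracket m P.d P.M P.γ i a ((P.e i : ℤ) - 2 - b) =
      ∏ r ∈ Finset.range (P.e i - 1 - c), (1 - ((P.q i)⁻¹ ^ (r + 1)) •
        (((P.q i)⁻¹ ^ a) • (Polynomial.X ^ (P.M i * P.d) : Polynomial k))) := by
  have hper (r : ℕ) : (P.q i)⁻¹ ^ (P.e i + r) = (P.q i)⁻¹ ^ r := by
    rw [pow_add, inv_pow, (P.q_prim i).pow_eq_one, inv_one, one_mul]
  have hfac (r : ℕ) : (1 : Polynomial k) - ((P.q i)⁻¹ ^ (r + 1)) •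
        (((P.q i)⁻¹ ^ a) • (Polynomial.X ^ (P.M i * P.d))) =
      phi P.d P.M P.γ i (((a + r : ℕ) : ℤ) * P.M i) := by
    rw [phi_eq, smul_smul, ← pow_add]; congr 3; ring
  have hphi (r : ℕ) : phi P.d P.M P.γ i (((P.e i + r : ℕ) : ℤ) * P.M i) =
      phi P.d P.M P.γ i ((r : ℤ) * P.M i) := by
    rw [phi_eq, phi_eq, add_assoc, hper]
  simp only [hfac]
  have hpos := P.e_pos i
  have he : exponent m (P.M i) = P.e i := rfl
  have ha' : ((a : ℤ) % (P.e i : ℤ)).toNat = a := by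
    rw [Int.emod_eq_of_lt (by omega) (by omega)]; simp
  simp only [bracket, he, ha']
  by_cases h1 : a + b + 1 = P.e i
  · rw [if_pos, show c = P.e i - 1 by rw [hc, Nat.mod_eq_of_lt (by omega)]; omega]
    · simp
    · rw [show (P.e i : ℤ) - 2 - b + 1 = a by omega]
  by_cases h2 : b + 1 = P.e i
  · -- the upper index is `-1`, which reduces to `e - 1`
    have hb' : (((P.e i : ℤ) - 2 - b) % (P.e i : ℤ)).toNat = P.e i - 1 := by
      rw [show (P.e i : ℤ) - 2 - b = (P.e i - 1 : ℤ) - P.e i by omega, Int.sub_emod_right,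
        Int.emod_eq_of_lt (by omega) (by omega)]
      omega
    have hne : ¬ ((a : ℤ) ≡ (P.e i : ℤ) - 2 - b + 1 [ZMOD P.e i]) := by
      rw [show (P.e i : ℤ) - 2 - b + 1 = 0 by omega, Int.modEq_zero_iff_dvd]
      intro h
      have := Nat.le_of_dvd (by omega) (Int.natCast_dvd_natCast.1 h)
      omega
    rw [if_neg hne, hb', if_pos (by omega), hc, Nat.mod_eq_sub_mod (by omega),
      Nat.mod_eq_of_lt (by omega), ← Finset.Ico_add_one_right_eq_Icc,
      Finset.prod_Ico_eq_prod_range]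
    congr 2
    omega
  · have hb' : (((P.e i : ℤ) - 2 - b) % (P.e i : ℤ)).toNat = P.e i - 2 - b := by
      rw [Int.emod_eq_of_lt (by omega) (by omega)]
      omega
    have hne : ¬ ((a : ℤ) ≡ (P.e i : ℤ) - 2 - b + 1 [ZMOD P.e i]) := by
      intro h
      rw [Int.ModEq, Int.emod_eq_of_lt (by omega) (by omega),
        Int.emod_eq_of_lt (by omega) (by omega)] at h
      omega
    rw [if_neg hne, hb']
    split_ifs with h3
    · rw [hc, Nat.mod_eq_of_lt (by omega), ← Finset.Ico_add_one_right_eq_Icc,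
        Finset.prod_Ico_eq_prod_range]
      congr 2
      omega
    · rw [hc, Nat.mod_eq_sub_mod (by omega), Nat.mod_eq_of_lt (by omega),
        ← Finset.Ico_add_one_right_eq_Icc, Finset.prod_Ico_eq_prod_range,
        Finset.prod_Ico_eq_prod_range,
        show P.e i - 1 - (a + b - P.e i) = (P.e i - a) + (P.e i - 2 - b + 1 - 0) by omega,
        Finset.prod_range_add]
      congr 1
      refine Finset.prod_congr rfl fun r _ => ?_
      rw [show a + (P.e i - a + r) = P.e i + r by omega, hphi, zero_add]

/-! ### Identities for the coefficients -/

variable [NeZero m]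

/-- Pascal's recursion in the `i`-th coordinate. -/
theorem B_add_M {N : ZMod m} {i : Fin θ} (h : P.co N i + 1 < P.e i) (n : ZMod m) :
    P.B (N + P.M i) n = P.B N (n - P.M i) + P.χ (P.M i * n) * P.B N n := by
  have hM : P.co (P.M i) i = 1 := by
    rw [co_M, if_pos rfl, Nat.mod_eq_of_lt (by omega)]
  simp only [B]
  rw [← Finset.mul_prod_erase _ _ (Finset.mem_univ i), ← Finset.mul_prod_erase _
    (fun j => gauss (P.q j) (P.co N j) (P.co (n - P.M i) j)) (Finset.mem_univ i),
    ← Finset.mul_prod_erase _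
    (fun j => gauss (P.q j) (P.co N j) (P.co n j)) (Finset.mem_univ i),
    P.co_add_M_self h,
    Finset.prod_congr rfl fun j hj => by rw [P.co_add_M_of_ne N (Finset.ne_of_mem_erase hj)],
    χ_M_mul]
  have hprod : ∏ j ∈ Finset.univ.erase i, gauss (P.q j) (P.co N j) (P.co n j) =
      ∏ j ∈ Finset.univ.erase i, gauss (P.q j) (P.co N j) (P.co (n - P.M i) j) :=
    Finset.prod_congr rfl fun j hj => by rw [P.co_sub_M_of_ne n (Finset.ne_of_mem_erase hj)]
  rw [hprod, ← mul_assoc, ← add_mul]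
  congr 1
  rcases h0 : P.co n i with _ | r
  · rw [P.co_sub_of_lt (by omega), h0, hM]
    rw [gauss_of_lt (n := P.co N i) _ (by omega)]
    simp
  · rw [P.co_sub_of_le (by omega), h0, hM]
    exact gauss_succ_succ _ _ _

theorem κ_sq (n : ZMod m) : P.κ n ^ 2 = P.χ (-(n * n + P.ones * n)) := by
  rw [AddChar.map_neg_eq_inv, AddChar.map_add_eq_mul, χ_mul P n n, ones, Finset.sum_mul, χ_sum,
    ← Finset.prod_mul_distrib, κ, ← Finset.prod_pow, ← Finset.prod_inv_distrib]
  refine Finset.prod_congr rfl fun i _ => ?_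
  rw [χ_M_mul, ← pow_add, mul_pow, ← pow_mul, mul_comm (P.co n i) 2, pow_mul (-1 : k), inv_pow,
    ← pow_mul (P.q i), Nat.div_mul_cancel (Nat.even_mul_succ_self _).two_dvd]
  simp [mul_add]

/-- The reflection formula for the coefficients `G`. It holds for all `s`: on both sides, a carry in
some coordinate makes the coefficient vanish. -/
theorem G_complement (N s : ZMod m) :
    P.G N (-P.ones - N - s) = P.κ N * P.χ (-(N * s)) * P.G N s := by
  have main (s : ZMod m) (h : ∀ i, P.co N i + P.co s i < P.e i) :
      P.G N (-P.ones - N - s) = P.κ N * P.χ (-(N * s)) * P.G N s := by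
    rw [AddChar.map_neg_eq_inv, χ_mul, ← Finset.prod_inv_distrib, G, G, κ,
      ← Finset.prod_mul_distrib, ← Finset.prod_mul_distrib]
    refine Finset.prod_congr rfl fun i _ => ?_
    have hi := h i
    have hq := P.q_prim i
    have h1 := gauss_reflect hq hi
    have hsymm : gauss (P.q i) (P.e i - 1 - P.co s i) (P.e i - 1 - P.co N i - P.co s i) =
        gauss (P.q i) (P.e i - 1 - P.co s i) (P.co N i) := by
      have h2 := gauss_mul_qFact (P.q i) (P.e i - 1 - P.co N i - P.co s i) (P.co N i)
      have h3 := gauss_mul_qFact (P.q i) (P.co N i) (P.e i - 1 - P.co N i - P.co s i)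
      rw [show P.e i - 1 - P.co N i - P.co s i + P.co N i = P.e i - 1 - P.co s i by omega] at h2
      rw [show P.co N i + (P.e i - 1 - P.co N i - P.co s i) = P.e i - 1 - P.co s i by omega] at h3
      apply mul_right_cancel₀ (mul_ne_zero
        (qFact_ne_zero hq (by omega : P.e i - 1 - P.co N i - P.co s i < P.e i))
        (qFact_ne_zero hq (P.co_lt N i)))
      linear_combination h2 - h3
    rw [P.co_complement i hi, show P.co N i + (P.e i - 1 - P.co N i - P.co s i) =
      P.e i - 1 - P.co s i by omega, hsymm]
    have hq0 := P.q_ne_zero i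
    rw [pow_add] at h1
    field_simp
    linear_combination h1
  by_cases hs : P.G N s = 0
  · rw [hs, mul_zero]
    by_contra h
    have h2 := main (-P.ones - N - s) (P.lt_of_G_ne_zero h)
    rw [show -P.ones - N - (-P.ones - N - s) = s by ring, hs] at h2
    refine mul_ne_zero (mul_ne_zero ?_ (P.χ_ne_zero _)) h h2.symm
    intro h0
    have := P.κ_sq N
    rw [h0, zero_pow two_ne_zero] at this
    exact P.χ_ne_zero _ this.symm
  · exact main s (P.lt_of_G_ne_zero hs)

/-- The product of brackets in the formula for `u_j u_l`, expanded in powers of `x`. The exponent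
occurring for the residue `s` is `|s| d`, and the dependence on `j` for fixed `j + l` is through the
value `χ (-(j s))` only. -/
theorem prod_bracket_eq_sum (j l : ZMod m) :
    ∏ i, bracket m P.d P.M P.γ i (coord m P.M j i)
        ((exponent m (P.M i) : ℤ) - 2 - coord m P.M l i) =
      ∑ s, (P.G (j + l) s * P.χ (-(j * s))) •
        (Polynomial.X ^ (P.deg s * P.d) : Polynomial k) := by
  have h (i : Fin θ) : bracket m P.d P.M P.γ i (coord m P.M j i)
        ((exponent m (P.M i) : ℤ) - 2 - coord m P.M l i) =
      ∑ s ∈ Finset.range (P.e i), gauss (P.q i) (P.co (j + l) i + s) s •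
        (((P.q i)⁻¹ ^ P.co j i) • (Polynomial.X ^ (P.M i * P.d) : Polynomial k)) ^ s := by
    rw [← prod_one_sub_eq_sum_gauss (P.q_prim i) _ (P.co_lt (j + l) i)]
    exact P.bracket_eq_prod i (P.co_lt j i) (P.co_lt l i) (P.co_add j l i)
  rw [Finset.prod_congr rfl fun i _ => h i, Finset.prod_univ_sum]
  refine Finset.sum_nbij' (fun a => ∑ i, (a i : ZMod m) * P.M i) (fun s => P.co s)
    (fun _ _ => Finset.mem_univ _) (fun s _ => ?_) (fun a ha => ?_) (fun s _ => P.sum_co s)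
    (fun a ha => ?_)
  · rw [Fintype.mem_piFinset]
    exact fun i => Finset.mem_range.2 (P.co_lt s i)
  · funext i
    rw [co_sum, Nat.mod_eq_of_lt (Finset.mem_range.1 (Fintype.mem_piFinset.1 ha i))]
  · have hco (i : Fin θ) : P.co (∑ i, (a i : ZMod m) * P.M i) i = a i := by
      rw [co_sum, Nat.mod_eq_of_lt (Finset.mem_range.1 (Fintype.mem_piFinset.1 ha i))]
    rw [AddChar.map_neg_eq_inv, χ_mul, G, ← Finset.prod_inv_distrib, ← Finset.prod_mul_distrib, deg,
      Finset.sum_mul, ← Finset.prod_pow_eq_pow_sum, ← Finset.prod_smul]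
    refine Finset.prod_congr rfl fun i _ => ?_
    simp only [hco]
    rw [smul_pow, smul_smul, ← pow_mul, ← pow_mul, inv_pow]
    congr 2
    ring

end Datum

/-! ### Models of the defining relations -/

theorem mul_prod_ofFn_pow {A : Type*} [Monoid A] {n : ℕ} (y : Fin n → A)
    (hy : ∀ i j, y i * y j = y j * y i) (a : Fin n → ℕ) (i : Fin n) :
    y i * (List.ofFn fun j => y j ^ a j).prod =
      (List.ofFn fun j => y j ^ (a j + if j = i then 1 else 0)).prod := by
  induction n with
  | zero => exact i.elim0
  | succ n ih =>
    simp only [List.ofFn_succ, List.prod_cons]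
    refine Fin.cases ?_ (fun i => ?_) i
    · simp [pow_succ', mul_assoc]
    · have h := ih (fun j => y j.succ) (fun i j => hy _ _) (fun j => a j.succ) i
      have hc : y i.succ * y 0 ^ a 0 = y 0 ^ a 0 * y i.succ :=
        Commute.pow_right (hy i.succ 0) (a 0)
      rw [← mul_assoc, hc, mul_assoc, h]
      simp [Fin.succ_inj, Ne.symm (Fin.succ_ne_zero i)]

theorem intPow_units {A : Type*} [Monoid A] (x : Aˣ) (n : ℤ) :
    intPow (x : A) (↑x⁻¹ : A) n = ↑(x ^ n) := by
  obtain ⟨a, rfl | rfl⟩ := n.eq_nat_or_neg <;> simp [intPow]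

namespace Datum

variable {k : Type*} [Field k] {m θ : ℕ} (P : Datum k m θ)

/-- The algebra `D(m̲, d, γ)` of a datum. -/
abbrev Alg : Type _ := D m P.d P.M P.γ P.ξ

/-- The ordered monomial `∏ y_i ^ {n_i}` in a family `y`. -/
noncomputable def Y {A : Type*} [Monoid A] (y : Fin θ → A) (n : ZMod m) : A :=
  (List.ofFn fun i => y i ^ P.co n i).prod

@[simp] theorem Y_zero {A : Type*} [Monoid A] (y : Fin θ → A) : P.Y y 0 = 1 := by
  simp only [Y, co_zero, pow_zero]
  rw [List.prod_eq_one]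
  simp

theorem mul_Y {A : Type*} [Monoid A] {y : Fin θ → A} (hy : ∀ i j, y i * y j = y j * y i)
    {n : ZMod m} {i : Fin θ} (h : P.co n i + 1 < P.e i) :
    y i * P.Y y n = P.Y y (n + P.M i) := by
  rw [Y, mul_prod_ofFn_pow y hy]
  congr 2
  funext j
  split_ifs with hj
  · rw [hj, P.co_add_M_self h]
  · rw [P.co_add_M_of_ne n hj, add_zero]

theorem Y_mul_of_qCommute [NeZero m] {A : Type*} [Ring A] [Algebra k A] {y : Fin θ → A}
    (hy : ∀ i j, y i * y j = y j * y i) {h : A}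
    (hh : ∀ i, y i * h = P.χ (P.M i) • (h * y i)) (n : ZMod m) :
    P.Y y n * h = P.χ n • (h * P.Y y n) := by
  induction n using P.co_induction with
  | zero => simp
  | add n i hn ih =>
    rw [← P.mul_Y hy hn, mul_assoc, ih, mul_smul_comm, ← mul_assoc, hh, smul_mul_assoc,
      smul_smul, mul_assoc, AddChar.map_add_eq_mul]

end Datum

/-- A family of elements of `A` satisfying the relations of `D(m̲, d, γ)`, in normalized form: the
group-like element `g` is replaced by `h = x⁻ᵈ g`, whose `m`-th power is `1`, and the products of
brackets are expanded. -/
structure Model {k : Type*} [Field k] {m θ : ℕ} [NeZero m] (P : Datum k m θ)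
    (A : Type*) [Ring A] [Algebra k A] where
  x : Aˣ
  h : Aˣ
  y : Fin θ → A
  u : ZMod m → A
  x_h : x * h = h * x
  x_y : ∀ i, (x : A) * y i = y i * x
  y_y : ∀ i j, y i * y j = y j * y i
  y_h : ∀ i, y i * h = P.χ (P.M i) • (h * y i)
  y_pow : ∀ i, y i ^ P.e i = 1 - (x : A) ^ (P.e i * P.M i * P.d)
  h_pow : h ^ m = 1
  x_u : ∀ j, (x : A) * u j = u j * (↑x⁻¹ : A)
  y_u : ∀ i j, y i * u j =
    u (j + P.M i) - P.χ (-(P.M i * (P.M i + j))) • ((x : A) ^ (P.M i * P.d) * u (j + P.M i))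
  y_u' : ∀ i j, y i * u j = P.ξ i • ((x : A) ^ (P.M i * P.d) * u j * y i)
  u_h : ∀ j, u j * h = P.χ j • (h * u j)
  u_u : ∀ j l, u j * u l = ∑ s, (P.C l * (m : k)⁻¹ * (P.G (j + l) s * P.χ (-(j * s)))) •
    ((↑(x ^ ((P.deg s * P.d : ℤ) - P.T)) : A) * (P.Y y (j + l) * h))

namespace Model

variable {k : Type*} [Field k] {m θ : ℕ} [NeZero m] {P : Datum k m θ}
  {A : Type*} [Ring A] [Algebra k A] (𝓜 : Model P A)

/-- The integral power `x ^ n`, as an element of the algebra. -/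
def X (n : ℤ) : A := ↑(𝓜.x ^ n)

/-- The power `h ^ a` with exponent a residue modulo `m`. -/
def H (a : ZMod m) : A := ↑(𝓜.h ^ a.val)

theorem X_add (a b : ℤ) : 𝓜.X (a + b) = 𝓜.X a * 𝓜.X b := by simp [X, zpow_add]

@[simp] theorem X_zero : 𝓜.X 0 = 1 := by simp [X]

theorem X_natCast (n : ℕ) : 𝓜.X n = (𝓜.x : A) ^ n := by simp [X]

theorem X_neg_natCast (n : ℕ) : 𝓜.X (-n) = (↑𝓜.x⁻¹ : A) ^ n := by simp [X]

theorem H_natCast (n : ℕ) : 𝓜.H n = (𝓜.h : A) ^ n := by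
  have : 𝓜.h ^ n = 𝓜.h ^ (n % m) := by
    conv_lhs => rw [← Nat.mod_add_div n m, pow_add, pow_mul, 𝓜.h_pow, one_pow, mul_one]
  rw [H, ZMod.val_natCast, ← this, Units.val_pow_eq_pow_val]

@[simp] theorem H_zero : 𝓜.H 0 = 1 := by simp [H]

theorem H_one : 𝓜.H 1 = 𝓜.h := by simpa using 𝓜.H_natCast 1

theorem H_add (a b : ZMod m) : 𝓜.H (a + b) = 𝓜.H a * 𝓜.H b := by
  rw [← ZMod.natCast_zmod_val a, ← ZMod.natCast_zmod_val b, ← Nat.cast_add, H_natCast, H_natCast,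
    H_natCast, pow_add]

theorem H_X (a : ZMod m) (n : ℤ) : 𝓜.H a * 𝓜.X n = 𝓜.X n * 𝓜.H a := by
  rw [H, X, ← Units.val_mul, ← Units.val_mul,
    ((show Commute 𝓜.x 𝓜.h from 𝓜.x_h).symm.pow_left _).zpow_right _]

theorem y_X (i : Fin θ) (n : ℤ) : 𝓜.y i * 𝓜.X n = 𝓜.X n * 𝓜.y i :=
  ((show Commute (𝓜.y i) 𝓜.x from (𝓜.x_y i).symm).units_zpow_right n)

theorem y_H (i : Fin θ) (a : ZMod m) :
    𝓜.y i * 𝓜.H a = P.χ (P.M i * a) • (𝓜.H a * 𝓜.y i) := by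
  rw [← ZMod.natCast_zmod_val a]
  induction a.val with
  | zero => simp
  | succ n ih =>
    rw [Nat.cast_succ, H_add, ← mul_assoc, ih, smul_mul_assoc, mul_assoc, H_one, y_h,
      mul_smul_comm, smul_smul, mul_add, mul_one, AddChar.map_add_eq_mul, mul_assoc]

theorem u_X (j : ZMod m) (n : ℤ) : 𝓜.u j * 𝓜.X n = 𝓜.X (-n) * 𝓜.u j := by
  have h : SemiconjBy (𝓜.u j) (𝓜.x : A) (↑𝓜.x⁻¹ : A) := by
    rw [SemiconjBy, Units.eq_inv_mul_iff_mul_eq, ← mul_assoc, 𝓜.x_u, mul_assoc, Units.inv_mul,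
      mul_one]
  have := h.units_zpow_right n
  simpa [X, SemiconjBy] using this

theorem u_H (j a : ZMod m) : 𝓜.u j * 𝓜.H a = P.χ (j * a) • (𝓜.H a * 𝓜.u j) := by
  rw [← ZMod.natCast_zmod_val a]
  induction a.val with
  | zero => simp
  | succ n ih =>
    rw [Nat.cast_succ, H_add, ← mul_assoc, ih, smul_mul_assoc, mul_assoc, H_one, u_h,
      mul_smul_comm, smul_smul, mul_add, mul_one, AddChar.map_add_eq_mul, mul_assoc]

theorem Y_X (n : ZMod m) (r : ℤ) : P.Y 𝓜.y n * 𝓜.X r = 𝓜.X r * P.Y 𝓜.y n := by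
  induction n using P.co_induction with
  | zero => simp
  | add n i h ih => rw [← P.mul_Y 𝓜.y_y h, mul_assoc, ih, ← mul_assoc, y_X, mul_assoc]

theorem Y_H (n a : ZMod m) : P.Y 𝓜.y n * 𝓜.H a = P.χ (n * a) • (𝓜.H a * P.Y 𝓜.y n) := by
  induction n using P.co_induction with
  | zero => simp
  | add n i h ih =>
    rw [← P.mul_Y 𝓜.y_y h, mul_assoc, ih, mul_smul_comm, ← mul_assoc, y_H, smul_mul_assoc,
      smul_smul, mul_assoc, add_mul, AddChar.map_add_eq_mul]

theorem y_u_X (i : Fin θ) (j : ZMod m) : 𝓜.y i * 𝓜.u j =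
    𝓜.u (j + P.M i) - P.χ (-(P.M i * (P.M i + j))) • (𝓜.X (P.M i * P.d) * 𝓜.u (j + P.M i)) := by
  rw [𝓜.y_u, ← Nat.cast_mul, X_natCast]

theorem y_u_X' (i : Fin θ) (j : ZMod m) : 𝓜.y i * 𝓜.u j =
    P.ξ i • (𝓜.X (P.M i * P.d) * (𝓜.u j * 𝓜.y i)) := by
  rw [𝓜.y_u', ← Nat.cast_mul, X_natCast, mul_assoc]

/-- The formula for `u_j u_l` with the factors in the order `x, h, y`. -/
theorem u_u_X (j l : ZMod m) : 𝓜.u j * 𝓜.u l =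
    ∑ s, (P.C l * (m : k)⁻¹ * P.G (j + l) s * P.χ (j + l - j * s)) •
      (𝓜.X (P.deg s * P.d - P.T) * 𝓜.H 1 * P.Y 𝓜.y (j + l)) := by
  rw [𝓜.u_u]
  refine Finset.sum_congr rfl fun s _ => ?_
  rw [P.Y_mul_of_qCommute 𝓜.y_y 𝓜.y_h, mul_smul_comm, smul_smul, sub_eq_add_neg (j + l),
    AddChar.map_add_eq_mul P.χ (j + l), mul_assoc (𝓜.X _), H_one]
  congr 1
  ring

/-! ### Algebra homomorphisms from models -/

/-- The value of a generator of the algebra in a model. -/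
def genVal : Gen m θ → A
  | .x => 𝓜.x
  | .xinv => ↑𝓜.x⁻¹
  | .g => 𝓜.X P.d * 𝓜.h
  | .ginv => ↑𝓜.h⁻¹ * 𝓜.X (-P.d)
  | .y i => 𝓜.y i
  | .u j => 𝓜.u j

theorem aeval_phi (i : Fin θ) (j : ZMod m) :
    Polynomial.aeval (𝓜.x : A) (phi P.d P.M P.γ i j.val) =
      1 - P.χ (-(P.M i * (P.M i + j))) • (𝓜.x : A) ^ (P.M i * P.d) := by
  have : P.γ ^ (-((P.M i : ℤ) * (P.M i + j.val))) = P.χ (-(P.M i * (P.M i + j))) := by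
    rw [← P.χ_intCast]; simp
  rw [phi, this]
  simp [Algebra.smul_def]

theorem lift_rel {a b : FreeAlgebra k (Gen m θ)} (hab : Rel m P.d P.M P.γ P.ξ a b) :
    FreeAlgebra.lift k 𝓜.genVal a = FreeAlgebra.lift k 𝓜.genVal b := by
  have hg (a : Gen m θ) : FreeAlgebra.lift k 𝓜.genVal (gen k m θ a) = 𝓜.genVal a :=
    FreeAlgebra.lift_ι_apply _ _
  have hx : (𝓜.x : A) = 𝓜.X 1 := by simp [X]
  have hxi : (↑𝓜.x⁻¹ : A) = 𝓜.X (-1) := by simp [X]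
  cases hab with
  | x_mul_xinv => simp [hg, genVal]
  | xinv_mul_x => simp [hg, genVal]
  | g_mul_ginv =>
    simp only [hg, genVal, map_mul, map_one]
    rw [mul_assoc, Units.mul_inv_cancel_left, ← X_add, add_neg_cancel, X_zero]
  | ginv_mul_g =>
    simp only [hg, genVal, map_mul, map_one]
    rw [mul_assoc, ← mul_assoc (𝓜.X _), ← X_add, neg_add_cancel, X_zero, one_mul, Units.inv_mul]
  | x_g =>
    simp only [hg, genVal, map_mul]
    rw [hx, ← H_one, mul_assoc, H_X, ← mul_assoc, ← mul_assoc, ← X_add, ← X_add, add_comm]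
  | x_y i => simpa only [hg, genVal, map_mul] using 𝓜.x_y i
  | y_y i j => simpa only [hg, genVal, map_mul] using 𝓜.y_y i j
  | y_g i =>
    simp only [hg, genVal, map_mul, map_smul]
    rw [← mul_assoc, y_X, mul_assoc, y_h, mul_smul_comm, mul_assoc, P.χ_natCast]
  | y_pow i =>
    simpa only [hg, genVal, map_mul, map_pow, map_sub, map_one, Datum.e] using 𝓜.y_pow i
  | g_pow =>
    simp only [hg, genVal, map_pow]
    have h1 : Commute (𝓜.X P.d) (𝓜.h : A) := by
      have := 𝓜.H_X 1 P.d
      rw [H_one] at this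
      exact this.symm
    rw [h1.mul_pow, ← Units.val_pow_eq_pow_val, 𝓜.h_pow, Units.val_one, mul_one, X_natCast,
      ← pow_mul, mul_comm]
  | x_u j => simpa only [hg, genVal, map_mul] using 𝓜.x_u j
  | y_u i j =>
    simp only [hg, genVal, map_mul, ← Polynomial.aeval_algHom_apply]
    rw [aeval_phi, 𝓜.y_u, sub_mul, one_mul, smul_mul_assoc]
  | y_u' i j =>
    simpa only [hg, genVal, map_mul, map_smul, map_pow] using 𝓜.y_u' i j
  | u_g j =>
    simp only [hg, genVal, map_mul, map_smul, map_pow]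
    rw [← mul_assoc, u_X, mul_assoc, u_h, mul_smul_comm, P.χ_apply, ← mul_assoc, ← mul_assoc,
      ← X_neg_natCast, ← X_add]
    congr 4
    push_cast; ring
  | u_u j l =>
    have hY : FreeAlgebra.lift k 𝓜.genVal (yMon m P.M (j + l)) = P.Y 𝓜.y (j + l) := by
      simp only [yMon, Datum.Y, map_list_prod, List.map_ofFn, Function.comp_def, map_pow, hg,
        genVal]
      rfl
    have hI (n : ℤ) : FreeAlgebra.lift k 𝓜.genVal
        (intPow (gen k m θ .x) (gen k m θ .xinv) n) = 𝓜.X n := by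
      rw [X, ← intPow_units]
      simp only [intPow, map_mul, map_pow, hg, genVal]
    simp only [map_mul, map_smul, ← Polynomial.aeval_algHom_apply, hg, hI, hY]
    rw [P.prod_bracket_eq_sum, P.half_exponent, P.mulCoeff_eq]
    simp only [genVal, map_sum, map_smul, map_pow, Polynomial.aeval_X]
    rw [𝓜.u_u, Finset.mul_sum, Finset.sum_mul, Finset.sum_mul, Finset.smul_sum]
    refine Finset.sum_congr rfl fun s _ => ?_
    rw [mul_smul_comm, smul_mul_assoc, smul_mul_assoc, smul_smul, ← X_natCast]
    congr 1
    rw [mul_assoc (_ * _) (P.Y 𝓜.y (j + l)), ← mul_assoc (P.Y 𝓜.y (j + l)), Y_X,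
      ← mul_assoc (_ * _) (_ * _), ← mul_assoc (_ * _) (𝓜.X _), ← X_add, ← X_add, ← mul_assoc]
    congr 2
    change 𝓜.X _ = _
    congr 1
    push_cast; ring

/-- The algebra homomorphism from `D(m̲, d, γ)` determined by a model. -/
noncomputable def lift : P.Alg →ₐ[k] A :=
  RingQuot.liftAlgHom k ⟨FreeAlgebra.lift k 𝓜.genVal, fun _ _ h => 𝓜.lift_rel h⟩

@[simp] theorem lift_of (a : Gen m θ) :
    𝓜.lift (D.of m P.d P.M P.γ P.ξ a) = 𝓜.genVal a := by
  rw [lift, D.of, RingQuot.liftAlgHom_mkAlgHom_apply]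
  exact FreeAlgebra.lift_ι_apply _ _

end Model
namespace Datum

variable {k : Type*} [Field k] {m θ : ℕ} (P : Datum k m θ)

/-! ### The tautological model -/

/-- A generator of the algebra of a datum. -/
noncomputable abbrev of (a : Gen m θ) : P.Alg := D.of m P.d P.M P.γ P.ξ a

theorem alg_induction {motive : P.Alg → Prop} (algebraMap : ∀ r : k, motive (algebraMap k P.Alg r))
    (of : ∀ a, motive (P.of a)) (add : ∀ a b, motive a → motive b → motive (a + b))
    (mul : ∀ a b, motive a → motive b → motive (a * b)) (a : P.Alg) : motive a := by
  obtain ⟨f, rfl⟩ := RingQuot.mkAlgHom_surjective k (Rel m P.d P.M P.γ P.ξ) a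
  induction f using FreeAlgebra.induction with
  | grade0 r => rw [AlgHom.commutes]; exact algebraMap r
  | grade1 a => exact of a
  | mul a b ha hb => rw [map_mul]; exact mul _ _ ha hb
  | add a b ha hb => rw [map_add]; exact add _ _ ha hb

theorem mk_gen (a : Gen m θ) :
    RingQuot.mkAlgHom k (Rel m P.d P.M P.γ P.ξ) (gen k m θ a) = P.of a := rfl

theorem mk_rel {a b : FreeAlgebra k (Gen m θ)} (h : Rel m P.d P.M P.γ P.ξ a b) :
    RingQuot.mkAlgHom k (Rel m P.d P.M P.γ P.ξ) a =
      RingQuot.mkAlgHom k (Rel m P.d P.M P.γ P.ξ) b :=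
  RingQuot.mkAlgHom_rel k h

/-- The generator `x` as a unit. -/
noncomputable def xUnit : P.Algˣ where
  val := P.of .x
  inv := P.of .xinv
  val_inv := by simpa only [map_mul, map_one, mk_gen] using P.mk_rel .x_mul_xinv
  inv_val := by simpa only [map_mul, map_one, mk_gen] using P.mk_rel .xinv_mul_x

/-- The generator `g` as a unit. -/
noncomputable def gUnit : P.Algˣ where
  val := P.of .g
  inv := P.of .ginv
  val_inv := by simpa only [map_mul, map_one, mk_gen] using P.mk_rel .g_mul_ginv
  inv_val := by simpa only [map_mul, map_one, mk_gen] using P.mk_rel .ginv_mul_g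

theorem of_x : P.of .x = P.xUnit := rfl

theorem of_xinv : P.of .xinv = (↑P.xUnit⁻¹ : P.Alg) := rfl

theorem of_g : P.of .g = P.gUnit := rfl

theorem xUnit_gUnit : Commute P.xUnit P.gUnit :=
  Units.ext (by simpa only [map_mul, Units.val_mul, mk_gen, of_x, of_xinv, of_g] using P.mk_rel .x_g)

theorem of_x_mul_of_u (j : ZMod m) : (P.xUnit : P.Alg) * P.of (.u j) =
    P.of (.u j) * (↑P.xUnit⁻¹ : P.Alg) := by
  simpa only [map_mul, mk_gen, of_x, of_xinv, of_g] using P.mk_rel (.x_u j)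

theorem of_u_mul_xUnit_zpow (j : ZMod m) (n : ℤ) : P.of (.u j) * (↑(P.xUnit ^ n) : P.Alg) =
    (↑(P.xUnit ^ (-n)) : P.Alg) * P.of (.u j) := by
  have h : SemiconjBy (P.of (.u j)) (P.xUnit : P.Alg) (↑P.xUnit⁻¹ : P.Alg) := by
    rw [SemiconjBy, Units.eq_inv_mul_iff_mul_eq, ← mul_assoc, of_x_mul_of_u, mul_assoc,
      Units.inv_mul, mul_one]
  have := h.units_zpow_right n
  simpa [SemiconjBy] using this

variable [NeZero m]

/-- The algebra of a datum is a model of its own relations, with `h = x⁻ᵈ g`. -/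
noncomputable def self : Model P P.Alg where
  x := P.xUnit
  h := P.xUnit ^ (-(P.d : ℤ)) * P.gUnit
  y i := P.of (.y i)
  u j := P.of (.u j)
  x_h := by
    have := P.xUnit_gUnit
    exact ((Commute.refl P.xUnit).zpow_right _).mul_right this
  x_y i := by simpa only [map_mul, mk_gen, of_x, of_xinv, of_g] using P.mk_rel (.x_y i)
  y_y i j := by simpa only [map_mul, mk_gen, of_x, of_xinv, of_g] using P.mk_rel (.y_y i j)
  y_h i := by
    have h1 : Commute (P.of (.y i)) (P.xUnit : P.Alg) := by
      have := P.mk_rel (.x_y i)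
      simp only [map_mul, mk_gen, of_x] at this
      exact this.symm
    have h2 : P.of (.y i) * P.gUnit = P.γ ^ P.M i • (P.gUnit * P.of (.y i)) := by
      simpa only [map_mul, map_smul, mk_gen, of_x, of_xinv, of_g] using P.mk_rel (.y_g i)
    rw [Units.val_mul, ← mul_assoc, (h1.units_zpow_right _).eq, mul_assoc, h2, mul_smul_comm,
      mul_assoc, P.χ_natCast]
  y_pow i := by
    have h := P.mk_rel (.y_pow i)
    simp only [map_pow, map_sub, map_one, mk_gen] at h
    exact h
  h_pow := by
    have h : P.gUnit ^ m = P.xUnit ^ (m * P.d) := Units.ext (by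
      have h := P.mk_rel .g_pow
      simp only [map_pow, mk_gen] at h
      rw [Units.val_pow_eq_pow_val, Units.val_pow_eq_pow_val]
      exact h)
    rw [(P.xUnit_gUnit.zpow_left _).mul_pow, h, ← zpow_natCast, ← zpow_mul, ← zpow_natCast,
      ← zpow_add]
    convert zpow_zero P.xUnit
    push_cast; ring
  x_u j := P.of_x_mul_of_u j
  y_u i j := by
    have h := P.mk_rel (.y_u i j)
    have h1 : P.γ ^ (-((P.M i : ℤ) * (P.M i + j.val))) = P.χ (-(P.M i * (P.M i + j))) := by
      rw [← P.χ_intCast]; simp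
    simp only [map_mul, ← Polynomial.aeval_algHom_apply, mk_gen, of_x] at h
    rw [h, phi, h1]
    simp only [map_sub, map_one, map_mul, Polynomial.aeval_C, map_pow, Polynomial.aeval_X]
    rw [sub_mul, one_mul, Algebra.smul_def, mul_assoc]
  y_u' i j := by
    simpa only [map_mul, map_pow, map_smul, mk_gen, of_x, of_xinv, of_g] using P.mk_rel (.y_u' i j)
  u_h j := by
    have h : P.of (.u j) * P.gUnit = P.γ ^ j.val •
        ((↑(P.xUnit ^ (-(2 * P.d : ℤ))) : P.Alg) * P.gUnit * P.of (.u j)) := by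
      have h1 : (↑(P.xUnit ^ (-(2 * P.d : ℤ))) : P.Alg) = P.of .xinv ^ (2 * P.d) := by
        rw [zpow_neg, ← inv_zpow, show (2 * P.d : ℤ) = (2 * P.d : ℕ) by push_cast; ring,
          zpow_natCast, Units.val_pow_eq_pow_val, of_xinv]
      rw [h1]
      simpa only [map_mul, map_pow, map_smul, mk_gen, of_x, of_xinv, of_g] using P.mk_rel (.u_g j)
    rw [Units.val_mul, ← mul_assoc, of_u_mul_xUnit_zpow, mul_assoc, h, mul_smul_comm, P.χ_apply,
      ← mul_assoc, ← mul_assoc, ← Units.val_mul, ← zpow_add]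
    congr 5
    ring
  u_u j l := by
    have h := P.mk_rel (.u_u j l)
    have hY : RingQuot.mkAlgHom k (Rel m P.d P.M P.γ P.ξ) (yMon m P.M (j + l)) =
        P.Y (fun i => P.of (.y i)) (j + l) := by
      simp only [yMon, Y, map_list_prod, List.map_ofFn, Function.comp_def, map_pow, mk_gen]
      rfl
    have hI (n : ℤ) : RingQuot.mkAlgHom k (Rel m P.d P.M P.γ P.ξ)
        (intPow (gen k m θ .x) (gen k m θ .xinv) n) = ↑(P.xUnit ^ n) := by
      rw [← intPow_units]
      simp only [intPow, map_mul, map_pow, mk_gen, of_x, of_xinv]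
    simp only [map_mul, map_smul, ← Polynomial.aeval_algHom_apply, mk_gen, hI, hY] at h
    rw [h, P.prod_bracket_eq_sum, P.half_exponent, P.mulCoeff_eq]
    simp only [map_sum, map_smul, map_pow, Polynomial.aeval_X]
    rw [Finset.mul_sum, Finset.sum_mul, Finset.sum_mul, Finset.smul_sum]
    refine Finset.sum_congr rfl fun s _ => ?_
    rw [mul_smul_comm, smul_mul_assoc, smul_mul_assoc, smul_smul]
    congr 1
    have hc : Commute (P.Y (fun i => P.of (.y i)) (j + l)) (P.xUnit : P.Alg) := by
      rw [Y]
      refine Commute.list_prod_left _ _ fun a ha => ?_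
      obtain ⟨i, rfl⟩ := (List.mem_ofFn' _ _).1 ha
      refine Commute.pow_left ?_ _
      have := P.mk_rel (.x_y i)
      simp only [map_mul, mk_gen, of_x] at this
      exact this.symm
    have hx : P.of .x ^ (P.deg s * P.d) = (↑(P.xUnit ^ ((P.deg s * P.d : ℕ) : ℤ)) : P.Alg) := by
      rw [zpow_natCast, Units.val_pow_eq_pow_val]; rfl
    rw [hx, Units.val_mul, ← mul_assoc (P.Y _ _), (hc.units_zpow_right _).eq, ← mul_assoc,
      ← mul_assoc, ← Units.val_mul, ← Units.val_mul, ← zpow_add, ← zpow_add]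
    rw [of_g, show -(P.d + P.T) + ((P.deg s * P.d : ℕ) : ℤ) = P.deg s * P.d - P.T + -P.d by
      push_cast; ring]

end Datum

namespace Model
variable {k : Type*} [Field k] {m θ : ℕ} [NeZero m] {P : Datum k m θ}

theorem self_of_g : P.of .g = P.self.X P.d * P.self.h := by
  change _ = ((P.xUnit ^ (P.d : ℤ) : P.Algˣ) : P.Alg) *
    ((P.xUnit ^ (-(P.d : ℤ)) * P.gUnit : P.Algˣ) : P.Alg)
  rw [← Units.val_mul, ← mul_assoc, ← zpow_add, add_neg_cancel, zpow_zero, one_mul]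
  rfl

theorem self_of_ginv : P.of .ginv = (↑P.self.h⁻¹ : P.Alg) * P.self.X (-P.d) := by
  change _ = (((P.xUnit ^ (-(P.d : ℤ)) * P.gUnit)⁻¹ : P.Algˣ) : P.Alg) *
    ((P.xUnit ^ (-(P.d : ℤ)) : P.Algˣ) : P.Alg)
  rw [← Units.val_mul, mul_inv_rev, inv_mul_cancel_right]
  rfl

/-- Algebra homomorphisms are determined by their values on `x`, `h`, the `y_i` and the `u_j`. -/
theorem algHom_ext {B : Type*} [Ring B] [Algebra k B] {f f' : P.Alg →ₐ[k] B}
    (hx : f P.self.x = f' P.self.x) (hh : f P.self.h = f' P.self.h)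
    (hy : ∀ i, f (P.self.y i) = f' (P.self.y i)) (hu : ∀ j, f (P.self.u j) = f' (P.self.u j)) :
    f = f' := by
  have hX : Units.map (f : P.Alg →* B) P.self.x = Units.map (f' : P.Alg →* B) P.self.x :=
    Units.ext hx
  have hH : Units.map (f : P.Alg →* B) P.self.h = Units.map (f' : P.Alg →* B) P.self.h :=
    Units.ext hh
  have hXn (n : ℤ) : f (P.self.X n) = f' (P.self.X n) := by
    have h1 : Units.map (f : P.Alg →* B) (P.self.x ^ n) =
        Units.map (f' : P.Alg →* B) (P.self.x ^ n) := by rw [map_zpow, map_zpow, hX]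
    exact congrArg Units.val h1
  have hHi : f (↑P.self.h⁻¹ : P.Alg) = f' (↑P.self.h⁻¹ : P.Alg) := by
    have h1 : Units.map (f : P.Alg →* B) P.self.h⁻¹ =
        Units.map (f' : P.Alg →* B) P.self.h⁻¹ := by rw [map_inv, map_inv, hH]
    exact congrArg Units.val h1
  refine AlgHom.ext fun a => ?_
  induction a using P.alg_induction with
  | algebraMap r => rw [AlgHom.commutes, AlgHom.commutes]
  | add a b ha hb => rw [map_add, map_add, ha, hb]
  | mul a b ha hb => rw [map_mul, map_mul, ha, hb]
  | of a =>
    cases a with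
    | x => exact hx
    | xinv =>
      have h1 := hXn (-1)
      rw [X, zpow_neg_one] at h1
      exact h1
    | g => rw [self_of_g, map_mul, map_mul, hh, hXn]
    | ginv => rw [self_of_ginv, map_mul, map_mul, hHi, hXn]
    | y i => exact hy i
    | u j => exact hu j

end Model

/-! ### The binomial theorem for elements commuting up to a scalar -/

/-- The binomial theorem for elements that commute up to a scalar `q`. -/
theorem add_pow_of_qCommute {k A : Type*} [CommRing k] [Ring A] [Algebra k A] {q : k} {a b : A}
    (h : b * a = q • (a * b)) (n : ℕ) :
    (a + b) ^ n = ∑ r ∈ Finset.range (n + 1), gauss q n r • (a ^ r * b ^ (n - r)) := by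
  have hr (r : ℕ) : b * a ^ r = q ^ r • (a ^ r * b) := by
    induction r with
    | zero => simp
    | succ r ih =>
      rw [pow_succ, ← mul_assoc, ih, smul_mul_assoc, mul_assoc, h, mul_smul_comm, smul_smul,
        pow_succ, mul_assoc]
  induction n with
  | zero => simp
  | succ n ih =>
    rw [pow_succ', ih, add_mul, Finset.mul_sum, Finset.mul_sum, Finset.sum_range_succ' _ (n + 1)]
    have h1 : ∑ r ∈ Finset.range (n + 1), b * gauss q n r • (a ^ r * b ^ (n - r)) =
        ∑ r ∈ Finset.range (n + 1), (q ^ (r + 1) * gauss q n (r + 1)) •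
          (a ^ (r + 1) * b ^ (n - r)) + b ^ (n + 1) := by
      rw [Finset.sum_range_succ', Finset.sum_range_succ _ n, gauss_of_lt q (Nat.lt_succ_self n)]
      congr 1
      · rw [mul_zero, zero_smul, add_zero]
        refine Finset.sum_congr rfl fun r hr' => ?_
        have hr' := Finset.mem_range.1 hr'
        rw [mul_smul_comm, ← mul_assoc, hr, smul_mul_assoc, smul_smul, mul_assoc, ← pow_succ',
          show n - (r + 1) + 1 = n - r by omega, mul_comm]
      · simp [pow_succ']
    rw [h1, ← add_assoc, ← Finset.sum_add_distrib]
    congr 1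
    · refine Finset.sum_congr rfl fun r _ => ?_
      rw [mul_smul_comm, ← mul_assoc, ← pow_succ', gauss_succ_succ, add_smul, Nat.add_sub_add_right]
    · simp

namespace Datum

variable {k : Type*} [Field k] {m θ : ℕ} (P : Datum k m θ)

theorem le_of_B_ne_zero {N n : ZMod m} (h : P.B N n ≠ 0) (i : Fin θ) : P.co n i ≤ P.co N i := by
  by_contra hc
  exact h (Finset.prod_eq_zero (Finset.mem_univ i) (gauss_of_lt _ (by omega)))

theorem Y_zero_left (n : ZMod m) : P.Y (fun _ => (0 : k)) n = if n = 0 then 1 else 0 := by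
  split_ifs with h
  · rw [h, Y_zero]
  · obtain ⟨i, hi⟩ : ∃ i, P.co n i ≠ 0 := by
      by_contra hc
      push Not at hc
      exact h (P.co_ext fun i => by rw [hc i, co_zero])
    exact List.prod_eq_zero ((List.mem_ofFn' _ _).2 ⟨i, zero_pow hi⟩)

theorem card_ne_zero [NeZero m] (P : Datum k m θ) : (m : k) ≠ 0 :=
  (IsPrimitiveRoot.neZero' P.prim).out

end Datum

namespace Model

variable {k : Type*} [Field k] {m θ : ℕ} [NeZero m] (P : Datum k m θ)

/-! ### The model of the counit -/

/-- The values of the counit on the generators. -/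
noncomputable def counit : Model P k where
  x := 1
  h := 1
  y _ := 0
  u j := if j = 0 then 1 else 0
  x_h := rfl
  x_y _ := by simp
  y_y _ _ := rfl
  y_h _ := by simp
  y_pow i := by simp [(P.e_pos i).ne']
  h_pow := one_pow m
  x_u _ := by simp
  y_u i j := by
    by_cases h : j + P.M i = 0
    · simp [h, show (P.M i : ZMod m) + j = 0 by rw [add_comm, h]]
    · simp [h]
  y_u' _ _ := by simp
  u_h j := by split_ifs with h <;> simp [h]
  u_u j l := by
    simp only [one_zpow, Units.val_one, one_mul, mul_one, P.Y_zero_left]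
    by_cases h : j + l = 0
    · simp only [h, if_true, P.G_zero_left, one_mul, smul_eq_mul, mul_one, ← Finset.mul_sum]
      have h1 : ∑ s, P.χ (-(j * s)) = if -j = 0 then (m : k) else 0 := by
        rw [← P.sum_χ_mul]
        exact Finset.sum_congr rfl fun s _ => by congr 1; ring
      rw [h1]
      by_cases hj : j = 0
      · have hl : l = 0 := by simpa [hj] using h
        simp [hj, hl, P.card_ne_zero]
      · simp [hj]
    · simp only [h, if_false, smul_zero, Finset.sum_const_zero]
      by_cases hj : j = 0
      · have hl : l ≠ 0 := fun hl => h (by rw [hj, hl, add_zero])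
        simp [hl]
      · simp [hj]

variable {P} {A : Type*} [Ring A] [Algebra k A] (𝓜 : Model P A)

/-! ### The model of the coproduct -/

/-- The group-like element `a ⊗ a` attached to a unit `a`. -/
def diag : Aˣ →* (A ⊗[k] A)ˣ where
  toFun a := ⟨a ⊗ₜ a, (↑a⁻¹ : A) ⊗ₜ (↑a⁻¹ : A),
    by simp [Algebra.TensorProduct.one_def], by simp [Algebra.TensorProduct.one_def]⟩
  map_one' := by ext; simp [Algebra.TensorProduct.one_def]
  map_mul' a b := by ext; simp

@[simp] theorem val_diag (a : Aˣ) : ((diag a : (A ⊗[k] A)ˣ) : A ⊗[k] A) = (a : A) ⊗ₜ (a : A) := rfl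

/-- The group-like element `g ^ m_i = x ^ (m_i d) h ^ m_i` of the algebra. -/
def K (i : Fin θ) : A := 𝓜.X (P.M i * P.d) * 𝓜.H (P.M i)

/-- The coproduct of `y_i`. -/
def comulY (i : Fin θ) : A ⊗[k] A := 𝓜.y i ⊗ₜ 𝓜.K i + 1 ⊗ₜ 𝓜.y i

/-- The coproduct of `u_j`. -/
noncomputable def comulU (j : ZMod m) : A ⊗[k] A :=
  ∑ s, P.χ (s * (j - s)) • (𝓜.u s ⊗ₜ (𝓜.H s * 𝓜.u (j - s)))

theorem x_K (i : Fin θ) : 𝓜.x * 𝓜.K i = 𝓜.K i * 𝓜.x := by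
  have hx : (𝓜.x : A) = 𝓜.X 1 := by simp [X]
  rw [hx, K, mul_assoc, H_X, ← mul_assoc, ← mul_assoc, ← X_add, ← X_add, add_comm]

theorem h_K (i : Fin θ) : 𝓜.K i * 𝓜.h = 𝓜.h * 𝓜.K i := by
  rw [K, ← H_one, mul_assoc, ← H_add, ← mul_assoc, H_X, mul_assoc, ← H_add, add_comm]

theorem K_K (i j : Fin θ) : 𝓜.K i * 𝓜.K j = 𝓜.K j * 𝓜.K i := by
  have this (i j : Fin θ) :
      𝓜.K i * 𝓜.K j = 𝓜.X (P.M i * P.d + P.M j * P.d) * 𝓜.H (P.M i + P.M j) := by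
    rw [X_add, H_add, K, K, mul_assoc, ← mul_assoc (𝓜.H _) (𝓜.X _), H_X]
    simp only [mul_assoc]
  rw [this, this, add_comm, add_comm (P.M i : ZMod m)]

theorem y_K (i j : Fin θ) : 𝓜.y i * 𝓜.K j = P.χ (P.M i * P.M j) • (𝓜.K j * 𝓜.y i) := by
  rw [K, ← mul_assoc, y_X, mul_assoc, y_H, mul_smul_comm, mul_assoc]

theorem K_pow (i : Fin θ) (n : ℕ) : 𝓜.K i ^ n = 𝓜.X (n * (P.M i * P.d)) * 𝓜.H (n * P.M i) := by
  induction n with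
  | zero => simp
  | succ n ih =>
    rw [pow_succ, ih, K, Nat.cast_succ, Nat.cast_succ, add_mul, add_mul, one_mul, one_mul, X_add,
      H_add, mul_assoc, ← mul_assoc (𝓜.H _) (𝓜.X _), H_X]
    simp only [mul_assoc]

theorem comulY_comm (i j : Fin θ) : 𝓜.comulY i * 𝓜.comulY j = 𝓜.comulY j * 𝓜.comulY i := by
  by_cases hij : i = j
  · rw [hij]
  · have h (i j : Fin θ) (hij : i ≠ j) : 𝓜.y i * 𝓜.K j = 𝓜.K j * 𝓜.y i := by
      rw [y_K, P.M_mul_M hij, AddChar.map_zero_eq_one, one_smul]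
    simp only [comulY, add_mul, mul_add, Algebra.TensorProduct.tmul_mul_tmul, one_mul, mul_one]
    rw [𝓜.y_y i j, 𝓜.K_K i j, h i j hij, h j i (Ne.symm hij)]
    abel

/-- In the binomial expansion of the `e_i`-th power, all coefficients but the outer two vanish. -/
theorem comulY_pow (i : Fin θ) :
    𝓜.comulY i ^ P.e i = 1 - ((𝓜.x : A) ⊗ₜ[k] (𝓜.x : A)) ^ (P.e i * P.M i * P.d) := by
  have hq : (1 ⊗ₜ[k] 𝓜.y i) * (𝓜.y i ⊗ₜ[k] 𝓜.K i) =
      P.q i • ((𝓜.y i ⊗ₜ[k] 𝓜.K i) * (1 ⊗ₜ[k] 𝓜.y i)) := by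
    have : P.χ (P.M i * P.M i) = P.q i := by
      rw [← Nat.cast_mul, P.χ_natCast, ← pow_two]; rfl
    simp only [Algebra.TensorProduct.tmul_mul_tmul, one_mul, mul_one]
    rw [y_K, this, TensorProduct.tmul_smul]
  have hpos := P.e_pos i
  rw [comulY, add_pow_of_qCommute hq, Finset.sum_range_succ, Nat.sub_self,
    ← Nat.sub_add_cancel hpos, Finset.sum_range_succ', Nat.sub_add_cancel hpos,
    Finset.sum_eq_zero, zero_add]
  · simp only [gauss_zero_right, gauss_self, pow_zero, mul_one, one_mul, one_smul, Nat.sub_zero,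
      Algebra.TensorProduct.tmul_pow, one_pow, 𝓜.y_pow]
    have hK : 𝓜.K i ^ P.e i = (𝓜.x : A) ^ (P.e i * P.M i * P.d) := by
      rw [K_pow, P.e_mul_M, H_zero, mul_one, ← X_natCast]
      congr 1
      push_cast; ring
    rw [hK, TensorProduct.sub_tmul, TensorProduct.tmul_sub, Algebra.TensorProduct.one_def]
    abel
  · intro r hr
    have hr := Finset.mem_range.1 hr
    have := gauss_eq_zero_of_carry (P.q_prim i) (a := r + 1) (b := P.e i - (r + 1)) (by omega)
      (by omega) (by omega)
    rw [Nat.add_sub_cancel' (by omega)] at this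
    rw [this, zero_smul]

/-- The element `(x ^ a ⊗ x ^ b) (u_s ⊗ h ^ s u_{j - s})`. -/
def uTensor (j : ZMod m) (a b : ℤ) (s : ZMod m) : A ⊗[k] A :=
  (𝓜.X a * 𝓜.u s) ⊗ₜ (𝓜.X b * (𝓜.H s * 𝓜.u (j - s)))

theorem X_mul_comulU (j : ZMod m) (n : ℤ) : (𝓜.X n ⊗ₜ[k] 𝓜.X n) * 𝓜.comulU j =
    ∑ s, P.χ (s * (j - s)) • 𝓜.uTensor j n n s := by
  rw [comulU, Finset.mul_sum]
  refine Finset.sum_congr rfl fun s _ => ?_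
  rw [mul_smul_comm, Algebra.TensorProduct.tmul_mul_tmul, uTensor]

theorem comulU_eq (j : ZMod m) : 𝓜.comulU j = ∑ s, P.χ (s * (j - s)) • 𝓜.uTensor j 0 0 s := by
  rw [← X_mul_comulU, X_zero, ← Algebra.TensorProduct.one_def, one_mul]

theorem x_mul_comulU (j : ZMod m) : ((𝓜.x : A) ⊗ₜ[k] (𝓜.x : A)) * 𝓜.comulU j =
    𝓜.comulU j * ((↑𝓜.x⁻¹ : A) ⊗ₜ[k] (↑𝓜.x⁻¹ : A)) := by
  have hx : (𝓜.x : A) = 𝓜.X 1 := by simp [X]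
  have hxi : (↑𝓜.x⁻¹ : A) = 𝓜.X (-1) := by simp [X]
  rw [hx, hxi, comulU, Finset.mul_sum, Finset.sum_mul]
  refine Finset.sum_congr rfl fun s _ => ?_
  rw [mul_smul_comm, smul_mul_assoc, Algebra.TensorProduct.tmul_mul_tmul,
    Algebra.TensorProduct.tmul_mul_tmul, u_X, mul_assoc (𝓜.H s), u_X, ← mul_assoc, ← mul_assoc,
    H_X, neg_neg]

theorem comulU_mul_h (j : ZMod m) : 𝓜.comulU j * ((𝓜.h : A) ⊗ₜ[k] (𝓜.h : A)) =
    P.χ j • (((𝓜.h : A) ⊗ₜ[k] (𝓜.h : A)) * 𝓜.comulU j) := by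
  rw [← H_one, comulU, Finset.mul_sum, Finset.sum_mul, Finset.smul_sum]
  refine Finset.sum_congr rfl fun s _ => ?_
  rw [mul_smul_comm, smul_mul_assoc, Algebra.TensorProduct.tmul_mul_tmul,
    Algebra.TensorProduct.tmul_mul_tmul, u_H, mul_assoc (𝓜.H s), u_H, mul_smul_comm, ← mul_assoc,
    ← mul_assoc, ← H_add, ← H_add, TensorProduct.tmul_smul, ← TensorProduct.smul_tmul', smul_smul,
    smul_smul, smul_smul, ← AddChar.map_add_eq_mul, ← AddChar.map_add_eq_mul,
    ← AddChar.map_add_eq_mul, add_comm s 1]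
  congr 2
  ring

/-- The common value of `Δ(y_i) Δ(u_j)` and `ξ_i Δ(x ^ (m_i d)) Δ(u_j) Δ(y_i)`. -/
theorem sum_uTensor (i : Fin θ) (j : ZMod m) :
    𝓜.comulU (j + P.M i) - P.χ (-(P.M i * (P.M i + j))) •
        ((𝓜.X (P.M i * P.d) ⊗ₜ[k] 𝓜.X (P.M i * P.d)) * 𝓜.comulU (j + P.M i)) =
      ∑ s, (P.χ (s * (j + P.M i - s)) • 𝓜.uTensor (j + P.M i) 0 0 s -
        P.χ (s * (j + P.M i - s) - P.M i * (P.M i + j)) •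
          𝓜.uTensor (j + P.M i) (P.M i * P.d) (P.M i * P.d) s) := by
  rw [X_mul_comulU, comulU_eq, Finset.smul_sum, Finset.sum_sub_distrib]
  congr 1
  refine Finset.sum_congr rfl fun s _ => ?_
  rw [smul_smul, ← AddChar.map_add_eq_mul]
  congr 2
  ring

theorem comulY_mul_comulU (i : Fin θ) (j : ZMod m) : 𝓜.comulY i * 𝓜.comulU j =
    𝓜.comulU (j + P.M i) - P.χ (-(P.M i * (P.M i + j))) •
      ((𝓜.X (P.M i * P.d) ⊗ₜ[k] 𝓜.X (P.M i * P.d)) * 𝓜.comulU (j + P.M i)) := by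
  have h1 (s : ZMod m) : (𝓜.y i ⊗ₜ[k] 𝓜.K i) * (𝓜.u s ⊗ₜ[k] (𝓜.H s * 𝓜.u (j - s))) =
      𝓜.uTensor (j + P.M i) 0 (P.M i * P.d) (s + P.M i) - P.χ (-(P.M i * (P.M i + s))) •
        𝓜.uTensor (j + P.M i) (P.M i * P.d) (P.M i * P.d) (s + P.M i) := by
    rw [Algebra.TensorProduct.tmul_mul_tmul, y_u_X, K, mul_assoc (𝓜.X _), ← mul_assoc (𝓜.H _),
      ← H_add, TensorProduct.sub_tmul, ← TensorProduct.smul_tmul', uTensor, uTensor,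
      add_sub_add_right_eq_sub, add_comm (P.M i : ZMod m) s, X_zero, one_mul]
  have h2 (s : ZMod m) : ((1 : A) ⊗ₜ[k] 𝓜.y i) * (𝓜.u s ⊗ₜ[k] (𝓜.H s * 𝓜.u (j - s))) =
      P.χ (P.M i * s) • 𝓜.uTensor (j + P.M i) 0 0 s -
        P.χ (P.M i * s - P.M i * (P.M i + (j - s))) •
          𝓜.uTensor (j + P.M i) 0 (P.M i * P.d) s := by
    rw [Algebra.TensorProduct.tmul_mul_tmul, one_mul, ← mul_assoc, y_H, smul_mul_assoc, mul_assoc,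
      y_u_X, mul_sub, mul_smul_comm, ← mul_assoc (𝓜.H s), H_X, smul_sub, smul_smul,
      ← AddChar.map_add_eq_mul, TensorProduct.tmul_sub, TensorProduct.tmul_smul,
      TensorProduct.tmul_smul, ← sub_eq_add_neg, uTensor, uTensor, X_zero, one_mul, one_mul,
      mul_assoc, show j - s + (P.M i : ZMod m) = j + P.M i - s by ring]
  rw [sum_uTensor, comulY, comulU, Finset.mul_sum]
  simp only [mul_smul_comm, add_mul, h1, h2, smul_add, Finset.sum_add_distrib]
  rw [← Equiv.sum_comp (Equiv.subRight (P.M i : ZMod m)), ← Finset.sum_add_distrib]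
  refine Finset.sum_congr rfl fun s _ => ?_
  simp only [Equiv.subRight_apply, sub_add_cancel, smul_sub, smul_smul, ← AddChar.map_add_eq_mul]
  -- the mixed terms cancel
  rw [show (s - (P.M i : ZMod m)) * (j - (s - P.M i)) =
      s * (j - s) + (P.M i * s - P.M i * (P.M i + (j - s))) by ring,
    show s * (j - s) + (P.M i * s - P.M i * (P.M i + (j - s))) +
      -(P.M i * (P.M i + (s - P.M i))) = s * (j + P.M i - s) - P.M i * (P.M i + j) by ring,
    show s * (j - s) + P.M i * s = s * (j + P.M i - s) by ring]
  abel

theorem comulU_mul_comulY (i : Fin θ) (j : ZMod m) :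
    P.ξ i • ((𝓜.X (P.M i * P.d) ⊗ₜ[k] 𝓜.X (P.M i * P.d)) * 𝓜.comulU j * 𝓜.comulY i) =
    𝓜.comulU (j + P.M i) - P.χ (-(P.M i * (P.M i + j))) •
      ((𝓜.X (P.M i * P.d) ⊗ₜ[k] 𝓜.X (P.M i * P.d)) * 𝓜.comulU (j + P.M i)) := by
  have h1 (s : ZMod m) : P.ξ i • ((𝓜.X (P.M i * P.d) ⊗ₜ[k] 𝓜.X (P.M i * P.d)) *
        (𝓜.u s ⊗ₜ[k] (𝓜.H s * 𝓜.u (j - s))) * (𝓜.y i ⊗ₜ[k] 𝓜.K i)) =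
      P.χ ((j - s) * P.M i) • 𝓜.uTensor (j + P.M i) 0 0 (s + P.M i) -
        P.χ ((j - s) * P.M i - P.M i * (P.M i + s)) •
          𝓜.uTensor (j + P.M i) (P.M i * P.d) 0 (s + P.M i) := by
    have hL : P.ξ i • (𝓜.X (P.M i * P.d) * 𝓜.u s * 𝓜.y i) = 𝓜.y i * 𝓜.u s := by
      rw [y_u_X', mul_assoc]
    have hR : 𝓜.X (P.M i * P.d) * (𝓜.H s * 𝓜.u (j - s)) * 𝓜.K i =
        P.χ ((j - s) * P.M i) • (𝓜.H (s + P.M i) * 𝓜.u (j - s)) := by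
      rw [K, mul_assoc, mul_assoc (𝓜.H s), ← mul_assoc (𝓜.u _), u_X, mul_assoc (𝓜.X (-_)), u_H,
        mul_smul_comm, mul_smul_comm, mul_smul_comm, ← mul_assoc (𝓜.H s), H_X, mul_assoc (𝓜.X (-_)),
        ← mul_assoc (𝓜.X _), ← X_add, add_neg_cancel, X_zero, one_mul, ← mul_assoc, ← H_add]
    rw [Algebra.TensorProduct.tmul_mul_tmul, Algebra.TensorProduct.tmul_mul_tmul, hR,
      TensorProduct.smul_tmul', hL, y_u_X, TensorProduct.tmul_smul, TensorProduct.sub_tmul,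
      ← TensorProduct.smul_tmul', smul_sub, smul_smul, ← AddChar.map_add_eq_mul, ← sub_eq_add_neg,
      uTensor, uTensor, add_sub_add_right_eq_sub, X_zero, one_mul, one_mul]
  have h2 (s : ZMod m) : P.ξ i • ((𝓜.X (P.M i * P.d) ⊗ₜ[k] 𝓜.X (P.M i * P.d)) *
        (𝓜.u s ⊗ₜ[k] (𝓜.H s * 𝓜.u (j - s))) * ((1 : A) ⊗ₜ[k] 𝓜.y i)) =
      𝓜.uTensor (j + P.M i) (P.M i * P.d) 0 s - P.χ (-(P.M i * (P.M i + (j - s)))) •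
        𝓜.uTensor (j + P.M i) (P.M i * P.d) (P.M i * P.d) s := by
    have hR : P.ξ i • (𝓜.X (P.M i * P.d) * (𝓜.H s * 𝓜.u (j - s)) * 𝓜.y i) =
        𝓜.H s * (𝓜.y i * 𝓜.u (j - s)) := by
      rw [y_u_X', mul_smul_comm, ← mul_assoc (𝓜.H s) (𝓜.X _), H_X]
      simp only [mul_assoc]
    rw [Algebra.TensorProduct.tmul_mul_tmul, Algebra.TensorProduct.tmul_mul_tmul, mul_one,
      ← TensorProduct.tmul_smul, hR, y_u_X, mul_sub, mul_smul_comm, ← mul_assoc (𝓜.H s) (𝓜.X _),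
      H_X, TensorProduct.tmul_sub, TensorProduct.tmul_smul, uTensor, uTensor, X_zero, one_mul,
      mul_assoc, show j - s + (P.M i : ZMod m) = j + P.M i - s by ring]
  rw [sum_uTensor, comulY, comulU, Finset.mul_sum, Finset.sum_mul, Finset.smul_sum]
  have h3 (s : ZMod m) : P.ξ i • ((𝓜.X (P.M i * P.d) ⊗ₜ[k] 𝓜.X (P.M i * P.d)) *
        P.χ (s * (j - s)) • (𝓜.u s ⊗ₜ[k] (𝓜.H s * 𝓜.u (j - s))) *
        (𝓜.y i ⊗ₜ[k] 𝓜.K i + (1 : A) ⊗ₜ[k] 𝓜.y i)) =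
      (P.χ (s * (j - s) + (j - s) * P.M i) • 𝓜.uTensor (j + P.M i) 0 0 (s + P.M i) -
        P.χ (s * (j - s) + ((j - s) * P.M i - P.M i * (P.M i + s))) •
          𝓜.uTensor (j + P.M i) (P.M i * P.d) 0 (s + P.M i)) +
      (P.χ (s * (j - s)) • 𝓜.uTensor (j + P.M i) (P.M i * P.d) 0 s -
        P.χ (s * (j - s) - P.M i * (P.M i + (j - s))) •
          𝓜.uTensor (j + P.M i) (P.M i * P.d) (P.M i * P.d) s) := by
    rw [mul_smul_comm, smul_mul_assoc, smul_comm, mul_add, smul_add, h1, h2, smul_add, smul_sub,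
      smul_sub, smul_smul, smul_smul, smul_smul, ← AddChar.map_add_eq_mul,
      ← AddChar.map_add_eq_mul, ← AddChar.map_add_eq_mul, ← sub_eq_add_neg]
  rw [Finset.sum_congr rfl fun s _ => h3 s, Finset.sum_add_distrib,
    ← Equiv.sum_comp (Equiv.subRight (P.M i : ZMod m)), ← Finset.sum_add_distrib]
  refine Finset.sum_congr rfl fun s _ => ?_
  simp only [Equiv.subRight_apply, sub_add_cancel]
  -- the mixed terms cancel
  rw [show (s - (P.M i : ZMod m)) * (j - (s - P.M i)) + (j - (s - P.M i)) * P.M i =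
      s * (j + P.M i - s) by ring,
    show (s - (P.M i : ZMod m)) * (j - (s - P.M i)) +
      ((j - (s - P.M i)) * P.M i - P.M i * (P.M i + (s - P.M i))) = s * (j - s) by ring,
    show s * (j - s) - (P.M i : ZMod m) * (P.M i + (j - s)) =
      s * (j + P.M i - s) - P.M i * (P.M i + j) by ring]
  abel

end Model
namespace Model

variable {k : Type*} [Field k] {m θ : ℕ} [NeZero m] {P : Datum k m θ}
  {A : Type*} [Ring A] [Algebra k A] (𝓜 : Model P A)

/-- The coproduct of a monomial in the `y_i`: the product over `i` of the `q_i`-binomial theorems.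
-/
theorem Y_comulY (N : ZMod m) : P.Y 𝓜.comulY N = ∑ n, P.B N n •
    (P.Y 𝓜.y n ⊗ₜ[k] (𝓜.X (P.deg n * P.d) * 𝓜.H n * P.Y 𝓜.y (N - n))) := by
  induction N using P.co_induction with
  | zero =>
    simp only [P.B_zero_left, ite_smul, one_smul, zero_smul, Finset.sum_ite_eq', Finset.mem_univ,
      if_true]
    simp [Algebra.TensorProduct.one_def]
  | add N i h ih =>
    set F : ZMod m → A ⊗[k] A := fun n =>
      P.Y 𝓜.y n ⊗ₜ[k] (𝓜.X (P.deg n * P.d) * 𝓜.H n * P.Y 𝓜.y (N + P.M i - n)) with hF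
    have h1 (n : ZMod m) : 𝓜.comulY i * P.B N n •
        (P.Y 𝓜.y n ⊗ₜ[k] (𝓜.X (P.deg n * P.d) * 𝓜.H n * P.Y 𝓜.y (N - n))) =
        P.B N n • F (n + P.M i) + (P.χ (P.M i * n) * P.B N n) • F n := by
      by_cases h0 : P.B N n = 0
      · simp [h0]
      have hle := P.le_of_B_ne_zero h0 i
      have hn : P.co n i + 1 < P.e i := by omega
      have hNn : P.co (N - n) i + 1 < P.e i := by rw [P.co_sub_of_le hle]; omega
      rw [mul_smul_comm, mul_comm (P.χ _), mul_smul, ← smul_add]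
      congr 1
      rw [comulY, add_mul, Algebra.TensorProduct.tmul_mul_tmul, Algebra.TensorProduct.tmul_mul_tmul,
        P.mul_Y 𝓜.y_y hn, one_mul, ← mul_assoc (𝓜.y i), ← mul_assoc (𝓜.y i), y_X,
        mul_assoc (𝓜.X _) (𝓜.y i), y_H, mul_smul_comm, smul_mul_assoc, TensorProduct.tmul_smul,
        ← mul_assoc (𝓜.X _) (𝓜.H n), mul_assoc _ (𝓜.y i), P.mul_Y 𝓜.y_y hNn]
      congr 1
      · rw [hF]
        simp only
        rw [P.deg_add_M hn, add_sub_add_right_eq_sub, K, mul_assoc (𝓜.X _) (𝓜.H _),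
          ← mul_assoc (𝓜.H _), ← mul_assoc (𝓜.H _), H_X, mul_assoc (𝓜.X _) (𝓜.H _) (𝓜.H _),
          ← H_add, ← mul_assoc (𝓜.X _), ← mul_assoc (𝓜.X _), ← X_add, add_comm (P.M i : ZMod m) n]
        congr 4
        push_cast; ring
      · rw [hF]
        simp only
        rw [sub_add_eq_add_sub]
    rw [← P.mul_Y 𝓜.comulY_comm h, ih, Finset.mul_sum, Finset.sum_congr rfl fun n _ => h1 n,
      Finset.sum_add_distrib, ← Equiv.sum_comp (Equiv.subRight (P.M i : ZMod m)),
      ← Finset.sum_add_distrib]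
    refine Finset.sum_congr rfl fun n _ => ?_
    rw [Equiv.subRight_apply, sub_add_cancel, ← add_smul, ← P.B_add_M h]

/-- A monomial `x ^ a h Y_n ⊗ x ^ b h ^ (n + 1) Y_(N - n)`; both sides of the relation for
`Δ(u_j) Δ(u_l)` are combinations of these with `N = j + l`. -/
noncomputable def yTensor (N n : ZMod m) (a b : ℤ) : A ⊗[k] A :=
  (𝓜.X a * 𝓜.H 1 * P.Y 𝓜.y n) ⊗ₜ (𝓜.X b * 𝓜.H (n + 1) * P.Y 𝓜.y (N - n))

theorem mul_Y_comulY (N : ZMod m) (a : ℤ) :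
    (𝓜.X a ⊗ₜ[k] 𝓜.X a) * (𝓜.H 1 ⊗ₜ[k] 𝓜.H 1) * P.Y 𝓜.comulY N =
      ∑ n, P.B N n • 𝓜.yTensor N n a (P.deg n * P.d + a) := by
  rw [Y_comulY, Finset.mul_sum]
  refine Finset.sum_congr rfl fun n _ => ?_
  rw [mul_smul_comm, Algebra.TensorProduct.tmul_mul_tmul, Algebra.TensorProduct.tmul_mul_tmul,
    yTensor]
  congr 2
  rw [mul_assoc (𝓜.X a) (𝓜.H 1), ← mul_assoc (𝓜.H 1), ← mul_assoc (𝓜.H 1), H_X,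
    mul_assoc (𝓜.X _) (𝓜.H 1), ← H_add, ← mul_assoc (𝓜.X a), ← mul_assoc (𝓜.X a), ← X_add,
    add_comm a, add_comm 1 n]

/-- One term of `Δ(u_j) Δ(u_l)`, with summation indices `a` and `n - a` in the two factors. -/
theorem tmul_u_u (j l a n : ZMod m) :
    (𝓜.u a ⊗ₜ[k] (𝓜.H a * 𝓜.u (j - a))) * (𝓜.u (n - a) ⊗ₜ[k] (𝓜.H (n - a) * 𝓜.u (l - (n - a)))) =
      ∑ s, ∑ t, (P.C (n - a) * (m : k)⁻¹ * P.G n s * P.χ (n - a * s) *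
        (P.C (l - (n - a)) * (m : k)⁻¹ * P.G (j + l - n) t *
          P.χ (j + l - n - (j - a) * t) * P.χ ((j - a) * (n - a)))) •
        𝓜.yTensor (j + l) n (P.deg s * P.d - P.T) (P.deg t * P.d - P.T) := by
  have h1 : 𝓜.H a * 𝓜.u (j - a) * (𝓜.H (n - a) * 𝓜.u (l - (n - a))) =
      P.χ ((j - a) * (n - a)) • (𝓜.H n * (𝓜.u (j - a) * 𝓜.u (l - (n - a)))) := by
    rw [mul_assoc, ← mul_assoc (𝓜.u _), u_H, smul_mul_assoc, mul_smul_comm, mul_assoc,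
      ← mul_assoc (𝓜.H a), ← H_add, add_sub_cancel]
  rw [Algebra.TensorProduct.tmul_mul_tmul, h1, u_u_X, u_u_X, add_sub_cancel,
    show j - a + (l - (n - a)) = j + l - n by ring, Finset.mul_sum, Finset.smul_sum,
    TensorProduct.sum_tmul]
  refine Finset.sum_congr rfl fun s _ => ?_
  rw [TensorProduct.tmul_sum]
  refine Finset.sum_congr rfl fun t _ => ?_
  rw [mul_smul_comm, smul_smul, TensorProduct.tmul_smul, ← TensorProduct.smul_tmul', smul_smul,
    yTensor, mul_comm (P.χ ((j - a) * (n - a))), ← mul_assoc (𝓜.H n), ← mul_assoc (𝓜.H n), H_X,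
    mul_assoc (𝓜.X _) (𝓜.H n), ← H_add]
  congr 1
  ring

theorem comulU_mul_comulU (j l : ZMod m) : 𝓜.comulU j * 𝓜.comulU l =
    ∑ s, (P.C l * (m : k)⁻¹ * P.G (j + l) s * P.χ (j + l - j * s)) •
      ((𝓜.X (P.deg s * P.d - P.T) ⊗ₜ[k] 𝓜.X (P.deg s * P.d - P.T)) * (𝓜.H 1 ⊗ₜ[k] 𝓜.H 1) *
        P.Y 𝓜.comulY (j + l)) := by
  set Z := fun n s t => 𝓜.yTensor (j + l) n (P.deg s * P.d - P.T) (P.deg t * P.d - P.T) with hZ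
  -- the scalars of the `a`-th summand, for fixed `n`, `s`, `t`, as a function of `a`
  have hscal (a n s t : ZMod m) : P.χ (a * (j - a)) * P.χ ((n - a) * (l - (n - a))) *
      (P.C (n - a) * (m : k)⁻¹ * P.G n s * P.χ (n - a * s) *
        (P.C (l - (n - a)) * (m : k)⁻¹ * P.G (j + l - n) t *
          P.χ (j + l - n - (j - a) * t) * P.χ ((j - a) * (n - a)))) =
      P.C l * (m : k)⁻¹ * (m : k)⁻¹ * P.G n s * P.G (j + l - n) t *
        P.χ (j + l + j * n - j * t) * P.χ (a * (t - (n + s))) := by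
    have hC : P.C (n - a) * P.C (l - (n - a)) * P.χ ((n - a) * (l - (n - a))) = P.C l := by
      rw [← P.C_add, add_sub_cancel]
    have hχ : P.χ (a * (j - a)) * P.χ (n - a * s) * P.χ (j + l - n - (j - a) * t) *
        P.χ ((j - a) * (n - a)) = P.χ (j + l + j * n - j * t) * P.χ (a * (t - (n + s))) := by
      simp only [← AddChar.map_add_eq_mul]
      congr 1
      ring
    linear_combination (m : k)⁻¹ * (m : k)⁻¹ * P.G n s * P.G (j + l - n) t *
      (P.χ (a * (j - a)) * P.χ (n - a * s) * P.χ (j + l - n - (j - a) * t) *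
        P.χ ((j - a) * (n - a)) * hC + P.C l * hχ)
  have hL : 𝓜.comulU j * 𝓜.comulU l = ∑ n, ∑ s, (P.C l * (m : k)⁻¹ * P.G n s *
      P.G (j + l - n) (n + s) * P.χ (j + l - j * s)) • Z n s (n + s) := by
    have h1 : 𝓜.comulU j * 𝓜.comulU l = ∑ a, ∑ n, ∑ s, ∑ t,
        (P.C l * (m : k)⁻¹ * (m : k)⁻¹ * P.G n s * P.G (j + l - n) t *
        P.χ (j + l + j * n - j * t) * P.χ (a * (t - (n + s)))) • Z n s t := by
      rw [comulU, comulU, Finset.sum_mul]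
      refine Finset.sum_congr rfl fun a _ => ?_
      rw [Finset.mul_sum, ← Equiv.sum_comp (Equiv.subRight a)]
      refine Finset.sum_congr rfl fun n _ => ?_
      rw [Equiv.subRight_apply, smul_mul_smul_comm, tmul_u_u, Finset.smul_sum]
      refine Finset.sum_congr rfl fun s _ => ?_
      rw [Finset.smul_sum]
      refine Finset.sum_congr rfl fun t _ => ?_
      rw [smul_smul, hscal]
    rw [h1, Finset.sum_comm]
    refine Finset.sum_congr rfl fun n _ => ?_
    rw [Finset.sum_comm]
    refine Finset.sum_congr rfl fun s _ => ?_
    rw [Finset.sum_comm]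
    -- orthogonality of characters leaves the term `t = n + s`
    simp only [← Finset.sum_smul, ← Finset.mul_sum, P.sum_χ_mul, sub_eq_zero]
    rw [Finset.sum_eq_single (n + s)]
    · rw [if_pos rfl]
      congr 1
      have hm := P.card_ne_zero
      rw [show j + l + j * n - j * (n + s) = j + l - j * s by ring]
      field_simp
    · intro t _ ht
      rw [if_neg ht, mul_zero, zero_smul]
    · simp
  rw [hL, Finset.sum_comm]
  refine Finset.sum_congr rfl fun s _ => ?_
  rw [mul_Y_comulY, Finset.smul_sum]
  refine Finset.sum_congr rfl fun n _ => ?_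
  rw [smul_smul, show P.C l * (m : k)⁻¹ * P.G (j + l) s * P.χ (j + l - j * s) * P.B (j + l) n =
    P.C l * (m : k)⁻¹ * P.G n s * P.G (j + l - n) (n + s) * P.χ (j + l - j * s) by
      linear_combination -(P.C l * (m : k)⁻¹ * P.χ (j + l - j * s)) * P.G_mul_G (j + l) n s]
  by_cases h0 : P.G n s = 0
  · simp [h0]
  · rw [hZ]
    simp only
    rw [P.deg_add_of_G_ne_zero h0]
    congr 2
    push_cast; ring

theorem comulY_mul_h (i : Fin θ) : 𝓜.comulY i * ((𝓜.h : A) ⊗ₜ[k] (𝓜.h : A)) =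
    P.χ (P.M i) • (((𝓜.h : A) ⊗ₜ[k] (𝓜.h : A)) * 𝓜.comulY i) := by
  rw [comulY, mul_add, add_mul]
  simp only [Algebra.TensorProduct.tmul_mul_tmul, 𝓜.y_h, 𝓜.h_K, one_mul, mul_one,
    TensorProduct.tmul_smul, ← TensorProduct.smul_tmul', smul_add]

/-- The values of the coproduct on the generators. -/
noncomputable def tensor : Model P (A ⊗[k] A) where
  x := diag 𝓜.x
  h := diag 𝓜.h
  y := 𝓜.comulY
  u := 𝓜.comulU
  x_h := by rw [← map_mul, 𝓜.x_h, map_mul]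
  x_y i := by
    rw [val_diag, comulY, mul_add, add_mul]
    simp only [Algebra.TensorProduct.tmul_mul_tmul, 𝓜.x_y, 𝓜.x_K, one_mul, mul_one]
  y_y := 𝓜.comulY_comm
  y_h := 𝓜.comulY_mul_h
  y_pow := 𝓜.comulY_pow
  h_pow := by rw [← map_pow, 𝓜.h_pow, map_one]
  x_u := 𝓜.x_mul_comulU
  y_u i j := by
    rw [comulY_mul_comulU, val_diag, Algebra.TensorProduct.tmul_pow, ← X_natCast, Nat.cast_mul]
  y_u' i j := by
    rw [comulY_mul_comulU, val_diag, Algebra.TensorProduct.tmul_pow, ← X_natCast, Nat.cast_mul,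
      comulU_mul_comulY]
  u_h := 𝓜.comulU_mul_h
  u_u j l := by
    rw [comulU_mul_comulU]
    refine Finset.sum_congr rfl fun s _ => ?_
    have hY : P.Y 𝓜.comulY (j + l) * ((𝓜.h : A) ⊗ₜ[k] (𝓜.h : A)) =
        P.χ (j + l) • (((𝓜.h : A) ⊗ₜ[k] (𝓜.h : A)) * P.Y 𝓜.comulY (j + l)) :=
      P.Y_mul_of_qCommute 𝓜.comulY_comm 𝓜.comulY_mul_h (j + l)
    rw [← map_zpow, val_diag, val_diag, hY, mul_smul_comm, smul_smul, H_one, mul_assoc,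
      sub_eq_add_neg (j + l), AddChar.map_add_eq_mul P.χ (j + l)]
    congr 1
    · ring
    · exact mul_assoc _ _ _

end Model
namespace Model

variable {k : Type*} [Field k] {m θ : ℕ} [NeZero m] {P : Datum k m θ}
  {A : Type*} [Ring A] [Algebra k A] (𝓜 : Model P A)

/-! ### Normal ordering -/

theorem X_mul_X_assoc (a b : ℤ) (z : A) : 𝓜.X a * (𝓜.X b * z) = 𝓜.X (a + b) * z := by
  rw [← mul_assoc, X_add]

theorem H_mul_H (a b : ZMod m) : 𝓜.H a * 𝓜.H b = 𝓜.H (a + b) := (𝓜.H_add a b).symm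

theorem H_mul_H_assoc (a b : ZMod m) (z : A) : 𝓜.H a * (𝓜.H b * z) = 𝓜.H (a + b) * z := by
  rw [← mul_assoc, H_add]

theorem H_X_assoc (a : ZMod m) (n : ℤ) (z : A) :
    𝓜.H a * (𝓜.X n * z) = 𝓜.X n * (𝓜.H a * z) := by
  rw [← mul_assoc, H_X, mul_assoc]

theorem y_X_assoc (i : Fin θ) (n : ℤ) (z : A) :
    𝓜.y i * (𝓜.X n * z) = 𝓜.X n * (𝓜.y i * z) := by
  rw [← mul_assoc, y_X, mul_assoc]

theorem y_H_assoc (i : Fin θ) (a : ZMod m) (z : A) :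
    𝓜.y i * (𝓜.H a * z) = P.χ (P.M i * a) • (𝓜.H a * (𝓜.y i * z)) := by
  rw [← mul_assoc, y_H, smul_mul_assoc, mul_assoc]

theorem u_X_assoc (j : ZMod m) (n : ℤ) (z : A) :
    𝓜.u j * (𝓜.X n * z) = 𝓜.X (-n) * (𝓜.u j * z) := by
  rw [← mul_assoc, u_X, mul_assoc]

theorem u_H_assoc (j a : ZMod m) (z : A) :
    𝓜.u j * (𝓜.H a * z) = P.χ (j * a) • (𝓜.H a * (𝓜.u j * z)) := by
  rw [← mul_assoc, u_H, smul_mul_assoc, mul_assoc]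

theorem Y_X_assoc (N : ZMod m) (n : ℤ) (z : A) :
    P.Y 𝓜.y N * (𝓜.X n * z) = 𝓜.X n * (P.Y 𝓜.y N * z) := by
  rw [← mul_assoc, Y_X, mul_assoc]

theorem Y_H_assoc (N a : ZMod m) (z : A) :
    P.Y 𝓜.y N * (𝓜.H a * z) = P.χ (N * a) • (𝓜.H a * (P.Y 𝓜.y N * z)) := by
  rw [← mul_assoc, Y_H, smul_mul_assoc, mul_assoc]

theorem Y_y (N : ZMod m) (i : Fin θ) : P.Y 𝓜.y N * 𝓜.y i = 𝓜.y i * P.Y 𝓜.y N := by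
  induction N using P.co_induction with
  | zero => simp
  | add N j h ih => rw [← P.mul_Y 𝓜.y_y h, mul_assoc, ih, ← mul_assoc, 𝓜.y_y, mul_assoc]

theorem x_eq : (𝓜.x : A) = 𝓜.X 1 := by simp [X]

theorem x_inv_eq : (↑𝓜.x⁻¹ : A) = 𝓜.X (-1) := by simp [X]

theorem h_inv_eq : (↑𝓜.h⁻¹ : A) = 𝓜.H (-1) := by
  rw [Units.inv_eq_of_mul_eq_one_right]
  rw [← H_one, ← H_add, add_neg_cancel, H_zero]

theorem x_inv_pow (n : ℕ) : (↑𝓜.x⁻¹ : A) ^ n = 𝓜.X (-n) := (𝓜.X_neg_natCast n).symm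

/-! ### The model of the antipode -/

/-- The homomorphism `a ↦ a⁻¹` from the units of an algebra to those of the opposite algebra. -/
def opInv : Aˣ →* (Aᵐᵒᵖ)ˣ where
  toFun a := ⟨.op ↑a⁻¹, .op a, by rw [← MulOpposite.op_mul]; simp,
    by rw [← MulOpposite.op_mul]; simp⟩
  map_one' := by ext; simp
  map_mul' a b := by ext; simp

/-- The antipode of `y_i`. -/
noncomputable def antipodeY (i : Fin θ) : A :=
  (-(P.q i)⁻¹) • (𝓜.X (-(P.M i * P.d)) * (𝓜.H (-P.M i) * 𝓜.y i))

/-- The antipode of `u_j`. -/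
noncomputable def antipodeU (j : ZMod m) : A :=
  P.A j • (𝓜.X (-P.T) * (𝓜.H (-1 - j) * 𝓜.u j))

theorem antipodeY_X (i : Fin θ) (n : ℤ) : 𝓜.antipodeY i * 𝓜.X n = 𝓜.X n * 𝓜.antipodeY i := by
  simp only [antipodeY, smul_mul_assoc, mul_smul_comm, mul_assoc, y_X, H_X_assoc, X_mul_X_assoc]
  rw [add_comm]

theorem antipodeY_H (i : Fin θ) (a : ZMod m) :
    𝓜.antipodeY i * 𝓜.H a = P.χ (P.M i * a) • (𝓜.H a * 𝓜.antipodeY i) := by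
  simp only [antipodeY, smul_mul_assoc, mul_smul_comm, mul_assoc, y_H, H_X_assoc, H_mul_H_assoc,
    smul_smul]
  rw [mul_comm, add_comm a]

theorem antipodeY_comm (i j : Fin θ) :
    𝓜.antipodeY i * 𝓜.antipodeY j = 𝓜.antipodeY j * 𝓜.antipodeY i := by
  by_cases hij : i = j
  · rw [hij]
  · simp only [antipodeY, smul_mul_assoc, mul_smul_comm, mul_assoc, y_X_assoc, y_H_assoc, H_X_assoc,
      H_mul_H_assoc, X_mul_X_assoc, smul_smul, mul_neg, P.M_mul_M hij, P.M_mul_M (Ne.symm hij)]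
    rw [𝓜.y_y i j, add_comm (-(P.M i : ZMod m)), add_comm (-((P.M i : ℤ) * P.d)),
      neg_zero, AddChar.map_zero_eq_one, mul_one, mul_one, mul_comm (-(P.q j)⁻¹)]

theorem q_eq (i : Fin θ) : P.χ (P.M i * P.M i) = P.q i := by
  rw [← Nat.cast_mul, P.χ_natCast, ← pow_two]; rfl

theorem antipodeY_pow (i : Fin θ) (n : ℕ) : 𝓜.antipodeY i ^ n =
    ((-1) ^ n * (P.q i ^ (n * (n + 1) / 2))⁻¹) •
      (𝓜.X (-(n * (P.M i * P.d))) * (𝓜.H (-(n * P.M i)) * 𝓜.y i ^ n)) := by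
  induction n with
  | zero => simp
  | succ n ih =>
    have hy : 𝓜.y i * (𝓜.H (-(n * P.M i)) * 𝓜.y i ^ n) =
        (P.q i ^ n)⁻¹ • (𝓜.H (-(n * P.M i)) * 𝓜.y i ^ (n + 1)) := by
      rw [y_H_assoc, ← pow_succ', show (P.M i : ZMod m) * -(n * P.M i) = -(n • (P.M i * P.M i)) by
        rw [nsmul_eq_mul]; ring, AddChar.map_neg_eq_inv, AddChar.map_nsmul_eq_pow, q_eq]
    have hn : (n + 1) * (n + 1 + 1) / 2 = n * (n + 1) / 2 + (n + 1) := by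
      rw [show (n + 1) * (n + 1 + 1) = n * (n + 1) + (n + 1) * 2 by ring,
        Nat.add_mul_div_right _ _ (by norm_num)]
    rw [pow_succ', ih, antipodeY, smul_mul_smul_comm, mul_assoc, mul_assoc, y_X_assoc, hy]
    simp only [mul_smul_comm, H_X_assoc, H_mul_H_assoc, X_mul_X_assoc, smul_smul]
    congr 1
    · rw [hn]
      simp only [pow_add, pow_one, mul_inv]
      ring
    · congr 2
      · push_cast; ring
      · congr 1
        push_cast; ring

theorem antipodeY_pow_e (i : Fin θ) : 𝓜.antipodeY i ^ P.e i =
    1 - (↑𝓜.x⁻¹ : A) ^ (P.e i * P.M i * P.d) := by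
  have hs : (-1 : k) ^ P.e i * (P.q i ^ (P.e i * (P.e i + 1) / 2))⁻¹ = -1 := by
    have h := P.w_e i
    have h1 : ((-1 : k) ^ P.e i)⁻¹ = (-1) ^ P.e i := by rw [← inv_pow]; norm_num
    rw [Datum.w, inv_pow, show P.ξ i ^ P.e i = -1 from P.ξ_pow i, inv_neg, inv_one] at h
    have h2 : (-1 : k) ^ P.e i * P.q i ^ (P.e i * (P.e i + 1) / 2) = -1 := by
      linear_combination -h
    have h3 := congrArg (·⁻¹) h2
    simp only [mul_inv, h1, inv_neg, inv_one] at h3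
    exact h3
  have hx : ((P.e i * P.M i * P.d : ℕ) : ℤ) = P.e i * (P.M i * P.d) := by push_cast; ring
  rw [antipodeY_pow, hs, P.e_mul_M, neg_zero, H_zero, one_mul, 𝓜.y_pow, ← X_natCast, x_inv_pow,
    hx, mul_sub, mul_one, ← X_add, neg_add_cancel, X_zero]
  simp

theorem antipodeU_X (j : ZMod m) (n : ℤ) :
    𝓜.antipodeU j * 𝓜.X n = 𝓜.X (-n) * 𝓜.antipodeU j := by
  simp only [antipodeU, smul_mul_assoc, mul_smul_comm, mul_assoc, u_X, H_X_assoc, X_mul_X_assoc]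
  rw [add_comm]

theorem antipodeU_H (j a : ZMod m) :
    𝓜.antipodeU j * 𝓜.H a = P.χ (j * a) • (𝓜.H a * 𝓜.antipodeU j) := by
  simp only [antipodeU, smul_mul_assoc, mul_smul_comm, mul_assoc, u_H, H_X_assoc, H_mul_H_assoc,
    smul_smul]
  rw [mul_comm, add_comm a]

theorem A_add_M (i : Fin θ) (j : ZMod m) :
    P.A (j + P.M i) = -((P.q i)⁻¹ * (P.ξ i)⁻¹ * P.χ (-(j * P.M i)) * P.A j) := by
  have hξ := P.ξ_ne_zero i
  have h : P.χ (P.M i) = P.ξ i ^ 2 := by rw [P.χ_natCast, P.ξ_sq]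
  have hM : P.A (P.M i) = -((P.q i)⁻¹ * (P.ξ i)⁻¹) := by
    rw [Datum.A, P.C_M, AddChar.map_neg_eq_inv, h, inv_neg, mul_inv, inv_inv]
    field_simp
  rw [P.A_add, hM]
  ring

/-- The common value of `S(u_j) S(y_i)` and `ξ_i S(y_i) S(u_j) S(x ^ (m_i d))`. -/
theorem antipodeU_add_M (i : Fin θ) (j : ZMod m) :
    𝓜.antipodeU (j + P.M i) - P.χ (-(P.M i * (P.M i + j))) •
        (𝓜.antipodeU (j + P.M i) * 𝓜.X (-(P.M i * P.d))) =
      P.A (j + P.M i) • (𝓜.X (-P.T) * (𝓜.H (-1 - (j + P.M i)) * (𝓜.y i * 𝓜.u j))) := by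
  rw [antipodeU_X, neg_neg, y_u_X]
  simp only [antipodeU, mul_sub, smul_sub, mul_smul_comm, H_X_assoc, X_mul_X_assoc]
  rw [smul_comm, add_comm (-P.T)]

theorem antipodeU_mul_antipodeY (i : Fin θ) (j : ZMod m) :
    𝓜.antipodeU j * 𝓜.antipodeY i =
      𝓜.antipodeU (j + P.M i) - P.χ (-(P.M i * (P.M i + j))) •
        (𝓜.antipodeU (j + P.M i) * 𝓜.X (-(P.M i * P.d))) := by
  have hξ := P.ξ_ne_zero i
  rw [antipodeU_add_M, y_u_X', A_add_M]
  simp only [antipodeU, antipodeY, smul_mul_assoc, mul_smul_comm, mul_assoc, u_X_assoc, u_H_assoc,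
    H_X_assoc, H_mul_H_assoc, X_mul_X_assoc, smul_smul, neg_neg]
  congr 1
  · rw [mul_neg]
    field_simp
  · congr 3
    ring

theorem antipodeY_mul_antipodeU (i : Fin θ) (j : ZMod m) :
    P.ξ i • (𝓜.antipodeY i * (𝓜.antipodeU j * 𝓜.X (-(P.M i * P.d)))) =
      𝓜.antipodeU (j + P.M i) - P.χ (-(P.M i * (P.M i + j))) •
        (𝓜.antipodeU (j + P.M i) * 𝓜.X (-(P.M i * P.d))) := by
  have hξ := P.ξ_ne_zero i
  have h : P.χ (P.M i * (-1 - j)) = (P.ξ i ^ 2)⁻¹ * P.χ (-(j * P.M i)) := by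
    rw [P.ξ_sq, ← P.χ_natCast, ← AddChar.map_neg_eq_inv, ← AddChar.map_add_eq_mul]
    congr 1
    ring
  rw [antipodeU_add_M, antipodeU_X, neg_neg, A_add_M]
  simp only [antipodeU, antipodeY, smul_mul_assoc, mul_smul_comm, mul_assoc, y_X_assoc, y_H_assoc,
    H_X_assoc, H_mul_H_assoc, X_mul_X_assoc, smul_smul, h]
  congr 1
  · field_simp
  · congr 2
    · ring
    · congr 2
      ring

theorem Y_antipodeY (N : ZMod m) : P.Y (fun i => MulOpposite.op (𝓜.antipodeY i)) N =
    .op (P.κ N • (𝓜.X (-(P.deg N * P.d)) * (𝓜.H (-N) * P.Y 𝓜.y N))) := by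
  induction N using P.co_induction with
  | zero => simp
  | add N i h ih =>
    rw [← P.mul_Y (fun i j => by rw [← MulOpposite.op_mul, ← MulOpposite.op_mul, antipodeY_comm]) h,
      ih, ← MulOpposite.op_mul, P.κ_add_M h, P.deg_add_M h, ← P.mul_Y 𝓜.y_y h]
    congr 1
    simp only [antipodeY, smul_mul_assoc, mul_smul_comm, mul_assoc, Y_X_assoc, Y_H_assoc, Y_y,
      H_X_assoc, H_mul_H_assoc, X_mul_X_assoc, smul_smul]
    rw [mul_neg (N : ZMod m), mul_comm N, AddChar.map_neg_eq_inv, P.χ_M_mul, pow_succ, mul_inv]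
    congr 1
    · ring
    · congr 2
      · push_cast; ring
      · congr 1
        ring

/-- The relation for `u_j u_l` in the opposite algebra. -/
theorem antipodeU_mul_antipodeU (j l : ZMod m) :
    𝓜.antipodeU l * 𝓜.antipodeU j = ∑ s, (P.C l * (m : k)⁻¹ * (P.G (j + l) s * P.χ (-(j * s)))) •
      (𝓜.H (-1) * (P.κ (j + l) • (𝓜.X (-(P.deg (j + l) * P.d)) * (𝓜.H (-(j + l)) *
        P.Y 𝓜.y (j + l)))) * 𝓜.X (-(P.deg s * P.d - P.T))) := by
  -- the two sides correspond termwise after reversing the order of the coefficients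
  rw [← Equiv.sum_comp (Equiv.subLeft (-P.ones - (j + l)))]
  simp only [antipodeU, smul_mul_assoc, mul_smul_comm, mul_assoc, u_X_assoc, u_H_assoc,
    H_X_assoc, H_mul_H_assoc, X_mul_X_assoc, smul_smul, u_u_X, Finset.mul_sum, Finset.smul_sum, Y_X,
    Equiv.subLeft_apply]
  refine Finset.sum_congr rfl fun s _ => ?_
  by_cases h0 : P.G (j + l) s = 0
  · rw [P.G_complement, add_comm l j, h0]; simp
  have hdeg := P.deg_complement h0
  have hT := P.two_mul_T
  have hscal : P.A j * (P.A l * (P.χ (l * (-1 - j)) * (P.C j * ((m : k)⁻¹ *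
      (P.G (j + l) s * P.χ (j + l - l * s)))))) =
      P.C l * ((m : k)⁻¹ * (P.κ (j + l) * P.χ (-((j + l) * s)) * P.G (j + l) s *
        (P.χ (-(j * (-P.ones - (j + l) - s))) * P.κ (j + l)))) := by
    apply mul_left_cancel₀ (P.C_ne_zero l)
    have hj := P.A_mul_C j
    have hl := P.A_mul_C l
    have hC := P.C_sq l
    have hκ := P.κ_sq (j + l)
    have hχ : P.χ (-j) * P.χ (-l) * P.χ (l * (-1 - j)) * P.χ (j + l - l * s) =
        P.χ (l * l + P.ones * l - l) * P.χ (-((j + l) * (j + l) + P.ones * (j + l))) *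
          P.χ (-((j + l) * s)) * P.χ (-(j * (-P.ones - (j + l) - s))) := by
      simp only [← AddChar.map_add_eq_mul]
      congr 1
      ring
    rw [← hj, ← hl, ← hC, ← hκ] at hχ
    linear_combination (m : k)⁻¹ * P.G (j + l) s * hχ
  rw [add_comm l j, P.G_complement, hscal, hdeg]
  congr 3
  · linear_combination -hT
  · congr 1
    ring

/-- The values of the antipode on the generators, as a homomorphism to the opposite algebra. -/
noncomputable def antipode : Model P Aᵐᵒᵖ where
  x := opInv 𝓜.x
  h := opInv 𝓜.h
  y i := .op (𝓜.antipodeY i)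
  u j := .op (𝓜.antipodeU j)
  x_h := by rw [← map_mul, 𝓜.x_h, map_mul]
  x_y i := by
    change MulOpposite.op (↑𝓜.x⁻¹ : A) * _ = _ * MulOpposite.op (↑𝓜.x⁻¹ : A)
    rw [← MulOpposite.op_mul, ← MulOpposite.op_mul, x_inv_eq, antipodeY_X]
  y_y i j := by rw [← MulOpposite.op_mul, ← MulOpposite.op_mul, antipodeY_comm]
  y_h i := by
    change _ * MulOpposite.op (↑𝓜.h⁻¹ : A) = _ • (MulOpposite.op (↑𝓜.h⁻¹ : A) * _)
    rw [← MulOpposite.op_mul, ← MulOpposite.op_mul, h_inv_eq, antipodeY_H, MulOpposite.op_smul,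
      smul_smul, ← AddChar.map_add_eq_mul]
    simp
  y_pow i := by
    change _ = 1 - MulOpposite.op (↑𝓜.x⁻¹ : A) ^ _
    rw [← MulOpposite.op_pow, ← MulOpposite.op_pow, antipodeY_pow_e, MulOpposite.op_sub,
      MulOpposite.op_one]
  h_pow := by rw [← map_pow, 𝓜.h_pow, map_one]
  x_u j := by
    change MulOpposite.op (↑𝓜.x⁻¹ : A) * _ = _ * MulOpposite.op (𝓜.x : A)
    rw [← MulOpposite.op_mul, ← MulOpposite.op_mul, x_inv_eq, x_eq, antipodeU_X, neg_neg]
  y_u i j := by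
    change _ = _ - _ • (MulOpposite.op (↑𝓜.x⁻¹ : A) ^ _ * _)
    rw [← MulOpposite.op_mul, antipodeU_mul_antipodeY, ← MulOpposite.op_pow, ← MulOpposite.op_mul,
      ← MulOpposite.op_smul, ← MulOpposite.op_sub, x_inv_pow, Nat.cast_mul]
  y_u' i j := by
    change _ = _ • (MulOpposite.op (↑𝓜.x⁻¹ : A) ^ _ * _ * _)
    rw [← MulOpposite.op_mul, antipodeU_mul_antipodeY, ← antipodeY_mul_antipodeU,
      ← MulOpposite.op_pow, ← MulOpposite.op_mul, ← MulOpposite.op_mul, ← MulOpposite.op_smul,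
      x_inv_pow, Nat.cast_mul]
  u_h j := by
    change _ * MulOpposite.op (↑𝓜.h⁻¹ : A) = _ • (MulOpposite.op (↑𝓜.h⁻¹ : A) * _)
    rw [← MulOpposite.op_mul, ← MulOpposite.op_mul, h_inv_eq, antipodeU_H, MulOpposite.op_smul,
      smul_smul, ← AddChar.map_add_eq_mul]
    simp
  u_u j l := by
    rw [← MulOpposite.op_mul, antipodeU_mul_antipodeU, Finset.op_sum]
    refine Finset.sum_congr rfl fun s _ => ?_
    change _ = _ • (_ * (_ * MulOpposite.op (↑𝓜.h⁻¹ : A)))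
    rw [← map_zpow, Y_antipodeY, ← MulOpposite.op_mul]
    change _ = _ • (MulOpposite.op (↑(𝓜.x ^ _)⁻¹ : A) * _)
    rw [← MulOpposite.op_mul, ← MulOpposite.op_smul, h_inv_eq, ← zpow_neg]
    rfl

/-! ### The antipode axioms on generators -/

theorem A_sq (j : ZMod m) : P.A j ^ 2 = P.χ (-(j * j + P.ones * j + j)) := by
  rw [Datum.A, mul_pow, inv_pow, P.C_sq, ← AddChar.map_neg_eq_inv, pow_two,
    ← AddChar.map_add_eq_mul, ← AddChar.map_add_eq_mul]
  congr 1
  ring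

theorem A_mul_C_sub (j s : ZMod m) :
    P.A s * P.C (j - s) = P.C j * P.χ (-(P.ones * s + j * s)) := by
  have h := P.C_add (j - s) s
  rw [sub_add_cancel] at h
  have h1 := P.A_mul_C s
  have h2 := A_sq (P := P) s
  have hχ : P.χ (-s) * P.χ (-(P.ones * s + j * s)) * P.χ ((j - s) * s) =
      P.χ (-(s * s + P.ones * s + s)) := by
    rw [← AddChar.map_add_eq_mul, ← AddChar.map_add_eq_mul]
    congr 1
    ring
  apply mul_left_cancel₀ (P.A_ne_zero s)
  rw [h]
  linear_combination P.C (j - s) * h2 - P.C (j - s) * hχ -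
    P.C (j - s) * P.χ (-(P.ones * s + j * s)) * P.χ ((j - s) * s) * h1

theorem antipodeY_mul_K (i : Fin θ) : 𝓜.antipodeY i * 𝓜.K i = -𝓜.y i := by
  have hq := P.q_ne_zero i
  simp only [antipodeY, K, smul_mul_assoc, mul_smul_comm, mul_assoc, y_X_assoc, y_H, H_X_assoc,
    H_mul_H_assoc, X_mul_X_assoc, smul_smul, q_eq]
  simp [hq]

theorem y_mul_antipode_K (i : Fin θ) :
    𝓜.y i * (𝓜.H (-P.M i) * 𝓜.X (-(P.M i * P.d))) = -𝓜.antipodeY i := by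
  simp only [antipodeY, H_X, y_X_assoc, y_H, mul_smul_comm, mul_neg, AddChar.map_neg_eq_inv, q_eq]
  simp

theorem sum_antipodeU_mul (j : ZMod m) :
    ∑ s, P.χ (s * (j - s)) • (𝓜.antipodeU s * (𝓜.H s * 𝓜.u (j - s))) =
      if j = 0 then 1 else 0 := by
  have h1 (s : ZMod m) : P.χ (s * (j - s)) • (𝓜.antipodeU s * (𝓜.H s * 𝓜.u (j - s))) =
      ∑ t, (P.C j * (m : k)⁻¹ * P.G j t * P.χ j * P.χ (s * -(P.ones + t))) •
        (𝓜.X (P.deg t * P.d - 2 * P.T) * P.Y 𝓜.y j) := by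
    simp only [antipodeU, smul_mul_assoc, mul_smul_comm, mul_assoc, u_H_assoc, H_X_assoc,
      H_mul_H_assoc, X_mul_X_assoc, smul_smul, u_u_X, Finset.mul_sum, Finset.smul_sum,
      add_sub_cancel]
    refine Finset.sum_congr rfl fun t _ => ?_
    congr 1
    · have hχ : P.χ (s * (j - s)) * P.χ (-(P.ones * s + j * s)) * P.χ (s * s) * P.χ (j - s * t) =
          P.χ j * P.χ (s * -(P.ones + t)) := by
        simp only [← AddChar.map_add_eq_mul]
        congr 1
        ring
      linear_combination (m : k)⁻¹ * P.G j t * (P.C j * hχ +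
        P.χ (s * (j - s)) * P.χ (s * s) * P.χ (j - s * t) * A_mul_C_sub (P := P) j s)
    · rw [show -1 - s + (s + 1) = 0 by ring, H_zero, one_mul]
      congr 2
      ring
  rw [Finset.sum_congr rfl fun s _ => h1 s, Finset.sum_comm]
  simp only [← Finset.sum_smul, ← Finset.mul_sum, P.sum_χ_mul, neg_eq_zero]
  -- orthogonality of characters leaves `t = -∑ m_i`, whose coordinates `e_i - 1` are maximal, so
  -- that `G j t` vanishes unless `j = 0`
  rw [Finset.sum_eq_single (-P.ones)]
  · rw [if_pos (by ring), ← P.sigma_eq, P.two_mul_T, sub_self, X_zero, one_mul]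
    split_ifs with hj
    · have hm := P.card_ne_zero
      simp [hj, hm]
    · have : P.G j (-P.ones) = 0 := by
        by_contra h0
        refine hj (P.co_ext fun i => ?_)
        have := P.lt_of_G_ne_zero h0 i
        rw [P.co_neg_ones] at this
        rw [P.co_zero]
        omega
      simp [this]
  · intro t _ ht
    rw [if_neg (fun h => ht (eq_neg_of_add_eq_zero_right h)), mul_zero, zero_smul]
  · simp

theorem sum_mul_antipodeU (j : ZMod m) :
    ∑ s, P.χ (s * (j - s)) • (𝓜.u s * (𝓜.antipodeU (j - s) * 𝓜.H (-s))) =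
      if j = 0 then 1 else 0 := by
  have h1 (s : ZMod m) : P.χ (s * (j - s)) • (𝓜.u s * (𝓜.antipodeU (j - s) * 𝓜.H (-s))) =
      ∑ t, ((m : k)⁻¹ * P.G j t * P.χ (s * -(j + t))) •
        (𝓜.X (P.deg t * P.d) * (𝓜.H (-j) * P.Y 𝓜.y j)) := by
    simp only [antipodeU, smul_mul_assoc, mul_smul_comm, mul_assoc, u_H_assoc, u_X_assoc, u_H,
      H_X_assoc, H_mul_H_assoc, X_mul_X_assoc, smul_smul, u_u_X, Finset.mul_sum, Finset.smul_sum,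
      add_sub_cancel]
    refine Finset.sum_congr rfl fun t _ => ?_
    congr 1
    · have hχ : P.χ (s * (j - s)) * P.χ (-(j - s)) * P.χ ((j - s) * -s) *
          P.χ (s * (-1 - (j - s) + -s)) * P.χ (j - s * t) = P.χ (s * -(j + t)) := by
        simp only [← AddChar.map_add_eq_mul]
        congr 1
        ring
      linear_combination (m : k)⁻¹ * P.G j t * (hχ + P.χ (s * (j - s)) * P.χ ((j - s) * -s) *
        P.χ (s * (-1 - (j - s) + -s)) * P.χ (j - s * t) * P.A_mul_C (j - s))
    · rw [show -1 - (j - s) + -s + 1 = -j by ring]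
      congr 2
      ring
  rw [Finset.sum_congr rfl fun s _ => h1 s, Finset.sum_comm]
  simp only [← Finset.sum_smul, ← Finset.mul_sum, P.sum_χ_mul, neg_eq_zero]
  -- here `t = -j`, and adding `j` and `-j` carries unless `j = 0`
  rw [Finset.sum_eq_single (-j)]
  · rw [if_pos (by ring)]
    split_ifs with hj
    · have hm := P.card_ne_zero
      simp [hj, hm]
    · have : P.G j (-j) = 0 := by
        by_contra h0
        refine hj (P.co_ext fun i => ?_)
        have h1 := P.co_add_of_lt (P.lt_of_G_ne_zero h0 i)
        rw [add_neg_cancel, P.co_zero] at h1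
        rw [P.co_zero]
        omega
      simp [this]
  · intro t _ ht
    rw [if_neg (fun h => ht (eq_neg_of_add_eq_zero_right h)), mul_zero, zero_smul]
  · simp

end Model
namespace Model

variable {k : Type*} [Field k] {m θ : ℕ} [NeZero m] {P : Datum k m θ}

/-! ### The structure maps on the generators of the algebra -/

section Lift

variable {A : Type*} [Ring A] [Algebra k A] (𝓜 : Model P A)

theorem self_of_x : P.of .x = P.self.X 1 := P.self.x_eq

theorem self_of_xinv : P.of .xinv = P.self.X (-1) := P.self.x_inv_eq

theorem H_intCast (n : ℤ) : 𝓜.H n = ↑(𝓜.h ^ n) := by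
  obtain ⟨a, rfl | rfl⟩ := n.eq_nat_or_neg
  · rw [Int.cast_natCast, H_natCast, zpow_natCast, Units.val_pow_eq_pow_val]
  · rw [zpow_neg, Int.cast_neg, Int.cast_natCast, eq_comm]
    refine Units.inv_eq_of_mul_eq_one_right ?_
    rw [zpow_natCast, Units.val_pow_eq_pow_val, ← H_natCast, ← H_add, add_neg_cancel, H_zero]

theorem lift_X (n : ℤ) : 𝓜.lift (P.self.X n) = 𝓜.X n := by
  have h : Units.map (𝓜.lift : P.Alg →* A) P.self.x = 𝓜.x := Units.ext (𝓜.lift_of .x)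
  have h1 := congrArg (fun z : Aˣ => ((z ^ n : Aˣ) : A)) h
  simp only [← map_zpow] at h1
  exact h1

theorem lift_h : 𝓜.lift P.self.h = 𝓜.h := by
  have h1 := 𝓜.lift_of .g
  change 𝓜.lift (P.of .g) = _ at h1
  rw [self_of_g, map_mul, lift_X] at h1
  have h2 := congrArg (𝓜.X (-P.d) * ·) h1
  simp only [genVal, X_mul_X_assoc, neg_add_cancel, X_zero, one_mul] at h2
  exact h2

theorem lift_H (a : ZMod m) : 𝓜.lift (P.self.H a) = 𝓜.H a := by
  rw [H, H, Units.val_pow_eq_pow_val, Units.val_pow_eq_pow_val, map_pow, lift_h]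

theorem lift_y (i : Fin θ) : 𝓜.lift (P.self.y i) = 𝓜.y i := 𝓜.lift_of (.y i)

theorem lift_u (j : ZMod m) : 𝓜.lift (P.self.u j) = 𝓜.u j := 𝓜.lift_of (.u j)

theorem tensor_X (n : ℤ) : 𝓜.tensor.X n = 𝓜.X n ⊗ₜ[k] 𝓜.X n := by
  change ((diag 𝓜.x ^ n : (A ⊗[k] A)ˣ) : A ⊗[k] A) = _
  rw [← map_zpow, val_diag]
  rfl

theorem tensor_H (a : ZMod m) : 𝓜.tensor.H a = 𝓜.H a ⊗ₜ[k] 𝓜.H a := by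
  change ((diag 𝓜.h ^ a.val : (A ⊗[k] A)ˣ) : A ⊗[k] A) = _
  rw [← map_pow, val_diag]
  rfl

theorem antipode_X (n : ℤ) : 𝓜.antipode.X n = .op (𝓜.X (-n)) := by
  change ((opInv 𝓜.x ^ n : (Aᵐᵒᵖ)ˣ) : Aᵐᵒᵖ) = _
  rw [← map_zpow, X, zpow_neg]
  rfl

theorem antipode_H (a : ZMod m) : 𝓜.antipode.H a = .op (𝓜.H (-a)) := by
  rw [← ZMod.natCast_zmod_val a, ← Int.cast_natCast, H_intCast, ← Int.cast_neg, H_intCast]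
  change ((opInv 𝓜.h ^ _ : (Aᵐᵒᵖ)ˣ) : Aᵐᵒᵖ) = _
  rw [← map_zpow, zpow_neg]
  rfl

end Lift

/-- Induction over the algebra, with the powers of `x` and `h` and the `y_i`, `u_j` as generators.
-/
theorem induction {motive : P.Alg → Prop} (algebraMap : ∀ r : k, motive (algebraMap k P.Alg r))
    (add : ∀ a b, motive a → motive b → motive (a + b))
    (mul : ∀ a b, motive a → motive b → motive (a * b))
    (X : ∀ n, motive (P.self.X n)) (H : ∀ a, motive (P.self.H a))
    (y : ∀ i, motive (P.self.y i)) (u : ∀ j, motive (P.self.u j)) (a : P.Alg) : motive a := by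
  refine P.alg_induction algebraMap (fun a => ?_) add mul a
  cases a with
  | x => rw [self_of_x]; exact X 1
  | xinv => rw [self_of_xinv]; exact X (-1)
  | g => rw [self_of_g, ← H_one]; exact mul _ _ (X _) (H 1)
  | ginv => rw [self_of_ginv, h_inv_eq]; exact mul _ _ (H (-1)) (X _)
  | y i => exact y i
  | u j => exact u j

variable (P)

/-- The coproduct as an algebra homomorphism. -/
noncomputable def comulHom : P.Alg →ₐ[k] P.Alg ⊗[k] P.Alg := P.self.tensor.lift

/-- The counit as an algebra homomorphism. -/
noncomputable def counitHom : P.Alg →ₐ[k] k := (counit P).lift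

/-- The antipode as an algebra homomorphism to the opposite algebra. -/
noncomputable def antipodeHom : P.Alg →ₐ[k] P.Algᵐᵒᵖ := P.self.antipode.lift

/-- The antipode as a linear map. -/
noncomputable def antipodeMap : P.Alg →ₗ[k] P.Alg :=
  (MulOpposite.opLinearEquiv k).symm.toLinearMap ∘ₗ (antipodeHom P).toLinearMap

@[simp] theorem comulHom_X (n : ℤ) : comulHom P (P.self.X n) = P.self.X n ⊗ₜ P.self.X n := by
  rw [comulHom, lift_X, tensor_X]

@[simp] theorem comulHom_h : comulHom P P.self.h = (P.self.h : P.Alg) ⊗ₜ (P.self.h : P.Alg) := by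
  rw [comulHom, lift_h]; rfl

@[simp] theorem comulHom_H (a : ZMod m) : comulHom P (P.self.H a) = P.self.H a ⊗ₜ P.self.H a := by
  rw [comulHom, lift_H, tensor_H]

@[simp] theorem comulHom_y (i : Fin θ) : comulHom P (P.self.y i) =
    P.self.y i ⊗ₜ P.self.K i + 1 ⊗ₜ P.self.y i := P.self.tensor.lift_y i

@[simp] theorem comulHom_u (j : ZMod m) : comulHom P (P.self.u j) =
    ∑ s, P.χ (s * (j - s)) • (P.self.u s ⊗ₜ (P.self.H s * P.self.u (j - s))) :=
  P.self.tensor.lift_u j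

@[simp] theorem comulHom_K (i : Fin θ) : comulHom P (P.self.K i) = P.self.K i ⊗ₜ P.self.K i := by
  rw [K, map_mul, comulHom_X, comulHom_H, Algebra.TensorProduct.tmul_mul_tmul]

@[simp] theorem counitHom_X (n : ℤ) : counitHom P (P.self.X n) = 1 := by
  rw [counitHom, lift_X, X]; simp [counit]

@[simp] theorem counitHom_h : counitHom P P.self.h = 1 := by
  rw [counitHom, lift_h]; rfl

@[simp] theorem counitHom_H (a : ZMod m) : counitHom P (P.self.H a) = 1 := by
  rw [counitHom, lift_H, H]; simp [counit]

@[simp] theorem counitHom_y (i : Fin θ) : counitHom P (P.self.y i) = 0 := (counit P).lift_y i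

@[simp] theorem counitHom_u (j : ZMod m) : counitHom P (P.self.u j) = if j = 0 then 1 else 0 :=
  (counit P).lift_u j

@[simp] theorem counitHom_K (i : Fin θ) : counitHom P (P.self.K i) = 1 := by
  rw [K, map_mul, counitHom_X, counitHom_H, one_mul]

theorem antipodeMap_apply (a : P.Alg) : antipodeMap P a = (antipodeHom P a).unop := rfl

theorem antipodeMap_mul (a b : P.Alg) :
    antipodeMap P (a * b) = antipodeMap P b * antipodeMap P a := by
  simp only [antipodeMap_apply, map_mul, MulOpposite.unop_mul]

@[simp] theorem antipodeMap_algebraMap (r : k) :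
    antipodeMap P (algebraMap k P.Alg r) = algebraMap k P.Alg r := by
  rw [antipodeMap_apply, AlgHom.commutes]; rfl

@[simp] theorem antipodeMap_one : antipodeMap P 1 = 1 := by
  simpa using antipodeMap_algebraMap P 1

@[simp] theorem antipodeMap_X (n : ℤ) : antipodeMap P (P.self.X n) = P.self.X (-n) := by
  rw [antipodeMap_apply, antipodeHom, lift_X, antipode_X]; rfl

@[simp] theorem antipodeMap_H (a : ZMod m) : antipodeMap P (P.self.H a) = P.self.H (-a) := by
  rw [antipodeMap_apply, antipodeHom, lift_H, antipode_H]; rfl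

@[simp] theorem antipodeMap_y (i : Fin θ) : antipodeMap P (P.self.y i) = P.self.antipodeY i := by
  rw [antipodeMap_apply, antipodeHom, lift_y]; rfl

@[simp] theorem antipodeMap_u (j : ZMod m) : antipodeMap P (P.self.u j) = P.self.antipodeU j := by
  rw [antipodeMap_apply, antipodeHom, lift_u]; rfl

/-! ### The Hopf algebra axioms -/

theorem coassoc : (Algebra.TensorProduct.assoc k k k P.Alg P.Alg P.Alg).toAlgHom.comp
      ((Algebra.TensorProduct.map (comulHom P) (.id k P.Alg)).comp (comulHom P)) =
    (Algebra.TensorProduct.map (.id k P.Alg) (comulHom P)).comp (comulHom P) := by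
  refine algHom_ext (B := P.Alg ⊗[k] (P.Alg ⊗[k] P.Alg)) ?_ ?_ (fun i => ?_) (fun j => ?_)
  · rw [P.self.x_eq]; simp
  · simp
  · simp [TensorProduct.add_tmul, TensorProduct.tmul_add, Algebra.TensorProduct.one_def, add_assoc]
  · simp only [AlgHom.comp_apply, comulHom_u, map_sum, map_smul, Algebra.TensorProduct.map_tmul,
      AlgHom.id_apply, map_mul, comulHom_H, TensorProduct.sum_tmul, TensorProduct.tmul_sum,
      Finset.mul_sum, Finset.smul_sum, TensorProduct.tmul_smul, ← TensorProduct.smul_tmul',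
      mul_smul_comm, Algebra.TensorProduct.tmul_mul_tmul, smul_smul]
    rw [Finset.sum_comm]
    refine Finset.sum_congr rfl fun l _ => ?_
    rw [← Equiv.sum_comp (Equiv.addLeft l)]
    refine Finset.sum_congr rfl fun p _ => ?_
    simp only [Equiv.coe_addLeft, add_sub_cancel_left]
    rw [← mul_assoc, H_mul_H, sub_sub, ← AddChar.map_add_eq_mul, ← AddChar.map_add_eq_mul]
    refine congrArg₂ (· • ·) (congrArg P.χ ?_) rfl
    ring

theorem rTensor_counit : (Algebra.TensorProduct.map (counitHom P) (.id k P.Alg)).comp (comulHom P) =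
    (Algebra.TensorProduct.lid k P.Alg).symm := by
  refine algHom_ext (B := k ⊗[k] P.Alg) ?_ ?_ (fun i => ?_) (fun j => ?_)
  · rw [P.self.x_eq]; simp
  · simp
  · simp
  · simp [TensorProduct.ite_tmul]

theorem lTensor_counit : (Algebra.TensorProduct.map (.id k P.Alg) (counitHom P)).comp (comulHom P) =
    (Algebra.TensorProduct.rid k k P.Alg).symm := by
  refine algHom_ext (B := P.Alg ⊗[k] k) ?_ ?_ (fun i => ?_) (fun j => ?_)
  · rw [P.self.x_eq]; simp
  · simp
  · simp
  · simp [TensorProduct.tmul_ite, sub_eq_zero]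

/-- The linear map `a ⊗ b ↦ S(a) b`. -/
noncomputable def leftConv : P.Alg ⊗[k] P.Alg →ₗ[k] P.Alg :=
  LinearMap.mul' k P.Alg ∘ₗ (antipodeMap P).rTensor P.Alg

/-- The linear map `a ⊗ b ↦ a S(b)`. -/
noncomputable def rightConv : P.Alg ⊗[k] P.Alg →ₗ[k] P.Alg :=
  LinearMap.mul' k P.Alg ∘ₗ (antipodeMap P).lTensor P.Alg

@[simp] theorem leftConv_tmul (a b : P.Alg) : leftConv P (a ⊗ₜ b) = antipodeMap P a * b := rfl

@[simp] theorem rightConv_tmul (a b : P.Alg) : rightConv P (a ⊗ₜ b) = a * antipodeMap P b := rfl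

/-- The left antipode axiom passes to products, the antipode being an antihomomorphism. -/
theorem leftConv_mul {t : P.Alg ⊗[k] P.Alg} {c : k} (ht : leftConv P t = algebraMap k P.Alg c)
    (w : P.Alg ⊗[k] P.Alg) : leftConv P (t * w) = algebraMap k P.Alg c * leftConv P w := by
  induction w with
  | zero => simp
  | add w₁ w₂ h₁ h₂ => rw [mul_add, map_add, h₁, h₂, map_add, mul_add]
  | tmul a b =>
    have h : leftConv P (t * a ⊗ₜ b) = antipodeMap P a * leftConv P t * b := by
      clear ht
      induction t with
      | zero => simp
      | add t₁ t₂ h₁ h₂ => rw [add_mul, map_add, h₁, h₂, map_add, mul_add, add_mul]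
      | tmul a' b' =>
        rw [Algebra.TensorProduct.tmul_mul_tmul, leftConv_tmul, leftConv_tmul, antipodeMap_mul]
        simp only [mul_assoc]
    rw [h, ht, leftConv_tmul, ← Algebra.commutes, mul_assoc]

/-- The right antipode axiom passes to products. -/
theorem rightConv_mul {w : P.Alg ⊗[k] P.Alg} {c : k} (hw : rightConv P w = algebraMap k P.Alg c)
    (t : P.Alg ⊗[k] P.Alg) : rightConv P (t * w) = algebraMap k P.Alg c * rightConv P t := by
  induction t with
  | zero => simp
  | add t₁ t₂ h₁ h₂ => rw [add_mul, map_add, h₁, h₂, map_add, mul_add]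
  | tmul a b =>
    have h : rightConv P (a ⊗ₜ b * w) = a * rightConv P w * antipodeMap P b := by
      clear hw
      induction w with
      | zero => simp
      | add w₁ w₂ h₁ h₂ => rw [mul_add, map_add, h₁, h₂, map_add, mul_add, add_mul]
      | tmul a' b' =>
        rw [Algebra.TensorProduct.tmul_mul_tmul, rightConv_tmul, rightConv_tmul, antipodeMap_mul]
        simp only [mul_assoc]
    rw [h, hw, rightConv_tmul, ← Algebra.commutes, mul_assoc]

theorem leftConv_comul (a : P.Alg) :
    leftConv P (comulHom P a) = algebraMap k P.Alg (counitHom P a) := by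
  induction a using induction with
  | algebraMap r =>
    rw [AlgHom.commutes, AlgHom.commutes, Algebra.TensorProduct.algebraMap_apply]
    simp
  | add a b ha hb => simp only [map_add, ha, hb]
  | mul a b ha hb => rw [map_mul, leftConv_mul P ha, hb, map_mul, map_mul]
  | X n => simp [← X_add]
  | H a => simp [H_mul_H]
  | y i => simp [antipodeY_mul_K]
  | u j =>
    simp only [comulHom_u, map_sum, map_smul, leftConv_tmul, antipodeMap_u, counitHom_u]
    rw [sum_antipodeU_mul]
    split_ifs <;> simp

theorem rightConv_comul (a : P.Alg) :
    rightConv P (comulHom P a) = algebraMap k P.Alg (counitHom P a) := by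
  induction a using induction with
  | algebraMap r =>
    rw [AlgHom.commutes, AlgHom.commutes, Algebra.TensorProduct.algebraMap_apply]
    simp
  | add a b ha hb => simp only [map_add, ha, hb]
  | mul a b ha hb =>
    rw [map_mul, rightConv_mul P hb, ha, map_mul, map_mul, Algebra.commutes]
  | X n => simp [← X_add]
  | H a => simp [H_mul_H]
  | y i =>
    have h : antipodeMap P (P.self.K i) = P.self.H (-P.M i) * P.self.X (-(P.M i * P.d)) := by
      rw [K, antipodeMap_mul, antipodeMap_X, antipodeMap_H]
    simp [h, y_mul_antipode_K]
  | u j =>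
    simp only [comulHom_u, map_sum, map_smul, rightConv_tmul, antipodeMap_u, antipodeMap_mul,
      antipodeMap_H, counitHom_u]
    rw [sum_mul_antipodeU]
    split_ifs <;> simp

theorem conj_inv_mul :
    P.self.H (-P.ones) * P.self.X P.T * (P.self.X (-P.T) * P.self.H P.ones) = 1 := by
  simp only [mul_assoc, X_mul_X_assoc, add_neg_cancel, X_zero, one_mul, H_mul_H, neg_add_cancel,
    H_zero]

theorem conj_mul_inv :
    P.self.X (-P.T) * P.self.H P.ones * (P.self.H (-P.ones) * P.self.X P.T) = 1 := by
  simp only [mul_assoc, H_mul_H_assoc, add_neg_cancel, H_zero, one_mul, ← X_add, neg_add_cancel,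
    X_zero]

/-- The square of the antipode is conjugation by `x ^ (-σ d / 2) h ^ (∑ m_i)`. -/
theorem antipodeMap_antipodeMap (a : P.Alg) : antipodeMap P (antipodeMap P a) =
    P.self.X (-P.T) * P.self.H P.ones * a * (P.self.H (-P.ones) * P.self.X P.T) := by
  have hinv := conj_inv_mul P
  have hinv' := conj_mul_inv P
  induction a using induction with
  | algebraMap r =>
    rw [antipodeMap_algebraMap, antipodeMap_algebraMap, ← Algebra.commutes, mul_assoc, hinv',
      mul_one]
  | add a b ha hb => rw [map_add, map_add, ha, hb, mul_add, add_mul]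
  | mul a b ha hb =>
    rw [antipodeMap_mul, antipodeMap_mul, ha, hb]
    calc _ = P.self.X (-P.T) * P.self.H P.ones * a * (P.self.H (-P.ones) * P.self.X P.T *
          (P.self.X (-P.T) * P.self.H P.ones)) * b * (P.self.H (-P.ones) * P.self.X P.T) := by
            simp only [mul_assoc]
      _ = _ := by rw [hinv, mul_one, mul_assoc _ a b]
  | X n =>
    rw [antipodeMap_X, antipodeMap_X, neg_neg, mul_assoc (P.self.X _), H_X, ← mul_assoc (P.self.X _),
      ← X_add, add_comm, X_add, mul_assoc (P.self.X n), mul_assoc (P.self.X n), hinv', mul_one]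
  | H a =>
    simp only [antipodeMap_H, neg_neg, mul_assoc, H_X_assoc, X_mul_X_assoc, H_X, H_mul_H,
      neg_add_cancel, X_zero, one_mul]
    congr 1
    ring
  | y i =>
    have hM : P.χ (P.M i * -P.ones) = (P.q i)⁻¹ := by
      rw [mul_neg, AddChar.map_neg_eq_inv, ← q_eq, Datum.ones, Finset.mul_sum,
        Finset.sum_eq_single i (fun j _ hj => P.M_mul_M (Ne.symm hj)) (by simp)]
    have hq := P.q_ne_zero i
    rw [antipodeMap_y, antipodeY, map_smul, antipodeMap_mul, antipodeMap_mul, antipodeMap_X,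
      antipodeMap_H, antipodeMap_y, antipodeY]
    simp only [neg_neg, mul_assoc, smul_mul_assoc, mul_smul_comm, H_X_assoc, X_mul_X_assoc, H_X, y_X,
      y_X_assoc, y_H, H_mul_H_assoc, neg_add_cancel, add_neg_cancel, X_zero, H_zero,
      one_mul, smul_smul, q_eq, hM]
    congr 1
    field_simp
  | u j =>
    have hA : P.A j * (P.A j * P.χ (j * -(-1 - j))) = P.χ (j * -P.ones) := by
      rw [← mul_assoc, ← pow_two, A_sq, ← AddChar.map_add_eq_mul]
      congr 1
      ring
    rw [antipodeMap_u, antipodeU, map_smul, antipodeMap_mul, antipodeMap_mul, antipodeMap_X,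
      antipodeMap_H, antipodeMap_u, antipodeU]
    simp only [neg_neg, mul_assoc, smul_mul_assoc, mul_smul_comm, H_X_assoc, X_mul_X_assoc, H_X, u_X,
      u_X_assoc, u_H, H_mul_H_assoc, smul_smul, add_neg_cancel, H_zero, one_mul]
    rw [← hA]

theorem antipodeMap_bijective : Function.Bijective (antipodeMap P) := by
  have hinv := conj_inv_mul P
  have hinv' := conj_mul_inv P
  have h : Function.Bijective (antipodeMap P ∘ antipodeMap P) := by
    refine Function.bijective_iff_has_inverse.2
      ⟨fun a => P.self.H (-P.ones) * P.self.X P.T * a * (P.self.X (-P.T) * P.self.H P.ones),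
        fun a => ?_, fun a => ?_⟩
    · rw [Function.comp_apply, antipodeMap_antipodeMap]
      calc _ = P.self.H (-P.ones) * P.self.X P.T * (P.self.X (-P.T) * P.self.H P.ones) * a *
            (P.self.H (-P.ones) * P.self.X P.T * (P.self.X (-P.T) * P.self.H P.ones)) := by
              simp only [mul_assoc]
        _ = a := by rw [hinv, one_mul, mul_one]
    · rw [Function.comp_apply, antipodeMap_antipodeMap]
      calc _ = P.self.X (-P.T) * P.self.H P.ones * (P.self.H (-P.ones) * P.self.X P.T) * a *
            (P.self.X (-P.T) * P.self.H P.ones * (P.self.H (-P.ones) * P.self.X P.T)) := by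
              simp only [mul_assoc]
        _ = a := by rw [hinv', one_mul, mul_one]
  exact ⟨h.1.of_comp, h.2.of_comp⟩

end Model
namespace Model

variable {k : Type*} [Field k] {m θ : ℕ} [NeZero m] (P : Datum k m θ)

/-! ### The Hopf algebra and its structure maps -/

/-- The Hopf algebra structure on `D(m̲, d, γ)`. -/
noncomputable abbrev hopfAlgebra : HopfAlgebra k P.Alg where
  toBialgebra := Bialgebra.ofAlgHom (comulHom P) (counitHom P) (coassoc P) (rTensor_counit P)
    (lTensor_counit P)
  antipode := antipodeMap P
  mul_antipode_rTensor_comul := LinearMap.ext fun a => leftConv_comul P a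
  mul_antipode_lTensor_comul := LinearMap.ext fun a => rightConv_comul P a

theorem gUnit_zpow (n : ℤ) : (↑(P.gUnit ^ n) : P.Alg) = P.self.X (n * P.d) * P.self.H n := by
  have h : P.gUnit = P.self.x ^ (P.d : ℤ) * P.self.h := Units.ext self_of_g
  have hc : Commute P.self.x P.self.h := P.self.x_h
  rw [h, (hc.zpow_left _).mul_zpow, ← zpow_mul, Units.val_mul, ← H_intCast, X, mul_comm n]

theorem of_g_pow (n : ℕ) : P.of .g ^ n = P.self.X (n * P.d) * P.self.H n := by
  rw [P.of_g, ← Units.val_pow_eq_pow_val, ← zpow_natCast, gUnit_zpow, Int.cast_natCast]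

theorem of_ginv_pow (n : ℕ) : P.of .ginv ^ n = P.self.X (-(n * P.d)) * P.self.H (-n) := by
  have h := gUnit_zpow P (-n)
  rw [zpow_neg, ← inv_zpow, zpow_natCast, Units.val_pow_eq_pow_val, Int.cast_neg, Int.cast_natCast,
    neg_mul] at h
  exact h

theorem of_xinv_pow (n : ℕ) : P.of .xinv ^ n = P.self.X (-n) := (P.self.X_neg_natCast n).symm

theorem sum_zmod_eq_sum_range {B : Type*} [AddCommMonoid B] (f : ZMod m → B) :
    ∑ s, f s = ∑ s ∈ Finset.range m, f s :=
  Finset.sum_nbij' ZMod.val (fun s => (s : ZMod m)) (fun s _ => Finset.mem_range.2 (ZMod.val_lt s))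
    (fun _ _ => Finset.mem_univ _) (fun s _ => ZMod.natCast_zmod_val s)
    (fun _ hs => ZMod.val_cast_of_lt (Finset.mem_range.1 hs))
    (fun s _ => by rw [ZMod.natCast_zmod_val])

theorem hasStructureMaps :
    letI := hopfAlgebra P
    HasStructureMaps (k := k) m P.d P.M P.γ P.ξ (P.of .x) (P.of .xinv) (P.of .g) (P.of .ginv)
      (fun i => P.of (.y i)) (fun j => P.of (.u j)) := by
  let _ := hopfAlgebra P
  exact {
    comul_x := by
      change comulHom P (P.of .x) = _
      rw [self_of_x, comulHom_X]
    comul_g := by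
      change comulHom P (P.of .g) = _
      rw [self_of_g, map_mul, comulHom_X, comulHom_h, Algebra.TensorProduct.tmul_mul_tmul]
    comul_y := fun i => by
      rw [of_g_pow]
      exact comulHom_y P i
    comul_u := fun j => by
      change comulHom P (P.self.u j) = _
      rw [comulHom_u, sum_zmod_eq_sum_range]
      refine Finset.sum_congr rfl fun s _ => ?_
      rw [of_xinv_pow, of_g_pow, ← mul_assoc (P.self.X _), ← X_add, ← P.χ_intCast]
      push_cast
      rw [neg_add_cancel, X_zero, one_mul, ZMod.natCast_zmod_val]
      rfl
    counit_x := by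
      change counitHom P (P.of .x) = _
      rw [self_of_x, counitHom_X]
    counit_g := by
      change counitHom P (P.of .g) = _
      rw [self_of_g, map_mul, counitHom_X, counitHom_h, one_mul]
    counit_y := fun i => counitHom_y P i
    counit_u_zero := (counitHom_u P 0).trans (if_pos rfl)
    counit_u := fun j hj => (counitHom_u P j).trans (if_neg hj)
    antipode_x := by
      change antipodeMap P (P.of .x) = _
      rw [self_of_x, antipodeMap_X, self_of_xinv]
    antipode_g := by
      change antipodeMap P (P.of .g) = _
      rw [self_of_g, ← H_one, antipodeMap_mul, antipodeMap_X, antipodeMap_H, self_of_ginv, h_inv_eq]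
    antipode_y := fun i => by
      change antipodeMap P (P.self.y i) = -(P.self.y i * _)
      rw [antipodeMap_y, of_ginv_pow, ← H_X, y_mul_antipode_K, neg_neg]
    antipode_u := fun j => by
      change antipodeMap P (P.self.u j) = _
      have hdeg : ((∑ i, (coord m P.M j i : ℤ) * P.M i : ℤ) : ZMod m) = j := by
        have := P.deg_cast j
        rw [Datum.deg] at this
        push_cast at this ⊢
        exact this
      have hx (n : ℤ) : intPow (P.of .x) (P.of .xinv) n = P.self.X n := intPow_units P.xUnit n
      have hg (n : ℤ) : intPow (P.of .g) (P.of .ginv) n = P.self.X (n * P.d) * P.self.H n :=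
        (intPow_units P.gUnit n).trans (gUnit_zpow P n)
      rw [antipodeMap_u, antipodeU, P.antipodeCoeff_eq, hx, hg]
      rw [← mul_assoc (P.self.X _), ← mul_assoc (P.self.X _), ← X_add, ← Finset.sum_mul]
      congr 4
      · rw [Datum.T]
        ring
      · rw [Int.cast_sub, hdeg]
        simp
    antipode_bijective := antipodeMap_bijective P }

end Model
end FracHopf

open FracHopf in
theorem proposition4p7 {k : Type*} [Field k] [IsAlgClosed k] [CharZero k]
    (m d : ℕ) (hd : 0 < d) {θ : ℕ} (M : Fin θ → ℕ) (hM : IsFraction m M)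
    (hpar₁ : (2 : ℤ) ∣ ∑ i, ((M i : ℤ) - 1) * ((exponent m (M i) : ℤ) - 1))
    (hpar₂ : (2 : ℤ) ∣ ∑ i, ((exponent m (M i) : ℤ) - 1) * M i * d)
    (γ : k) (hγ : IsPrimitiveRoot γ m)
    (ξ : Fin θ → k) (hξ_sq : ∀ i, ξ i ^ 2 = γ ^ M i)
    (hξ_pow : ∀ i, ξ i ^ exponent m (M i) = -1) :
    -- a Hopf algebra structure whose underlying algebra is the given quotient algebra
    ∃ H : HopfAlgebra k (D m d M γ ξ),
      H.toAlgebra = RingQuot.instAlgebra (Rel m d M γ ξ) ∧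
      HasStructureMaps (k := k) m d M γ ξ (A := D m d M γ ξ)
        (D.of m d M γ ξ .x) (D.of m d M γ ξ .xinv)
        (D.of m d M γ ξ .g) (D.of m d M γ ξ .ginv)
        (fun i => D.of m d M γ ξ (.y i)) (fun j => D.of m d M γ ξ (.u j)) := by
  have : NeZero m := ⟨hM.pos.ne'⟩
  let P : Datum k m θ := ⟨d, M, γ, ξ, hM, hpar₂, hγ, hξ_sq, hξ_pow⟩
  exact ⟨Model.hopfAlgebra P, rfl, Model.hasStructureMaps P⟩
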